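/- Manifolds are smooth and Hausdorff. Let $n,d\ge 0$ be integers, let $X$ be a $d$-dimensional manifold, and let smooth functions $C_{ij}^k$ ($1\le i,j,k\le n$) and smooth vector fields $F_1,\dots,F_n$ on $X$ be given. A \emph{realization} of these data is a triple $(M,\theta,h)$ consisting of an $n$-dimensional manifold $M$, a coframe $\theta=(\theta^1,\dots,\theta^n)$ on $M$ and a smooth map $h:M\to X$ such that $$d\theta^k=\sum_{i<j}(C_{ij}^k\circ h)\,\theta^i\wedge\theta^j,\qquad dh=\sum_i (F_i\circ h)\,\theta^i .$$ Assume that the data determine a Lie algebroid $A=X\times\mathbb R^n\to X$ with bracket $[e_i,e_j]=-\sum_k C_{ij}^k e_k$ and anchor $\sharp e_i=F_i$ (the \emph{classifying Lie algebroid}), and that $A$ is \emph{weakly integrable}: for each orbit $L$ of $A$, regarded as an immersed submanifold of $X$, the restriction $A|_L$ is integrable, i.e. isomorphic to the Lie algebroid of a Lie groupoid over $L$. Lie groupoids need not be Hausdorff, but their source fibers are. For a Lie groupoid $\mathcal G$ with source $\mathbf s$ and target $\mathbf t$ that integrates $A|_L$, each source fiber $\mathbf s^{-1}(x)$ is a realization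 $(\mathbf s^{-1}(x),\omega_{MC},\mathbf t)$, where $\omega_{MC}(\xi)=d_gR_{g^{-1}}\xi$ is the right-invariant Maurer--Cartan form. \textbf{Theorem.} Let $(M,\theta,h)$ be a realization with $M$ connected and non-empty. Then $h(M)$ is contained in an orbit $L$ of $A$. There is a Lie groupoid integrating $A|_L$, and for every Lie groupoid $\mathcal G$ integrating $A|_L$ the realization $(M,\theta,h)$ is globally equivalent, up to covering, to an open subset $V$ of an $\mathbf s$-fiber of $\mathcal G$, in the following sense: there are $x\in L$, an open subset $V\subset\mathbf s^{-1}(x)$, a connected $n$-dimensional manifold $N$, and surjective local diffeomorphisms $\pi_1:N\to M$ and $\pi_2:N\to V$ such that $$\pi_1^*\theta=\pi_2^*\omega_{MC},\qquad h\circ\pi_1=\mathbf t\circ\pi_2 ,$$ so that with this coframe and this map to $X$ the manifold $N$ is a common realization cover of $M$ and $V$; moreover $\pi_1$ is a covering map in the topological sense. (The map $\pi_2$ need not be evenly covered.) -/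

import Mathlib

open scoped Manifold ContDiff Topology

universe u v

/- On a model space this instance agrees, by definition, with `chartedSpaceSelf`; removing it makes
instance search return the latter. -/
attribute [-instance] TopCat.of.chartedSpace

namespace CartanRealization

/-! ### One-forms and their exterior derivative -/

section Forms

variable {n : ℕ} {M : Type*} [TopologicalSpace M] [ChartedSpace (EuclideanSpace ℝ (Fin n)) M]

/-- The representative, in the chart of `M` at `p`, of a one-form `θ` with values in `ℝᵏ`. -/
noncomputable def chartForm {k : ℕ}
    (θ : ∀ p : M, TangentSpace (𝓡 n) p →L[ℝ] (Fin k → ℝ)) (p : M)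
    (y : EuclideanSpace ℝ (Fin n)) : EuclideanSpace ℝ (Fin n) →L[ℝ] (Fin k → ℝ) :=
  (θ ((extChartAt (𝓡 n) p).symm y)).comp
    (mfderiv 𝓘(ℝ, EuclideanSpace ℝ (Fin n)) (𝓡 n) (extChartAt (𝓡 n) p).symm y)

/-- The exterior derivative `(dθ)_p (v, w)` of a one-form, computed in the chart at `p` as
`D_v θ(w) - D_w θ(v)`. In Mathlib `TangentSpace (𝓡 n) p` is the model space, the identification
being the derivative at `p` of the chart at `p`; so `v`, `w` need no change of coordinates. -/
noncomputable def extDerivOneForm {k : ℕ}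
    (θ : ∀ p : M, TangentSpace (𝓡 n) p →L[ℝ] (Fin k → ℝ)) (p : M)
    (v w : TangentSpace (𝓡 n) p) : Fin k → ℝ :=
  let D := fderiv ℝ (chartForm θ p) (extChartAt (𝓡 n) p p)
  D v w - D w v

end Forms

/-! ### The realization problem and its classifying Lie algebroid -/

/-- Initial data of a Cartan realization problem on a `d`-dimensional manifold `X`: functions
`C i j k` (written `C_{ij}^k`) and vector fields `F i`, all smooth. -/
structure CartanData (n d : ℕ) (X : Type*) [TopologicalSpace X]
    [ChartedSpace (EuclideanSpace ℝ (Fin d)) X] [IsManifold (𝓡 d) ∞ X] where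
  C : Fin n → Fin n → Fin n → X → ℝ
  F : Fin n → ∀ x : X, TangentSpace (𝓡 d) x
  contMDiff_C : ∀ i j k, ContMDiff (𝓡 d) 𝓘(ℝ, ℝ) ∞ (C i j k)
  contMDiff_F : ∀ i, ContMDiff (𝓡 d) (𝓡 d).tangent ∞
    (fun x => (⟨x, F i x⟩ : TangentBundle (𝓡 d) X))

namespace CartanData

variable {n d : ℕ} {X : Type*} [TopologicalSpace X] [ChartedSpace (EuclideanSpace ℝ (Fin d)) X]
  [IsManifold (𝓡 d) ∞ X] (D : CartanData n d X)

/-- The anchor `♯ : X × ℝⁿ → TX`, with `♯ (x, eᵢ) = Fᵢ x`. -/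
noncomputable def anchor (x : X) (a : Fin n → ℝ) : TangentSpace (𝓡 d) x :=
  ∑ i, a i • D.F i x

/-- The derivative `L_{♯(x, a)} f` at `x` of a function `f : X → ℝⁿ` along the anchor. -/
noncomputable def derivAlong (f : X → Fin n → ℝ) (x : X) (a : Fin n → ℝ) : Fin n → ℝ :=
  mfderiv (𝓡 d) 𝓘(ℝ, Fin n → ℝ) f x (D.anchor x a)

/-- The bracket of two sections of the trivial bundle `X × ℝⁿ`: the extension of
`[eᵢ, eⱼ] = - ∑ₖ C_{ij}^k eₖ` by the Leibniz rule. -/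
noncomputable def bracket (α β : X → Fin n → ℝ) (x : X) : Fin n → ℝ := fun k =>
  (∑ i, ∑ j, -(D.C i j k x * α x i * β x j))
    + D.derivAlong β x (α x) k - D.derivAlong α x (β x) k

/-- The initial data determine a Lie algebroid `A = X × ℝⁿ`, the classifying Lie algebroid: the
bracket on smooth sections is a Lie bracket. (The Leibniz rule holds by construction.) -/
structure IsLieAlgebroid : Prop where
  alternating : ∀ α : X → Fin n → ℝ, ContMDiff (𝓡 d) 𝓘(ℝ, Fin n → ℝ) ∞ α →
    ∀ x, D.bracket α α x = 0
  jacobi : ∀ α β γ : X → Fin n → ℝ,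
    ContMDiff (𝓡 d) 𝓘(ℝ, Fin n → ℝ) ∞ α → ContMDiff (𝓡 d) 𝓘(ℝ, Fin n → ℝ) ∞ β →
    ContMDiff (𝓡 d) 𝓘(ℝ, Fin n → ℝ) ∞ γ → ∀ x,
    D.bracket α (D.bracket β γ) x + D.bracket β (D.bracket γ α) x
      + D.bracket γ (D.bracket α β) x = 0

/-- `x` and `y` are joined by a smooth `A`-path: a smooth `a : [0,1] → ℝⁿ` with a base path `γ`
from `x` to `y` such that `γ' = ♯ (γ, a)`. -/
def JoinedByPath (x y : X) : Prop :=
  ∃ (γ : ℝ → X) (a : ℝ → Fin n → ℝ), ContDiffOn ℝ ∞ a (Set.Icc 0 1) ∧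
    (∀ t ∈ Set.Icc (0 : ℝ) 1, HasMFDerivWithinAt 𝓘(ℝ, ℝ) (𝓡 d) γ (Set.Icc 0 1) t
      (ContinuousLinearMap.toSpanSingleton ℝ (D.anchor (γ t) (a t)))) ∧
    γ 0 = x ∧ γ 1 = y

/-- The orbit of `x`: the points reached from `x` by finite concatenations of `A`-paths. -/
def orbit (x : X) : Set X := {y | Relation.EqvGen D.JoinedByPath x y}

end CartanData

/-- A realization `(M, θ, h)`: a coframe `θ` on the `n`-dimensional manifold `M`, viewed as a
one-form with values in `ℝⁿ`, and a map `h : M → X`, with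
`dθᵏ = ∑_{i<j} (C_{ij}^k ∘ h) θⁱ ∧ θʲ` and `dh = ∑ᵢ (Fᵢ ∘ h) θⁱ`. -/
structure Realization {n d : ℕ} {X : Type*} [TopologicalSpace X]
    [ChartedSpace (EuclideanSpace ℝ (Fin d)) X] [IsManifold (𝓡 d) ∞ X] (D : CartanData n d X)
    (M : Type*) [TopologicalSpace M] [ChartedSpace (EuclideanSpace ℝ (Fin n)) M]
    [IsManifold (𝓡 n) ∞ M] where
  θ : ∀ p : M, TangentSpace (𝓡 n) p →L[ℝ] (Fin n → ℝ)
  h : M → X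
  contMDiff_θ : ContMDiff (𝓡 n).tangent 𝓘(ℝ, Fin n → ℝ) ∞
    (fun v : TangentBundle (𝓡 n) M => θ v.1 v.2)
  contMDiff_h : ContMDiff (𝓡 n) (𝓡 d) ∞ h
  coframe : ∀ p, Function.Bijective (θ p)
  structure_θ : ∀ (p : M) (v w : TangentSpace (𝓡 n) p) (k : Fin n),
    extDerivOneForm θ p v w k =
      ∑ i, ∑ j ∈ Finset.Ioi i, D.C i j k (h p) * (θ p v i * θ p w j - θ p v j * θ p w i)
  structure_h : ∀ (p : M) (v : TangentSpace (𝓡 n) p),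
    mfderiv (𝓡 n) (𝓡 d) h p v = D.anchor (h p) (θ p v)

/-! ### Orbits as manifolds, and the restriction of the Lie algebroid to an orbit -/

/-- The orbit `L` of `x₀` as an immersed submanifold of `X` (with its leaf topology), together with
the restriction `A|_L` of the Lie algebroid: the trivial bundle `L × ℝⁿ` with the restricted
structure functions and the vector fields on `L` to which the `Fᵢ` restrict. -/
structure OrbitManifold {n d : ℕ} {X : Type u} [TopologicalSpace X]
    [ChartedSpace (EuclideanSpace ℝ (Fin d)) X] [IsManifold (𝓡 d) ∞ X] (D : CartanData n d X) (x₀ : X) where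
  dim : ℕ
  carrier : Type u
  topology : TopologicalSpace carrier
  charted : ChartedSpace (EuclideanSpace ℝ (Fin dim)) carrier
  manifold : IsManifold (𝓡 dim) ∞ carrier
  incl : carrier → X
  immersion : Manifold.IsImmersion (𝓡 dim) (𝓡 d) ∞ incl
  injective : Function.Injective incl
  range_incl : Set.range incl = D.orbit x₀
  restriction : CartanData n dim carrier
  restriction_C : ∀ i j k p, restriction.C i j k p = D.C i j k (incl p)
  restriction_F : ∀ i p, mfderiv (𝓡 dim) (𝓡 d) incl p (restriction.F i p) = D.F i (incl p)
  tangent_eq : ∀ (p : carrier) (v : TangentSpace (𝓡 dim) p), ∃ a, restriction.anchor p a = v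

attribute [instance] OrbitManifold.topology OrbitManifold.charted OrbitManifold.manifold

/-! ### Lie groupoids -/

/-- A Lie groupoid `G ⇉ L` (not necessarily Hausdorff, with Hausdorff source fibers). Arrows compose
from right to left: `mul g k` is meaningful when `src g = tgt k`, and takes irrelevant values
otherwise. The composable pairs form an embedded submanifold of `G × G`, on which `mul` is
smooth. -/
structure LieGroupoid (r m : ℕ) (L G : Type*) [TopologicalSpace L]
    [ChartedSpace (EuclideanSpace ℝ (Fin r)) L] [TopologicalSpace G]
    [ChartedSpace (EuclideanSpace ℝ (Fin m)) G] where
  src : G → L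
  tgt : G → L
  one : L → G
  inv : G → G
  mul : G → G → G
  src_one : ∀ x, src (one x) = x
  tgt_one : ∀ x, tgt (one x) = x
  src_inv : ∀ g, src (inv g) = tgt g
  tgt_inv : ∀ g, tgt (inv g) = src g
  src_mul : ∀ g k, src g = tgt k → src (mul g k) = src k
  tgt_mul : ∀ g k, src g = tgt k → tgt (mul g k) = tgt g
  mul_assoc : ∀ g k l, src g = tgt k → src k = tgt l → mul (mul g k) l = mul g (mul k l)
  one_mul : ∀ g, mul (one (tgt g)) g = g
  mul_one : ∀ g, mul g (one (src g)) = g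
  inv_mul : ∀ g, mul (inv g) g = one (src g)
  mul_inv : ∀ g, mul g (inv g) = one (tgt g)
  submersion_src : Manifold.IsSubmersion (𝓡 m) (𝓡 r) ∞ src
  submersion_tgt : Manifold.IsSubmersion (𝓡 m) (𝓡 r) ∞ tgt
  contMDiff_one : ContMDiff (𝓡 r) (𝓡 m) ∞ one
  contMDiff_inv : ContMDiff (𝓡 m) (𝓡 m) ∞ inv
  contMDiffOn_mul : ContMDiffOn ((𝓡 m).prod (𝓡 m)) (𝓡 m) ∞
    (fun q : G × G => mul q.1 q.2) {q | src q.1 = tgt q.2}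
  t2_fiber : ∀ x, T2Space (src ⁻¹' {x})

namespace LieGroupoid

variable {r m : ℕ} {L G : Type*} [TopologicalSpace L]
  [ChartedSpace (EuclideanSpace ℝ (Fin r)) L] [TopologicalSpace G]
  [ChartedSpace (EuclideanSpace ℝ (Fin m)) G] (𝒢 : LieGroupoid r m L G)

/-- The differential at `g` of the right translation
`R_k : s⁻¹(t k) → s⁻¹(s k)`, `R_k g = g k`. It is only ever applied to vectors tangent to the source
fiber `s⁻¹(t k)`, where the derivative within the fiber is uniquely determined. -/
noncomputable def dRight (k g : G) : TangentSpace (𝓡 m) g →L[ℝ] TangentSpace (𝓡 m) (𝒢.mul g k) :=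
  mfderivWithin (𝓡 m) (𝓡 m) (fun g' => 𝒢.mul g' k) (𝒢.src ⁻¹' {𝒢.tgt k}) g

/-- The Maurer-Cartan form `ξ ↦ d_g R_{g⁻¹} ξ ∈ A(G)_{t(g)}` for `ξ` tangent at `g` to the source
fiber of `g`. Its values lie in the tangent space at `g g⁻¹ = 1_{t(g)}`. -/
noncomputable def maurerCartan (g : G) (ξ : TangentSpace (𝓡 m) g) :
    TangentSpace (𝓡 m) (𝒢.one (𝒢.tgt g)) :=
  𝒢.dRight (𝒢.inv g) g ξ

/-- The right-invariant vector field on `G` determined by a family `a x ∈ A(G)_x` of vectors tangent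
at the units to the source fibers: its value at `g` is `d R_g (a (t g))`, a vector tangent at
`1_{t(g)} g = g`. -/
noncomputable def rightInvariant (a : ∀ x : L, TangentSpace (𝓡 m) (𝒢.one x)) (g : G) :
    TangentSpace (𝓡 m) g :=
  (𝒢.dRight g (𝒢.one (𝒢.tgt g)) (a (𝒢.tgt g)) : EuclideanSpace ℝ (Fin m))

end LieGroupoid

/-- A Lie groupoid `G ⇉ L` integrating the Lie algebroid `L × ℝⁿ` determined by `E`: an isomorphism
`iso` of vector bundles over `L` from `L × ℝⁿ` to the Lie algebroid `A(G) = ker ds|_L` of `G`, which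
preserves anchors (the anchor of `A(G)` being `dt`) and brackets (the bracket of `A(G)` being that of
the right-invariant vector fields extending sections). -/
structure Integration {n r : ℕ} {L : Type u} [TopologicalSpace L]
    [ChartedSpace (EuclideanSpace ℝ (Fin r)) L] [IsManifold (𝓡 r) ∞ L] (E : CartanData n r L) where
  dim : ℕ
  arrows : Type u
  topology : TopologicalSpace arrows
  charted : ChartedSpace (EuclideanSpace ℝ (Fin dim)) arrows
  manifold : IsManifold (𝓡 dim) ∞ arrows
  groupoid : LieGroupoid r dim L arrows
  iso : ∀ x : L, (Fin n → ℝ) →L[ℝ] TangentSpace (𝓡 dim) (groupoid.one x)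
  contMDiff_iso : ContMDiff ((𝓡 r).prod 𝓘(ℝ, Fin n → ℝ)) (𝓡 dim).tangent ∞
    (fun q : L × (Fin n → ℝ) =>
      (⟨groupoid.one q.1, iso q.1 q.2⟩ : TangentBundle (𝓡 dim) arrows))
  injective_iso : ∀ x, Function.Injective (iso x)
  range_iso : ∀ (x : L) (ξ : TangentSpace (𝓡 dim) (groupoid.one x)),
    (∃ a, iso x a = ξ) ↔ mfderiv (𝓡 dim) (𝓡 r) groupoid.src (groupoid.one x) ξ = 0
  anchor_iso : ∀ (x : L) (a : Fin n → ℝ),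
    mfderiv (𝓡 dim) (𝓡 r) groupoid.tgt (groupoid.one x) (iso x a) = E.anchor x a
  bracket_iso : ∀ α β : L → Fin n → ℝ,
    ContMDiff (𝓡 r) 𝓘(ℝ, Fin n → ℝ) ∞ α → ContMDiff (𝓡 r) 𝓘(ℝ, Fin n → ℝ) ∞ β → ∀ g : arrows,
    VectorField.mlieBracket (𝓡 dim) (groupoid.rightInvariant fun x => iso x (α x))
      (groupoid.rightInvariant fun x => iso x (β x)) g
      = groupoid.rightInvariant (fun x => iso x (E.bracket α β x)) g

attribute [instance] Integration.topology Integration.charted Integration.manifold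

/-- The Lie algebroid is weakly integrable: its restriction to each orbit is integrable. -/
def CartanData.WeaklyIntegrable {n d : ℕ} {X : Type u} [TopologicalSpace X]
    [ChartedSpace (EuclideanSpace ℝ (Fin d)) X] [IsManifold (𝓡 d) ∞ X] (D : CartanData n d X) : Prop :=
  ∀ x₀ : X, ∃ O : OrbitManifold D x₀, Nonempty (Integration O.restriction)

/-! ### Source fibers as realizations -/

/-- The source fiber `s⁻¹(x)` of a Lie groupoid `G ⇉ L` integrating `A|_L`, as an `n`-dimensional
embedded submanifold of `G`, with its structure of realization `(s⁻¹(x), ω_MC, t)`. -/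
structure SourceFiber {n d : ℕ} {X : Type u} [TopologicalSpace X]
    [ChartedSpace (EuclideanSpace ℝ (Fin d)) X] [IsManifold (𝓡 d) ∞ X] {D : CartanData n d X} {x₀ : X}
    {O : OrbitManifold D x₀} (𝒢 : Integration O.restriction) (x : O.carrier) where
  carrier : Type u
  topology : TopologicalSpace carrier
  charted : ChartedSpace (EuclideanSpace ℝ (Fin n)) carrier
  manifold : IsManifold (𝓡 n) ∞ carrier
  incl : carrier → 𝒢.arrows
  embedding : Manifold.IsSmoothEmbedding (𝓡 n) (𝓡 𝒢.dim) ∞ incl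
  range_incl : Set.range incl = 𝒢.groupoid.src ⁻¹' {x}
  realization : Realization D carrier
  realization_h : ∀ q, realization.h q = O.incl (𝒢.groupoid.tgt (incl q))
  realization_θ : ∀ (q : carrier) (v : TangentSpace (𝓡 n) q),
    𝒢.iso (𝒢.groupoid.tgt (incl q)) (realization.θ q v)
      = 𝒢.groupoid.maurerCartan (incl q) (mfderiv (𝓡 n) (𝓡 𝒢.dim) incl q v)

attribute [instance] SourceFiber.topology SourceFiber.charted SourceFiber.manifold

/-! ### Equivalence up to covering -/

section Equivalence

variable {n d : ℕ} {X : Type*} [TopologicalSpace X]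
  [ChartedSpace (EuclideanSpace ℝ (Fin d)) X] [IsManifold (𝓡 d) ∞ X] {D : CartanData n d X}
  {N : Type*} [TopologicalSpace N] [ChartedSpace (EuclideanSpace ℝ (Fin n)) N]
  [IsManifold (𝓡 n) ∞ N]
  {M : Type*} [TopologicalSpace M] [ChartedSpace (EuclideanSpace ℝ (Fin n)) M]
  [IsManifold (𝓡 n) ∞ M]

/-- `π : N → M` is a local diffeomorphism whose image is the open subset `V` of `M`, and the
realization on `N` is `(N, π^*θ, π^*h)`. -/
structure IsCoverOnto (R' : Realization D N) (R : Realization D M) (π : N → M)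
    (V : TopologicalSpace.Opens M) : Prop where
  localDiffeo : IsLocalDiffeomorph (𝓡 n) (𝓡 n) ∞ π
  range_eq : Set.range π = V
  pullback_θ : ∀ (q : N) (v : TangentSpace (𝓡 n) q),
    R'.θ q v = R.θ (π q) (mfderiv (𝓡 n) (𝓡 n) π q v)
  pullback_h : ∀ q, R'.h q = R.h (π q)

end Equivalence

/-- `(M, θ, h)` is globally equivalent, up to covering, to the open subset `V` of the realization on
`S`: a connected manifold `N` carries a realization which is a realization cover both of `M`, through
a covering map in the sense of topology, and of `V`. -/
def EquivalentUpToCover {n d : ℕ} {X : Type*} [TopologicalSpace X]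
    [ChartedSpace (EuclideanSpace ℝ (Fin d)) X] [IsManifold (𝓡 d) ∞ X] {D : CartanData n d X}
    {M : Type v} [TopologicalSpace M] [ChartedSpace (EuclideanSpace ℝ (Fin n)) M]
    [IsManifold (𝓡 n) ∞ M]
    {S : Type u} [TopologicalSpace S] [ChartedSpace (EuclideanSpace ℝ (Fin n)) S]
    [IsManifold (𝓡 n) ∞ S]
    (R : Realization D M) (R_S : Realization D S) (V : TopologicalSpace.Opens S) : Prop :=
  ∃ (N : Type (max u v)) (_ : TopologicalSpace N)
    (_ : ChartedSpace (EuclideanSpace ℝ (Fin n)) N) (_ : IsManifold (𝓡 n) ∞ N)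
    (_ : T2Space N) (_ : ConnectedSpace N) (R' : Realization D N) (π₁ : N → M) (π₂ : N → S),
    IsCoveringMap π₁ ∧ IsCoverOnto R' R π₁ ⊤ ∧ IsCoverOnto R' R_S π₂ V

end CartanRealization

namespace CartanRealization

/-! ### Total differential equations -/

section TotalDE

open Set Metric

variable {E F : Type*} [NormedAddCommGroup E] [NormedSpace ℝ E] [NormedAddCommGroup F]
  [NormedSpace ℝ F]

/-! The exterior derivative of the coframe and the differential of `h` are prescribed functions of
`h` alone, so the germ of a realization is determined by one value of `h`. The proof turns this into
a developing-map argument, with the source fibers as target.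

Local step. A development of one realization along another is a map σ with σ^*θ' = θ and h' ∘ σ = h.
In charts it solves Dσ = A(x, σ) with A = θ'⁻¹ ∘ θ. The Frobenius condition compares dθ with dθ', so
it is available only on the set where h = h', which need not be a submanifold. A solution along a
radial segment nevertheless stays in that set: h and h' along it satisfy the same ordinary
differential equation, driven by the anchor. A Frobenius theorem that asks for integrability only
along radial solutions, `exists_hasFDerivAt_of_integrable`, therefore applies. It gives
`exists_isDevelopment`; with the uniqueness in `IsDevelopment.eventuallyEq`, each pair (p, p') with
h p = h' p' carries exactly one germ of development.

Source fibers. The coframe dual to the right-invariant frame is the Maurer-Cartan form. Its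
structure equation is the bracket relation of the frame (`frame_extDerivOneForm`), its equation for
`h` is the compatibility of anchors, and its smoothness rests on `contDiffAt_frameChart`.

Global step. Germs of developments from M to s⁻¹(x) form an étale space over M. Right translations
preserve the Maurer-Cartan form and the target map. Hence, if σ₀ is a development on a connected U
into s⁻¹(y), any development through a point g over q ∈ U extends to all of U as σ₀ followed by
right translation by σ₀(q)⁻¹ g (`evenlyExtends_developments`). A connected component N of the étale
space is thus a covering of M. Evaluation of germs is a local diffeomorphism from N onto an open V;
nothing forces it to be evenly covered, since M need not be complete.

That h(M) lies in one orbit is elementary: h sends chart segments to base paths of `A`-paths, and M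
is connected. -/

theorem norm_taylor_le {s : Set E} (hs : Convex ℝ s) {f : E → F} {f' : E → E →L[ℝ] F} {K : NNReal}
    (hf : ∀ x ∈ s, HasFDerivAt f (f' x) x) (hK : LipschitzOnWith K f' s) {x y : E} (hx : x ∈ s)
    (hy : y ∈ s) : ‖f y - f x - f' x (y - x)‖ ≤ K * ‖y - x‖ ^ 2 := by
  have hseg : segment ℝ x y ⊆ s := hs.segment_subset hx hy
  have := (convex_segment (𝕜 := ℝ) x y).norm_image_sub_le_of_norm_hasFDerivWithin_le' (f := f)
    (f' := f') (φ := f' x) (C := K * ‖y - x‖)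
    (fun z hz => (hf z (hseg hz)).hasFDerivWithinAt) (fun z hz => ?_)
    (left_mem_segment ℝ x y) (right_mem_segment ℝ x y)
  · calc _ ≤ K * ‖y - x‖ * ‖y - x‖ := this
      _ = _ := by ring
  · have h1 := hK.dist_le_mul z (hseg hz) x hx
    rw [dist_eq_norm, dist_eq_norm] at h1
    refine h1.trans (mul_le_mul_of_nonneg_left ?_ K.2)
    have := norm_sub_le_of_mem_segment hz
    simpa using this

/-- Linearity in the inhomogeneous term lets a factor ‖δ‖² be pulled out of the Grönwall estimate,
leaving a constant independent of δ. -/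
theorem gronwallBound_zero_mul (K ε x : ℝ) :
    gronwallBound 0 K ε x = ε * gronwallBound 0 K 1 x := by
  unfold gronwallBound
  split_ifs <;> ring

/-- Two solutions of `Df = A(x, f)` along nearby radial segments differ to first order by `A`, when
the integrability condition holds along the first of them. -/
theorem norm_radial_sub_le {A : E × F → E →L[ℝ] F} {A' : E × F → E × F →L[ℝ] E →L[ℝ] F}
    {s : Set (E × F)} (hs : Convex ℝ s) (hA : ∀ z ∈ s, HasFDerivAt A (A' z) z) {C L : ℝ}
    {K : NNReal} (hC : ∀ z ∈ s, ‖A z‖ ≤ C) (hL : ∀ z ∈ s, ‖A' z‖ ≤ L)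
    (hK : LipschitzOnWith K A' s) {x₀ v δ : E} (hv : ‖v + δ‖ ≤ 1) {B : ℝ} {u₁ u₂ : ℝ → F}
    (h0 : u₁ 0 = u₂ 0) (h₁ : ∀ t ∈ Icc (0 : ℝ) 1, (x₀ + t • v, u₁ t) ∈ s)
    (h₂ : ∀ t ∈ Icc (0 : ℝ) 1, (x₀ + t • (v + δ), u₂ t) ∈ s)
    (hB : ∀ t ∈ Icc (0 : ℝ) 1, ‖u₂ t - u₁ t‖ + ‖A (x₀ + t • v, u₁ t) δ‖ ≤ B)
    (d₁ : ∀ t ∈ Icc (0 : ℝ) 1,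
      HasDerivWithinAt u₁ (A (x₀ + t • v, u₁ t) v) (Icc 0 1) t)
    (d₂ : ∀ t ∈ Icc (0 : ℝ) 1,
      HasDerivWithinAt u₂ (A (x₀ + t • (v + δ), u₂ t) (v + δ)) (Icc 0 1) t)
    (hint : ∀ t ∈ Icc (0 : ℝ) 1,
      A' (x₀ + t • v, u₁ t) (v, A (x₀ + t • v, u₁ t) v) δ
        = A' (x₀ + t • v, u₁ t) (δ, A (x₀ + t • v, u₁ t) δ) v) :
    ‖u₂ 1 - u₁ 1 - A (x₀ + v, u₁ 1) δ‖ ≤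
      (2 * K * (1 + C) ^ 2 + L * (1 + C)) * gronwallBound 0 (L + 2 * K * B) 1 1 * ‖δ‖ ^ 2 := by
  set p : ℝ → E × F := fun t => (x₀ + t • v, u₁ t) with hp
  set q : ℝ → E × F := fun t => (x₀ + t • (v + δ), u₂ t) with hq
  have hps : (0 : ℝ) ∈ Icc (0 : ℝ) 1 := ⟨le_rfl, zero_le_one⟩
  have hC0 : 0 ≤ C := (norm_nonneg _).trans (hC _ (h₁ 0 hps))
  have hL0 : 0 ≤ L := (norm_nonneg (A' (p 0))).trans (hL _ (h₁ 0 hps))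
  have hdp : ∀ t ∈ Icc (0 : ℝ) 1, HasDerivWithinAt p (v, A (p t) v) (Icc 0 1) t := by
    intro t ht
    refine HasDerivWithinAt.prodMk ?_ (d₁ t ht)
    simpa using ((hasDerivWithinAt_id t _).smul_const v).const_add x₀
  -- The error of the expected first-order variation t ↦ t A(p t) δ of the radial solution. It
  -- vanishes at t = 0 and will be shown to satisfy a Grönwall inequality with source term of order
  -- ‖δ‖².
  set w : ℝ → F := fun t => u₂ t - u₁ t - t • A (p t) δ with hw
  set w' : ℝ → F := fun t => A (q t) (v + δ) - A (p t) v -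
    (t • A' (p t) (v, A (p t) v) δ + (1 : ℝ) • A (p t) δ) with hw'
  have hdw : ∀ t ∈ Icc (0 : ℝ) 1, HasDerivWithinAt w (w' t) (Icc 0 1) t := by
    intro t ht
    refine ((d₂ t ht).sub (d₁ t ht)).sub ?_
    have h1 : HasDerivWithinAt (fun t => A (p t)) (A' (p t) (v, A (p t) v)) (Icc 0 1) t :=
      (hA _ (h₁ t ht)).comp_hasDerivWithinAt t (hdp t ht)
    exact (hasDerivWithinAt_id t _).smul (by simpa using h1.clm_apply (hasDerivWithinAt_const t _ δ))
  have hkey : ∀ t ∈ Icc (0 : ℝ) 1, ‖w' t‖ ≤ (L + 2 * K * B) * ‖w t‖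
      + (2 * K * (1 + C) ^ 2 + L * (1 + C)) * ‖δ‖ ^ 2 := by
    intro t ht
    set Δ : E × F := q t - p t with hΔ
    have hΔ2 : Δ = (t • δ, t • A (p t) δ + w t) := by
      simp only [hΔ, hq, hp, hw]
      ext <;> simp
    have hsplit : A' (p t) Δ = t • A' (p t) (δ, A (p t) δ) + A' (p t) (0, w t) := by
      have : Δ = t • (δ, A (p t) δ) + ((0 : E), w t) := by rw [hΔ2]; simp
      rw [this, map_add, map_smul]
    set R := A (q t) - A (p t) - A' (p t) Δ with hR
    have hRn : ‖R‖ ≤ K * ‖Δ‖ ^ 2 := norm_taylor_le hs hA hK (h₁ t ht) (h₂ t ht)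
    have hAq : A (q t) = A (p t) + R + (t • A' (p t) (δ, A (p t) δ) + A' (p t) (0, w t)) := by
      rw [← hsplit, hR]; abel
    -- After Taylor expansion of A at p t, the terms linear in δ are t A'(δ, Aδ) v and -t A'(v, Av)
    -- δ. Integrability makes them cancel; what remains is linear in w or quadratic.
    have hw'eq : w' t = A' (p t) (0, w t) (v + δ) + R (v + δ)
        + t • A' (p t) (δ, A (p t) δ) δ := by
      have hi : A' (p t) (v, A (p t) v) δ = A' (p t) (δ, A (p t) δ) v := hint t ht
      simp only [hw', hi, hAq, add_apply, smul_apply, map_add]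
      module
    have hAδ : ‖A (p t) δ‖ ≤ C * ‖δ‖ := (A (p t)).le_of_opNorm_le (hC _ (h₁ t ht)) δ
    have ht1 : ‖t‖ ≤ 1 := by rw [Real.norm_eq_abs, abs_of_nonneg ht.1]; exact ht.2
    have hsm : ∀ y : F, ‖t • y‖ ≤ ‖y‖ := fun y => by
      rw [norm_smul]; exact mul_le_of_le_one_left (norm_nonneg _) ht1
    have hδn := norm_nonneg δ
    have hwn := norm_nonneg (w t)
    have hwB : ‖w t‖ ≤ B := by
      refine le_trans (norm_sub_le _ _) (le_trans ?_ (hB t ht))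
      exact add_le_add_right (hsm _) _
    have hΔn : ‖Δ‖ ≤ (1 + C) * ‖δ‖ + ‖w t‖ := by
      rw [hΔ2, Prod.norm_mk]
      refine max_le ?_ ?_
      · have : ‖t • δ‖ ≤ ‖δ‖ := by
          rw [norm_smul]; exact mul_le_of_le_one_left (norm_nonneg _) ht1
        nlinarith
      · have := norm_add_le (t • A (p t) δ) (w t)
        have := hsm (A (p t) δ)
        nlinarith
    -- The a priori bound ‖w‖ ≤ B turns ‖w‖² into B ‖w‖, so that the Taylor remainder fits a linear
    -- differential inequality.
    have hΔsq : ‖Δ‖ ^ 2 ≤ 2 * (1 + C) ^ 2 * ‖δ‖ ^ 2 + 2 * B * ‖w t‖ := by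
      have h1 : ‖Δ‖ ^ 2 ≤ ((1 + C) * ‖δ‖ + ‖w t‖) ^ 2 := pow_le_pow_left₀ (norm_nonneg _) hΔn 2
      nlinarith [sq_nonneg ((1 + C) * ‖δ‖ - ‖w t‖), mul_le_mul_of_nonneg_right hwB hwn]
    have b1 : ‖A' (p t) (0, w t) (v + δ)‖ ≤ L * ‖w t‖ := by
      have e1 := (A' (p t) (0, w t)).le_opNorm (v + δ)
      have e2 := (A' (p t)).le_of_opNorm_le (hL _ (h₁ t ht)) (0, w t)
      have e3 : ‖((0 : E), w t)‖ = ‖w t‖ := by simp [Prod.norm_mk]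
      rw [e3] at e2
      exact e1.trans ((mul_le_of_le_one_right (norm_nonneg _) hv).trans e2)
    have b2 : ‖R (v + δ)‖ ≤ K * ‖Δ‖ ^ 2 :=
      (R.le_opNorm _).trans ((mul_le_of_le_one_right (norm_nonneg _) hv).trans hRn)
    have b3 : ‖t • A' (p t) (δ, A (p t) δ) δ‖ ≤ L * (1 + C) * ‖δ‖ ^ 2 := by
      refine (hsm _).trans ?_
      have e1 := (A' (p t) (δ, A (p t) δ)).le_opNorm δ
      have e2 := (A' (p t)).le_of_opNorm_le (hL _ (h₁ t ht)) (δ, A (p t) δ)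
      have e3 : ‖(δ, A (p t) δ)‖ ≤ (1 + C) * ‖δ‖ := by
        rw [Prod.norm_mk]
        exact max_le (by nlinarith) (by nlinarith)
      calc _ ≤ _ := e1
        _ ≤ L * ((1 + C) * ‖δ‖) * ‖δ‖ := by gcongr; exact e2.trans (by gcongr)
        _ = _ := by ring
    rw [hw'eq]
    refine (norm_add₃_le).trans ?_
    have hK0 : (0 : ℝ) ≤ K := K.2
    linarith [mul_le_mul_of_nonneg_left hΔsq hK0]
  have hmem : ∀ t ∈ Ico (0 : ℝ) 1, Icc (0 : ℝ) 1 ∈ 𝓝[Ici t] t := fun t ht =>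
    Icc_mem_nhdsGE_of_mem ht
  have hfin := norm_le_gronwallBound_of_norm_deriv_right_le (f := w) (f' := w') (δ := 0)
    (fun t ht => (hdw t ht).continuousWithinAt)
    (fun t ht => (hdw t (Ico_subset_Icc_self ht)).mono_of_mem_nhdsWithin (hmem t ht))
    (by simp [hw, h0]) (fun t ht => hkey t (Ico_subset_Icc_self ht)) 1 ⟨zero_le_one, le_rfl⟩
  rw [gronwallBound_zero_mul] at hfin
  simp only [hw, hp, one_smul, sub_zero] at hfin
  calc _ ≤ _ := hfin
    _ = _ := by ring

/-- The Picard iteration takes place among curves in the closed ball, so its fixed point stays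
there. This confinement keeps radial solutions in the region of uniform estimates. -/
theorem _root_.IsPicardLindelof.exists_hasDerivWithinAt_mem_closedBall [CompleteSpace F]
    {f : ℝ → F → F} {a b : ℝ} {t₀ : Icc a b} {x₀ : F} {r L K : NNReal}
    (hf : IsPicardLindelof f t₀ x₀ r 0 L K) :
    ∃ α : ℝ → F, α t₀ = x₀ ∧ (∀ t ∈ Icc a b, HasDerivWithinAt α (f t (α t)) (Icc a b) t) ∧
      ∀ t ∈ Icc a b, α t ∈ closedBall x₀ r := by
  have hx : x₀ ∈ closedBall x₀ ((0 : NNReal) : ℝ) := mem_closedBall_self le_rfl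
  obtain ⟨α, hα⟩ := ODE.FunSpace.exists_isFixedPt_next hf hx
  refine ⟨α.compProj, by rw [ODE.FunSpace.compProj_val, ← hα, ODE.FunSpace.next_apply₀],
    fun t ht ↦ ?_, fun t _ => α.compProj_mem_closedBall hf.mul_max_le⟩
  apply ODE.hasDerivWithinAt_picard_Icc t₀.2 hf.continuousOn_uncurry
    α.continuous_compProj.continuousOn (fun _ ht' ↦ α.compProj_mem_closedBall hf.mul_max_le)
    x₀ ht |>.congr_of_mem _ ht
  intro t' ht'
  nth_rw 1 [← hα]
  rw [ODE.FunSpace.compProj_of_mem ht', ODE.FunSpace.next_apply]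

/-- **Local solutions of a total differential equation** `Df = A(x, f)`. The integrability condition
is only needed on a set `Z` which contains the solutions along radial segments. -/
theorem exists_hasFDerivAt_of_integrable [CompleteSpace F] {A : E × F → E →L[ℝ] F} {x₀ : E} {y₀ : F}
    (hA : ContDiffAt ℝ 2 A (x₀, y₀)) {Z : Set (E × F)}
    (hint : ∀ᶠ z in 𝓝 (x₀, y₀), z ∈ Z → ∀ v w,
      fderiv ℝ A z (v, A z v) w = fderiv ℝ A z (w, A z w) v)
    (hZ : ∃ W ∈ 𝓝 (x₀, y₀), ∀ (v : E) (u : ℝ → F), u 0 = y₀ →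
      (∀ t ∈ Icc (0 : ℝ) 1, (x₀ + t • v, u t) ∈ W) →
      (∀ t ∈ Icc (0 : ℝ) 1, HasDerivWithinAt u (A (x₀ + t • v, u t) v) (Icc 0 1) t) →
      ∀ t ∈ Icc (0 : ℝ) 1, (x₀ + t • v, u t) ∈ Z) :
    ∃ f : E → F, f x₀ = y₀ ∧
      ∀ᶠ x in 𝓝 x₀, (x, f x) ∈ Z ∧ HasFDerivAt f (A (x, f x)) x := by
  obtain ⟨W, hW, hWZ⟩ := hZ
  have hd : ∀ᶠ z in 𝓝 (x₀, y₀), DifferentiableAt ℝ A z :=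
    (hA.eventually (by simp)).mono fun z hz => hz.differentiableAt (by simp)
  obtain ⟨K₁, t₁, ht₁, hK₁⟩ := ContDiffAt.exists_lipschitzOnWith (hA.of_le one_le_two)
  obtain ⟨K₂, t₂, ht₂, hK₂⟩ := ContDiffAt.exists_lipschitzOnWith
    (hA.fderiv_right (m := 1) (by norm_num))
  have hb1 : ∀ᶠ z in 𝓝 (x₀, y₀), ‖A z‖ < ‖A (x₀, y₀)‖ + 1 :=
    hA.continuousAt.norm.eventually_lt_const (by simp)
  have hb2 : ∀ᶠ z in 𝓝 (x₀, y₀), ‖fderiv ℝ A z‖ < ‖fderiv ℝ A (x₀, y₀)‖ + 1 :=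
    (hA.fderiv_right (m := 1) (by norm_num)).continuousAt.norm.eventually_lt_const (by simp)
  obtain ⟨ρ₀, hρ₀, hball⟩ := Metric.eventually_nhds_iff_ball.1
    (hint.and (hd.and (hb1.and (hb2.and ((Filter.eventually_mem_set.2 ht₁).and
      ((Filter.eventually_mem_set.2 ht₂).and (Filter.eventually_mem_set.2 hW)))))))
  -- The bound by 1 serves the hypothesis ‖v + δ‖ ≤ 1 of `norm_radial_sub_le`.
  set ρ := min (ρ₀ / 2) 1 with hρdef
  have hρ : 0 < ρ := lt_min (by linarith) one_pos
  have hρ1 : ρ ≤ 1 := min_le_right _ _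
  set s : Set (E × F) := closedBall x₀ ρ ×ˢ closedBall y₀ ρ with hs
  have hsb : s ⊆ ball (x₀, y₀) ρ₀ := by
    rw [hs, closedBall_prod_same]
    exact closedBall_subset_ball (lt_of_le_of_lt (min_le_left _ _) (by linarith))
  have hsc : Convex ℝ s := (convex_closedBall _ _).prod (convex_closedBall _ _)
  set C := ‖A (x₀, y₀)‖ + 1 with hC
  have hC1 : 1 ≤ C := by simp [hC]
  set L := ‖fderiv ℝ A (x₀, y₀)‖ + 1 with hL
  -- For ‖v‖ ≤ r the speed ‖A v‖ is at most C r = ρ, so the radial solution exists up to time 1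
  -- inside the ρ-ball around y₀.
  set r := ρ / C with hr
  have hr0 : 0 < r := div_pos hρ (by linarith)
  have hrρ : r ≤ ρ := div_le_self hρ.le hC1
  have hex : ∀ v : E, ‖v‖ ≤ r → ∃ u : ℝ → F, u 0 = y₀ ∧
      (∀ t ∈ Icc (0 : ℝ) 1, (x₀ + t • v, u t) ∈ s) ∧
      ∀ t ∈ Icc (0 : ℝ) 1, HasDerivWithinAt u (A (x₀ + t • v, u t) v) (Icc 0 1) t := by
    intro v hv
    have hps : (0 : ℝ) ∈ Icc (0 : ℝ) 1 := ⟨le_rfl, zero_le_one⟩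
    have hxt : ∀ t ∈ Icc (0 : ℝ) 1, x₀ + t • v ∈ closedBall x₀ ρ := by
      intro t ht
      rw [mem_closedBall, dist_eq_norm, add_sub_cancel_left, norm_smul, Real.norm_eq_abs,
        abs_of_nonneg ht.1]
      exact (mul_le_of_le_one_left (norm_nonneg _) ht.2).trans (hv.trans hrρ)
    have hpl : IsPicardLindelof (fun t y => A (x₀ + t • v, y) v)
        (⟨0, hps⟩ : Icc (0 : ℝ) 1) y₀ ⟨ρ, hρ.le⟩ 0 ⟨ρ, hρ.le⟩ (K₁ * ‖v‖₊) := by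
      constructor
      · intro t ht
        refine LipschitzOnWith.of_dist_le_mul fun y hy y' hy' => ?_
        change y ∈ closedBall y₀ ρ at hy
        change y' ∈ closedBall y₀ ρ at hy'
        have h1 := hK₁.dist_le_mul _ (hball _ (hsb (show (x₀ + t • v, y) ∈ s from ⟨hxt t ht, hy⟩))).2.2.2.2.1 _
          (hball _ (hsb (show (x₀ + t • v, y') ∈ s from ⟨hxt t ht, hy'⟩))).2.2.2.2.1
        rw [dist_eq_norm, ← sub_apply]
        refine (ContinuousLinearMap.le_opNorm _ _).trans ?_
        rw [dist_eq_norm, Prod.dist_eq, dist_self, max_eq_right dist_nonneg] at h1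
        calc _ ≤ K₁ * dist y y' * ‖v‖ := by gcongr
          _ = _ := by push_cast; ring
      · intro y hy t ht
        change y ∈ closedBall y₀ ρ at hy
        have hc : ContinuousAt A (x₀ + t • v, y) :=
          (hball _ (hsb (show (x₀ + t • v, y) ∈ s from ⟨hxt t ht, hy⟩))).2.1.continuousAt
        have h2 : ContinuousAt (fun t : ℝ => A (x₀ + t • v, y)) t :=
          ContinuousAt.comp (f := fun t : ℝ => (x₀ + t • v, y)) hc (by fun_prop)
        exact (h2.clm_apply continuousAt_const).continuousWithinAt
      · intro t ht y hy
        change y ∈ closedBall y₀ ρ at hy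
        have h1 := (hball _ (hsb (show (x₀ + t • v, y) ∈ s from ⟨hxt t ht, hy⟩))).2.2.1
        refine (ContinuousLinearMap.le_of_opNorm_le _ h1.le v).trans ?_
        calc _ ≤ C * r := by gcongr
          _ = ρ := by rw [hr]; field_simp
      · simp
    obtain ⟨u, hu0, hu, hus⟩ := hpl.exists_hasDerivWithinAt_mem_closedBall
    exact ⟨u, hu0, fun t ht => ⟨hxt t ht, hus t ht⟩, hu⟩
  choose! U hU0 hUs hUd using hex
  have hUZ : ∀ v : E, ‖v‖ ≤ r → ∀ t ∈ Icc (0 : ℝ) 1, (x₀ + t • v, U v t) ∈ Z := fun v hv =>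
    hWZ v (U v) (hU0 v hv) (fun t ht => (hball _ (hsb (hUs v hv t ht))).2.2.2.2.2.2) (hUd v hv)
  -- The solution at x is the endpoint at time 1 of the radial solution with velocity x - x₀.
  refine ⟨fun x => U (x - x₀) 1, ?_, ?_⟩
  · have h0 : ‖(0 : E)‖ ≤ r := by simpa using hr0.le
    simp only [sub_self]
    have := constant_of_has_deriv_right_zero (f := U 0) (a := 0) (b := 1)
      (fun t ht => (hUd 0 h0 t ht).continuousWithinAt)
      (fun t ht => by
        have := (hUd 0 h0 t (Ico_subset_Icc_self ht)).mono_of_mem_nhdsWithin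
          (Icc_mem_nhdsGE_of_mem ht)
        simpa using this) 1 ⟨zero_le_one, le_rfl⟩
    rw [this, hU0 0 h0]
  · filter_upwards [ball_mem_nhds x₀ hr0] with x hx
    have h1 : (1 : ℝ) ∈ Icc (0 : ℝ) 1 := ⟨zero_le_one, le_rfl⟩
    set v := x - x₀ with hv
    have hvr : ‖v‖ < r := by rwa [mem_ball, dist_eq_norm] at hx
    have hxv : x₀ + v = x := by simp [hv]
    refine ⟨by simpa [hxv] using hUZ v hvr.le 1 h1, ?_⟩
    rw [hasFDerivAt_iff_isLittleO_nhds_zero]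
    -- Here B = 2 + 2 * C works: two radial solutions are within 2ρ ≤ 2 of each other, and ‖A δ‖ ≤ C
    -- for ‖δ‖ ≤ 1.
    set c := (2 * K₂ * (1 + C) ^ 2 + L * (1 + C)) *
      gronwallBound 0 (L + 2 * K₂ * (2 + 2 * C)) 1 1 with hc
    have hbig : (fun δ => U (x + δ - x₀) 1 - U v 1 - A (x, U v 1) δ) =O[𝓝 0]
        fun δ : E => ‖δ‖ ^ 2 := by
      refine Asymptotics.IsBigO.of_bound c ?_
      filter_upwards [ball_mem_nhds (0 : E) (sub_pos.2 hvr)] with δ hδ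
      have hδ' : ‖v + δ‖ ≤ r := by
        rw [mem_ball_zero_iff] at hδ
        linarith [norm_add_le v δ]
      have hδ2 : ‖δ‖ ≤ 1 := by
        rw [mem_ball_zero_iff] at hδ
        linarith [norm_nonneg v]
      have := norm_radial_sub_le (A' := fderiv ℝ A) hsc
        (fun z hz => (hball z (hsb hz)).2.1.hasFDerivAt)
        (fun z hz => (hball z (hsb hz)).2.2.1.le) (fun z hz => (hball z (hsb hz)).2.2.2.1.le)
        (hK₂.mono fun z hz => (hball z (hsb hz)).2.2.2.2.2.1) (x₀ := x₀) (v := v) (δ := δ)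
        (hδ'.trans (hrρ.trans hρ1)) (B := 2 + 2 * C)
        ((hU0 v hvr.le).trans (hU0 (v + δ) hδ').symm) (hUs v hvr.le) (hUs (v + δ) hδ')
        (fun t ht => ?_) (hUd v hvr.le) (hUd (v + δ) hδ')
        (fun t ht => (hball _ (hsb (hUs v hvr.le t ht))).1 (hUZ v hvr.le t ht) _ _)
      · rw [hxv] at this
        have e : x + δ - x₀ = v + δ := by rw [hv]; abel
        rw [e, Real.norm_of_nonneg (sq_nonneg ‖δ‖)]
        exact this
      · have e1 := (hUs v hvr.le t ht).2
        have e2 := (hUs (v + δ) hδ' t ht).2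
        have e3 := dist_triangle_right (U (v + δ) t) (U v t) y₀
        rw [mem_closedBall] at e1 e2
        rw [dist_eq_norm] at e3
        have e4 := ContinuousLinearMap.le_of_opNorm_le _
          (hball _ (hsb (hUs v hvr.le t ht))).2.2.1.le δ
        have : ‖A (x₀ + t • v, U v t)‖ * ‖δ‖ ≤ C * 1 := by gcongr; exact (hball _ (hsb (hUs v hvr.le t ht))).2.2.1.le
        nlinarith [norm_nonneg δ]
    have hlit : (fun δ : E => ‖δ‖ ^ 2) =o[𝓝 0] fun δ : E => δ := by
      have := Asymptotics.isLittleO_norm_pow_id (E' := E) one_lt_two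
      exact this
    exact hbig.trans_isLittleO hlit

/-- Restricted to a radial segment, both functions solve one Lipschitz ordinary differential
equation with the same initial value. -/
theorem eventuallyEq_of_hasFDerivAt {A : E × F → E →L[ℝ] F} {x₀ : E} {y₀ : F}
    (hA : ContDiffAt ℝ 1 A (x₀, y₀)) {f g : E → F} (hf0 : f x₀ = y₀) (hg0 : g x₀ = y₀)
    (hf : ∀ᶠ x in 𝓝 x₀, HasFDerivAt f (A (x, f x)) x)
    (hg : ∀ᶠ x in 𝓝 x₀, HasFDerivAt g (A (x, g x)) x) : f =ᶠ[𝓝 x₀] g := by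
  obtain ⟨K, t, ht, hK⟩ := hA.exists_lipschitzOnWith
  have hcf : ContinuousAt (fun x => (x, f x)) x₀ :=
    continuousAt_id.prodMk hf.self_of_nhds.continuousAt
  have hcg : ContinuousAt (fun x => (x, g x)) x₀ :=
    continuousAt_id.prodMk hg.self_of_nhds.continuousAt
  have htf := hcf.preimage_mem_nhds (t := t) (by simpa [hf0] using ht)
  have htg := hcg.preimage_mem_nhds (t := t) (by simpa [hg0] using ht)
  obtain ⟨r, hr, hball⟩ := Metric.eventually_nhds_iff_ball.1
    (hf.and (hg.and ((Filter.eventually_mem_set.2 htf).and (Filter.eventually_mem_set.2 htg))))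
  filter_upwards [ball_mem_nhds x₀ hr] with x hx
  set v := x - x₀ with hv
  have hxt : ∀ t ∈ Icc (0 : ℝ) 1, x₀ + t • v ∈ ball x₀ r := by
    intro t ht
    rw [mem_ball, dist_eq_norm, add_sub_cancel_left, norm_smul, Real.norm_eq_abs,
      abs_of_nonneg ht.1]
    rw [mem_ball, dist_eq_norm] at hx
    exact (mul_le_of_le_one_left (norm_nonneg _) ht.2).trans_lt hx
  have hl : ∀ t : ℝ, HasDerivAt (fun t : ℝ => x₀ + t • v) v t := fun t => by
    simpa using ((hasDerivAt_id t).smul_const v).const_add x₀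
  have hdf : ∀ t ∈ Icc (0 : ℝ) 1, HasDerivAt (fun t : ℝ => f (x₀ + t • v))
      (A (x₀ + t • v, f (x₀ + t • v)) v) t := fun t ht =>
    (hball _ (hxt t ht)).1.comp_hasDerivAt t (hl t)
  have hdg : ∀ t ∈ Icc (0 : ℝ) 1, HasDerivAt (fun t : ℝ => g (x₀ + t • v))
      (A (x₀ + t • v, g (x₀ + t • v)) v) t := fun t ht =>
    (hball _ (hxt t ht)).2.1.comp_hasDerivAt t (hl t)
  have := ODE_solution_unique_of_mem_Icc_right (v := fun t' y => A (x₀ + t' • v, y) v)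
    (s := fun t' => {y | (x₀ + t' • v, y) ∈ t}) (K := K * ‖v‖₊)
    (fun t' _ => ?_) (fun t' ht' => (hdf t' ht').continuousAt.continuousWithinAt)
    (fun t' ht' => (hdf t' (Ico_subset_Icc_self ht')).hasDerivWithinAt)
    (fun t' ht' => (hball _ (hxt t' (Ico_subset_Icc_self ht'))).2.2.1)
    (fun t' ht' => (hdg t' ht').continuousAt.continuousWithinAt)
    (fun t' ht' => (hdg t' (Ico_subset_Icc_self ht')).hasDerivWithinAt)
    (fun t' ht' => (hball _ (hxt t' (Ico_subset_Icc_self ht'))).2.2.2)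
    (by simp [hf0, hg0]) (⟨zero_le_one, le_rfl⟩ : (1 : ℝ) ∈ Icc (0 : ℝ) 1)
  · simpa [hv] using this
  · refine LipschitzOnWith.of_dist_le_mul fun y hy y' hy' => ?_
    have h1 := hK.dist_le_mul _ hy _ hy'
    rw [dist_eq_norm, ← sub_apply]
    refine (ContinuousLinearMap.le_opNorm _ _).trans ?_
    rw [dist_eq_norm, Prod.dist_eq, dist_self, max_eq_right dist_nonneg] at h1
    calc _ ≤ K * dist y y' * ‖v‖ := by gcongr
      _ = _ := by push_cast; ring

/-- Bootstrapping: if f is of class Cᵏ, so is its derivative x ↦ A(x, f x). -/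
theorem contDiffOn_infty_of_hasFDerivAt {A : E × F → E →L[ℝ] F} {s : Set E} (hs : IsOpen s)
    {W : Set (E × F)} (hA : ContDiffOn ℝ ∞ A W) {f : E → F} (hW : ∀ x ∈ s, (x, f x) ∈ W)
    (hf : ∀ x ∈ s, HasFDerivAt f (A (x, f x)) x) : ContDiffOn ℝ ∞ f s := by
  rw [contDiffOn_infty]
  intro k
  induction k with
  | zero => exact contDiffOn_zero.2 fun x hx => (hf x hx).continuousAt.continuousWithinAt
  | succ k ih =>
    rw [Nat.cast_succ, contDiffOn_succ_iff_fderiv_of_isOpen hs]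
    refine ⟨fun x hx => (hf x hx).differentiableAt.differentiableWithinAt, by simp, ?_⟩
    refine ContDiffOn.congr (f := fun x => A (x, f x)) ?_ fun x hx => (hf x hx).fderiv
    exact (hA.of_le (by exact_mod_cast le_top)).comp (contDiffOn_id.prodMk ih) hW

end TotalDE

end CartanRealization

namespace CartanRealization

/-! ### The exterior derivative in vector spaces -/

section Curl

variable {E E₁ E₂ F P : Type*} [NormedAddCommGroup E] [NormedSpace ℝ E] [NormedAddCommGroup E₁]
  [NormedSpace ℝ E₁] [NormedAddCommGroup E₂] [NormedSpace ℝ E₂] [NormedAddCommGroup F]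
  [NormedSpace ℝ F] [NormedAddCommGroup P] [NormedSpace ℝ P]

/-- The exterior derivative of a one-form on a vector space. -/
noncomputable def curl (Θ : E → E →L[ℝ] F) (y v w : E) : F :=
  fderiv ℝ Θ y v w - fderiv ℝ Θ y w v

theorem fderiv_fderiv_symm {f : E → F} {x : E} (hf : ContDiffAt ℝ 2 f x) (v w : E) :
    fderiv ℝ (fderiv ℝ f) x v w = fderiv ℝ (fderiv ℝ f) x w v :=
  (hf.isSymmSndFDerivAt (by simp [minSmoothness_of_isRCLikeNormedField])).eq v w

theorem curl_congr {Θ Θ' : E → E →L[ℝ] F} {y : E} (h : Θ =ᶠ[𝓝 y] Θ') (v w : E) :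
    curl Θ y v w = curl Θ' y v w := by
  simp only [curl, h.fderiv_eq]

/-- The extra terms contain the second derivative of κ, which is symmetric and disappears under
antisymmetrization. -/
theorem curl_pullback {κ : E₁ → E} {Θ : E → E →L[ℝ] F} {y : E₁} (hκ : ContDiffAt ℝ 2 κ y)
    (hΘ : DifferentiableAt ℝ Θ (κ y)) (v w : E₁) :
    curl (fun z => (Θ (κ z)).comp (fderiv ℝ κ z)) y v w
      = curl Θ (κ y) (fderiv ℝ κ y v) (fderiv ℝ κ y w) := by
  have hd : HasFDerivAt (fderiv ℝ κ) (fderiv ℝ (fderiv ℝ κ) y) y :=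
    ((hκ.fderiv_right (m := 1) (by norm_num)).differentiableAt (by simp)).hasFDerivAt
  have hκ' : HasFDerivAt κ (fderiv ℝ κ y) y := (hκ.differentiableAt (by simp)).hasFDerivAt
  have hc := (hΘ.hasFDerivAt.comp y hκ').clm_comp hd
  have := hc.fderiv
  simp only [Function.comp_def] at this
  simp only [curl, this]
  simp [fderiv_fderiv_symm hκ v w]

/-- If a map `J` pulls back a moving frame `V` to the coframe `ϑ`, then `dϑ` is determined by the
brackets of the frame. -/
theorem frame_curl {J : E₁ → E₂} {V : E₂ → P →L[ℝ] E₂} {ϑ : E₁ → E₁ →L[ℝ] P} {y : E₁}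
    (hJ : ContDiffAt ℝ 2 J y) (hV : DifferentiableAt ℝ V (J y)) (hϑ : DifferentiableAt ℝ ϑ y)
    (h : ∀ᶠ z in 𝓝 y, fderiv ℝ J z = (V (J z)).comp (ϑ z)) (v w : E₁) :
    V (J y) (curl ϑ y v w) = fderiv ℝ V (J y) (V (J y) (ϑ y w)) (ϑ y v)
      - fderiv ℝ V (J y) (V (J y) (ϑ y v)) (ϑ y w) := by
  have hJ' : HasFDerivAt J (fderiv ℝ J y) y := (hJ.differentiableAt (by simp)).hasFDerivAt
  have hc := (hV.hasFDerivAt.comp y hJ').clm_comp hϑ.hasFDerivAt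
  have e : fderiv ℝ (fderiv ℝ J) y = _ := (Filter.EventuallyEq.fderiv_eq h).trans hc.fderiv
  have hs := fderiv_fderiv_symm hJ v w
  rw [e, h.self_of_nhds] at hs
  simp only [Function.comp_apply, add_apply, ContinuousLinearMap.comp_apply,
    ContinuousLinearMap.compL_apply, ContinuousLinearMap.flip_apply] at hs
  rw [curl, map_sub, sub_eq_sub_iff_add_eq_add]
  rw [add_comm, add_comm (fderiv ℝ V (J y) (V (J y) (ϑ y w)) (ϑ y v))]
  rw [add_comm]
  exact hs

/-- The integrability condition for the equation `Ω(f) ∘ Df = Θ` holds where `dΩ` and `dΘ` agree. -/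
theorem integrable_of_curl_eq {A : E × F → E →L[ℝ] F} {Ω : F → F →L[ℝ] P} {Θ : E → E →L[ℝ] P}
    {z : E × F} (hA : DifferentiableAt ℝ A z) (hΩ : DifferentiableAt ℝ Ω z.2)
    (hΘ : DifferentiableAt ℝ Θ z.1) (h : ∀ᶠ z' in 𝓝 z, (Ω z'.2).comp (A z') = Θ z'.1)
    (inj : Function.Injective (Ω z.2))
    (hc : ∀ v w, curl Ω z.2 (A z v) (A z w) = curl Θ z.1 v w) (v w : E) :
    fderiv ℝ A z (v, A z v) w = fderiv ℝ A z (w, A z w) v := by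
  have h1 := (hΩ.hasFDerivAt.comp z (hasFDerivAt_snd (𝕜 := ℝ))).clm_comp hA.hasFDerivAt
  have h2 := hΘ.hasFDerivAt.comp z (hasFDerivAt_fst (𝕜 := ℝ))
  -- Differentiate the identity Ω ∘ A = Θ in the directions (v, A v) and (w, A w). Subtracting the
  -- results leaves the two curls, which cancel, and Ω applied to the defect of integrability.
  have e : _ = _ := (h1.congr_of_eventuallyEq (h.mono fun _ hz => hz.symm)).unique h2
  have ev := congrArg (fun T => T (v, A z v) w) e
  have ew := congrArg (fun T => T (w, A z w) v) e
  simp only [Function.comp_apply, add_apply, ContinuousLinearMap.comp_apply,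
    ContinuousLinearMap.compL_apply, ContinuousLinearMap.flip_apply,
    ContinuousLinearMap.coe_fst', ContinuousLinearMap.coe_snd'] at ev ew
  have := hc v w
  simp only [curl] at this
  apply inj
  rw [← sub_eq_zero] at this ev ew ⊢
  linear_combination (norm := module) ev - ew - this

end Curl

end CartanRealization

namespace CartanRealization

/-! ### The étale space of a sheaf of local maps -/

/-- A class of continuous maps from open subsets of `M` to `S`, such that two of them with the same
value at a point agree near it. -/
structure LocalMaps (M : Type*) (S : Type*) [TopologicalSpace M] [TopologicalSpace S] where
  mem : Set M → (M → S) → Prop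
  isOpen : ∀ {U σ}, mem U σ → IsOpen U
  continuousOn : ∀ {U σ}, mem U σ → ContinuousOn σ U
  eventuallyEq : ∀ {U U' σ σ' q}, mem U σ → mem U' σ' → q ∈ U → q ∈ U' → σ q = σ' q →
    σ =ᶠ[𝓝 q] σ'

namespace LocalMaps

open Set

variable {M : Type u} {S : Type v} [TopologicalSpace M] [TopologicalSpace S]

/-- The étale space, realized on the set `M × S`. -/
def Etale (_ : LocalMaps M S) : Type (max u v) := M × S

variable (L : LocalMaps M S)

/-- The section of the étale space defined by a local map. -/
def sec (σ : M → S) (q : M) : L.Etale := (q, σ q)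

/-- The finest topology in which all sections are continuous. A point of M × S that lies on no
section is isolated, and such points do not affect the components used later. -/
instance : TopologicalSpace L.Etale where
  IsOpen V := ∀ U σ, L.mem U σ → IsOpen {q | q ∈ U ∧ L.sec σ q ∈ V}
  isOpen_univ U σ h := by simpa only [mem_univ, and_true] using! L.isOpen h
  isOpen_inter V V' hV hV' U σ h := by
    convert (hV U σ h).inter (hV' U σ h) using 1
    ext q
    exact ⟨fun h => ⟨⟨h.1, h.2.1⟩, ⟨h.1, h.2.2⟩⟩, fun h => ⟨h.1.1, h.1.2, h.2.2⟩⟩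
  isOpen_sUnion s hs U σ h := by
    have : {q | q ∈ U ∧ L.sec σ q ∈ ⋃₀ s} = ⋃ V ∈ s, {q | q ∈ U ∧ L.sec σ q ∈ V} := by
      ext q
      simp only [mem_iUnion, exists_prop]
      exact ⟨fun ⟨hq, V, hV, h⟩ => ⟨V, hV, hq, h⟩, fun ⟨V, hV, hq, h⟩ => ⟨hq, V, hV, h⟩⟩
    rw [this]
    exact isOpen_biUnion fun V hV => hs V hV U σ h

variable {L}

theorem isOpen_etale_iff {V : Set L.Etale} :
    IsOpen V ↔ ∀ U σ, L.mem U σ → IsOpen {q | q ∈ U ∧ L.sec σ q ∈ V} := Iff.rfl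

theorem continuousOn_sec {U : Set M} {σ : M → S} (h : L.mem U σ) : ContinuousOn (L.sec σ) U := by
  rw [continuousOn_open_iff (L.isOpen h)]
  exact fun V hV => isOpen_etale_iff.1 hV U σ h

/-- This is where local uniqueness enters: two sections that meet at a point agree near it, so the
preimage of one image under the other section is open. -/
theorem isOpen_image_sec {U : Set M} {σ : M → S} (h : L.mem U σ) {A : Set M} (hA : IsOpen A)
    (hAU : A ⊆ U) : IsOpen (L.sec σ '' A) := by
  rw [isOpen_etale_iff]
  intro U' σ' h'
  rw [isOpen_iff_mem_nhds]
  rintro q ⟨hq, q', hq', e⟩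
  obtain rfl : q' = q := congrArg Prod.fst e
  have e2 : σ q' = σ' q' := congrArg Prod.snd e
  filter_upwards [(L.isOpen h').mem_nhds hq, hA.mem_nhds hq',
    L.eventuallyEq h h' (hAU hq') hq e2] with x h1 h2 h3
  exact ⟨h1, x, h2, Prod.ext rfl h3⟩

/-- The étale topology refines the product topology, hence is Hausdorff when M and S are. -/
theorem continuous_toProd : Continuous (fun z : L.Etale => (show M × S from z)) := by
  rw [continuous_def]
  intro V hV
  rw [isOpen_etale_iff]
  intro U σ h
  have : ContinuousOn (fun q => (q, σ q)) U := continuousOn_id.prodMk (L.continuousOn h)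
  exact (continuousOn_open_iff (L.isOpen h)).1 this V hV

theorem continuous_proj : Continuous (fun z : L.Etale => (show M × S from z).1) :=
  continuous_fst.comp continuous_toProd

instance [T2Space M] [T2Space S] : T2Space L.Etale :=
  T2Space.of_injective_continuous (f := fun z : L.Etale => (show M × S from z))
    (fun _ _ h => h) continuous_toProd

/-- The set of agreement is closed because S is Hausdorff and open by local uniqueness. -/
theorem eqOn [T2Space S] {U : Set M} (hU : IsPreconnected U) {σ σ' : M → S} (h : L.mem U σ)
    (h' : L.mem U σ') {q : M} (hq : q ∈ U) (e : σ q = σ' q) : EqOn σ σ' U := by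
  have hU' : PreconnectedSpace U := isPreconnected_iff_preconnectedSpace.1 hU
  have hcl : IsClopen {x : U | σ x = σ' x} := by
    refine ⟨isClosed_eq (L.continuousOn h).domRestrict (L.continuousOn h').domRestrict, ?_⟩
    rw [isOpen_iff_mem_nhds]
    intro x hx
    exact continuous_subtype_val.continuousAt.eventually (L.eventuallyEq h h' x.2 x.2 hx)
  have := hcl.eq_univ ⟨⟨q, hq⟩, e⟩
  intro x hx
  have : (⟨x, hx⟩ : U) ∈ {x : U | σ x = σ' x} := by rw [this]; trivial
  exact this

/-- Every local map through a point over a suitable neighbourhood extends to the whole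
neighbourhood. -/
def EvenlyExtends (L : LocalMaps M S) : Prop :=
  ∀ p, ∃ U, IsOpen U ∧ p ∈ U ∧ IsPreconnected U ∧ ∀ q ∈ U, ∀ s,
    (∃ U' σ', L.mem U' σ' ∧ q ∈ U' ∧ σ' q = s) → ∃ σ, L.mem U σ ∧ σ q = s

/-- The connected component of a point in the étale space. -/
def Component (L : LocalMaps M S) (z : L.Etale) : Type (max u v) := connectedComponent z

instance (z : L.Etale) : TopologicalSpace (L.Component z) :=
  inferInstanceAs (TopologicalSpace (connectedComponent z))

instance [T2Space M] [T2Space S] (z : L.Etale) : T2Space (L.Component z) :=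
  inferInstanceAs (T2Space (connectedComponent z))

instance (z : L.Etale) : ConnectedSpace (L.Component z) :=
  isConnected_iff_connectedSpace.1 isConnected_connectedComponent

/-- The projection of a component of the étale space to the base. -/
def Component.proj {z : L.Etale} (y : L.Component z) : M := (show M × S from y.1).1

/-- The evaluation of local maps on a component of the étale space. -/
def Component.ev {z : L.Etale} (y : L.Component z) : S := (show M × S from y.1).2

theorem Component.continuous_proj {z : L.Etale} :
    Continuous (Component.proj : L.Component z → M) :=
  LocalMaps.continuous_proj.comp continuous_subtype_val

theorem sec_mem_component {z : L.Etale} {U : Set M} (hU : IsPreconnected U) {σ : M → S}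
    (h : L.mem U σ) {q q' : M} (hq : q ∈ U) (hq' : q' ∈ U)
    (hz : L.sec σ q ∈ connectedComponent z) : L.sec σ q' ∈ connectedComponent z := by
  have := (hU.image _ (continuousOn_sec h)).subset_connectedComponent (mem_image_of_mem _ hq)
  rw [connectedComponent_eq hz]
  exact this (mem_image_of_mem _ hq')

/-- The points lying on sections form a clopen set, since every section runs entirely inside it; a
component that meets this set is contained in it. -/
theorem exists_mem_of_mem_component {p₀ : M} {s₀ : S}
    (h₀ : ∃ U σ, L.mem U σ ∧ p₀ ∈ U ∧ σ p₀ = s₀) {z : L.Etale}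
    (hz : z ∈ connectedComponent (show L.Etale from (p₀, s₀))) :
    ∃ U σ, L.mem U σ ∧ z.1 ∈ U ∧ L.sec σ z.1 = z := by
  have hcl : IsClopen {z : L.Etale | ∃ U σ, L.mem U σ ∧ z.1 ∈ U ∧ L.sec σ z.1 = z} := by
    constructor
    · rw [← isOpen_compl_iff, isOpen_etale_iff]
      intro U σ h
      convert isOpen_empty
      ext q
      simp only [mem_ofPred_eq, mem_empty_iff_false, iff_false, not_and]
      exact fun hq hn => hn ⟨U, σ, h, hq, rfl⟩
    · rw [isOpen_etale_iff]
      intro U σ h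
      convert L.isOpen h
      ext q
      simp only [mem_ofPred_eq, and_iff_left_iff_imp]
      exact fun hq => ⟨U, σ, h, hq, rfl⟩
  obtain ⟨U, σ, h, hp, hs⟩ := h₀
  exact hcl.connectedComponent_subset ⟨U, σ, h, hp, show L.sec σ p₀ = (p₀, s₀) from Prod.ext rfl hs⟩ hz

/-- Near each of its points, a component of the étale space is the image of a section. -/
theorem Component.exists_ev_eq {p₀ : M} {s₀ : S} (h₀ : ∃ U σ, L.mem U σ ∧ p₀ ∈ U ∧ σ p₀ = s₀)
    (y : L.Component (show L.Etale from (p₀, s₀))) :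
    ∃ U σ, L.mem U σ ∧ y.proj ∈ U ∧ σ y.proj = y.ev ∧ ∀ᶠ y' in 𝓝 y, y'.ev = σ y'.proj := by
  obtain ⟨U, σ, h, hy, e⟩ := exists_mem_of_mem_component h₀ y.2
  refine ⟨U, σ, h, hy, congrArg Prod.snd e, ?_⟩
  have : L.sec σ '' U ∈ 𝓝 y.1 :=
    (isOpen_image_sec h (L.isOpen h) subset_rfl).mem_nhds ⟨_, hy, e⟩
  filter_upwards [continuous_subtype_val.continuousAt.preimage_mem_nhds this]
  rintro y' ⟨q, hq, e'⟩
  have e1 : q = y'.proj := congrArg Prod.fst e'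
  have e2 : σ q = y'.ev := congrArg Prod.snd e'
  rw [← e2, e1]

/-- Over an evenly extending U, the part of the component above U is a disjoint union of images of
sections defined on all of U, one for each point of the component above p. -/
theorem Component.isCoveringMap [T2Space S] (hL : L.EvenlyExtends) {p₀ : M} {s₀ : S}
    (h₀ : ∃ U σ, L.mem U σ ∧ p₀ ∈ U ∧ σ p₀ = s₀) :
    IsCoveringMap (Component.proj : L.Component (show L.Etale from (p₀, s₀)) → M) := by
  intro p
  obtain ⟨U, hU, hpU, hUc, hext⟩ := hL p
  set z₀ : L.Etale := (p₀, s₀) with hz₀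
  let I := {s : S // (show L.Etale from (p, s)) ∈ connectedComponent z₀}
  have : Nonempty (M → S) := ⟨fun _ => s₀⟩
  let _ : TopologicalSpace I := ⊥
  have : DiscreteTopology I := ⟨rfl⟩
  suffices IsEvenlyCovered (Component.proj : L.Component z₀ → M) p I from
    this.to_isEvenlyCovered_preimage
  have hσ : ∀ y : L.Component z₀, y.proj ∈ U → ∃ σ, L.mem U σ ∧ σ y.proj = y.ev := by
    intro y hy
    obtain ⟨U', σ', h', hq, e⟩ := exists_mem_of_mem_component h₀ y.2
    exact hext _ hy _ ⟨U', σ', h', hq, congrArg Prod.snd e⟩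
  have hτ : ∀ s : I, ∃ σ, L.mem U σ ∧ σ p = s.1 := by
    intro s
    obtain ⟨U', σ', h', hq, e⟩ := exists_mem_of_mem_component h₀ s.2
    exact hext _ hpU _ ⟨U', σ', h', hq, congrArg Prod.snd e⟩
  choose! σ hσm hσe using hσ
  choose τ hτm hτe using hτ
  have hτz : ∀ (s : I) (q : M), q ∈ U → L.sec (τ s) q ∈ connectedComponent z₀ := fun s q hq =>
    sec_mem_component hUc (hτm s) hpU hq (by
      have := s.2
      rw [← hτe s] at this
      exact this)
  have hσz : ∀ y : L.Component z₀, y.proj ∈ U → ∀ q ∈ U, L.sec (σ y) q ∈ connectedComponent z₀ :=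
    fun y hy q hq => sec_mem_component hUc (hσm y hy) hy hq (by
      have := y.2
      have e : L.sec (σ y) y.proj = y.1 := Prod.ext rfl (hσe y hy)
      rw [e]; exact this)
  refine ⟨‹_›, U, hpU, hU, hU.preimage Component.continuous_proj, ?_⟩
  -- The sheet of y is labelled by the value at p of the section through y. Uniqueness on the
  -- preconnected set U makes the two maps inverse to each other and the label locally constant.
  refine ⟨{ toFun := fun y => (⟨y.1.proj, y.2⟩, ⟨σ y.1 p, hσz y.1 y.2 p hpU⟩)
            invFun := fun x => ⟨⟨L.sec (τ x.2) x.1, hτz x.2 x.1 x.1.2⟩, x.1.2⟩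
            left_inv := ?_
            right_inv := ?_
            continuous_toFun := ?_
            continuous_invFun := ?_ }, fun y => rfl⟩
  · rintro ⟨y, hy⟩
    have hy : y.proj ∈ U := hy
    refine Subtype.ext (Subtype.ext (Prod.ext rfl ?_))
    have e := eqOn hUc (hτm ⟨σ y p, hσz y hy p hpU⟩) (hσm y hy) hpU (hτe _) hy
    exact e.trans (hσe y hy)
  · rintro ⟨⟨q, hq⟩, s⟩
    refine Prod.ext rfl (Subtype.ext ?_)
    set y : L.Component z₀ := ⟨L.sec (τ s) q, hτz s q hq⟩ with hy
    have e := eqOn hUc (hσm y hq) (hτm s) hq (hσe y hq) hpU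
    exact e.trans (hτe s)
  · refine Continuous.prodMk ?_ ?_
    · exact Continuous.subtype_mk (Component.continuous_proj.comp continuous_subtype_val) _
    · refine (IsLocallyConstant.iff_eventually_eq _).2 ?_ |>.continuous
      rintro ⟨y, hy⟩
      have hy : y.proj ∈ U := hy
      have hn : L.sec (σ y) '' U ∈ 𝓝 y.1 := (isOpen_image_sec (hσm y hy) hU subset_rfl).mem_nhds
        ⟨_, hy, Prod.ext rfl (hσe y hy)⟩
      have hc : Continuous fun x : (Component.proj : L.Component z₀ → M) ⁻¹' U => x.1.1 :=
        Continuous.comp (g := Subtype.val) continuous_subtype_val continuous_subtype_val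
      filter_upwards [hc.continuousAt.preimage_mem_nhds hn]
      rintro ⟨y', hy'⟩ ⟨q, hq, e⟩
      have hy' : y'.proj ∈ U := hy'
      have e1 : q = y'.proj := congrArg Prod.fst e
      have e2 : σ y q = y'.ev := congrArg Prod.snd e
      refine Subtype.ext ?_
      refine eqOn hUc (hσm y' hy') (hσm y hy) hy' ?_ hpU
      rw [hσe y' hy', ← e2, e1]
  · refine Continuous.subtype_mk (Continuous.subtype_mk ?_ _) _
    rw [continuous_prod_of_discrete_right]
    intro s
    exact (continuousOn_sec (hτm s)).domRestrict

/-- The image is open, and it is closed because a section over an evenly extending neighbourhood of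
a limit point reaches that point. Even covering alone would allow empty fibers. -/
theorem Component.surjective_proj [ConnectedSpace M] [T2Space S] (hL : L.EvenlyExtends) {p₀ : M}
    {s₀ : S} (h₀ : ∃ U σ, L.mem U σ ∧ p₀ ∈ U ∧ σ p₀ = s₀) :
    Function.Surjective (Component.proj : L.Component (show L.Etale from (p₀, s₀)) → M) := by
  rw [← range_eq_univ]
  refine IsClopen.eq_univ ⟨?_, (isCoveringMap hL h₀).isOpenMap.isOpen_range⟩
    ⟨p₀, ⟨(p₀, s₀), mem_connectedComponent⟩, rfl⟩
  rw [← closure_subset_iff_isClosed]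
  intro p hp
  obtain ⟨U, hU, hpU, hUc, hext⟩ := hL p
  obtain ⟨q, hq, y, rfl⟩ := mem_closure_iff.1 hp U hU hpU
  obtain ⟨U', σ', h', hq', e⟩ := exists_mem_of_mem_component h₀ y.2
  obtain ⟨σ, h, hσ⟩ := hext _ hq _ ⟨U', σ', h', hq', congrArg Prod.snd e⟩
  have e : L.sec σ y.proj = y.1 := Prod.ext rfl hσ
  exact ⟨⟨L.sec σ p, sec_mem_component hUc h hq hpU (by rw [e]; exact y.2)⟩, rfl⟩

end LocalMaps

end CartanRealization

namespace CartanRealization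

/-! ### One-forms and vector fields in charts -/

open Set

section TangentMap

variable {E H E' H' : Type*} [NormedAddCommGroup E] [NormedSpace ℝ E] [TopologicalSpace H]
  {I : ModelWithCorners ℝ E H} [NormedAddCommGroup E'] [NormedSpace ℝ E'] [TopologicalSpace H']
  {I' : ModelWithCorners ℝ E' H'} {M M' : Type*} [TopologicalSpace M] [ChartedSpace H M]
  [IsManifold I ∞ M] [TopologicalSpace M'] [ChartedSpace H' M'] [IsManifold I' ∞ M']

theorem contMDiffOn_tangentMap {f : M → M'} {s : Set M} (hs : IsOpen s)
    (hf : ContMDiffOn I I' ∞ f s) :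
    ContMDiffOn I.tangent I'.tangent ∞ (tangentMap I I' f)
      {v : TangentBundle I M | v.1 ∈ s} := by
  have h := hf.contMDiffOn_tangentMapWithin (m := ∞) (by simp) hs.uniqueMDiffOn
  refine h.congr fun v hv => ?_
  simp only [tangentMap, tangentMapWithin, mfderivWithin_of_isOpen hs hv]

end TangentMap

section Charts

variable {n : ℕ} {M : Type*} [TopologicalSpace M] [ChartedSpace (EuclideanSpace ℝ (Fin n)) M]
  [IsManifold (𝓡 n) ∞ M]

omit [IsManifold (𝓡 n) ∞ M] in
theorem mem_chart_of_mem_extChartAt {p q : M} (h : q ∈ (extChartAt (𝓡 n) p).source) :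
    q ∈ (chartAt (EuclideanSpace ℝ (Fin n)) p).source := by
  rwa [extChartAt_source] at h

theorem mdifferentiableAt_extChartAt_symm {p : M} {y : EuclideanSpace ℝ (Fin n)}
    (hy : y ∈ (extChartAt (𝓡 n) p).target) :
    MDifferentiableAt 𝓘(ℝ, EuclideanSpace ℝ (Fin n)) (𝓡 n) (extChartAt (𝓡 n) p).symm y := by
  have := mdifferentiableWithinAt_extChartAt_symm hy
  rwa [ModelWithCorners.range_eq_univ, mdifferentiableWithinAt_univ] at this

theorem mfderiv_extChartAt_mfderiv_symm {p : M} {y : EuclideanSpace ℝ (Fin n)}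
    (hy : y ∈ (extChartAt (𝓡 n) p).target) (w : EuclideanSpace ℝ (Fin n)) :
    (mfderiv (𝓡 n) 𝓘(ℝ, EuclideanSpace ℝ (Fin n)) (extChartAt (𝓡 n) p)
      ((extChartAt (𝓡 n) p).symm y)
      (mfderiv 𝓘(ℝ, EuclideanSpace ℝ (Fin n)) (𝓡 n) (extChartAt (𝓡 n) p).symm y w) :
        EuclideanSpace ℝ (Fin n)) = w := by
  have := mfderiv_extChartAt_comp_mfderivWithin_extChartAt_symm hy
  rw [ModelWithCorners.range_eq_univ, mfderivWithin_univ] at this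
  exact congrArg (fun T => T w) this

theorem mfderiv_symm_mfderiv_extChartAt' {p : M} {y : EuclideanSpace ℝ (Fin n)}
    (hy : y ∈ (extChartAt (𝓡 n) p).target)
    (v : TangentSpace (𝓡 n) ((extChartAt (𝓡 n) p).symm y)) :
    mfderiv 𝓘(ℝ, EuclideanSpace ℝ (Fin n)) (𝓡 n) (extChartAt (𝓡 n) p).symm y
      (mfderiv (𝓡 n) 𝓘(ℝ, EuclideanSpace ℝ (Fin n)) (extChartAt (𝓡 n) p)
        ((extChartAt (𝓡 n) p).symm y) v : EuclideanSpace ℝ (Fin n)) = v := by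
  have := mfderivWithin_extChartAt_symm_comp_mfderiv_extChartAt hy
  rw [ModelWithCorners.range_eq_univ, mfderivWithin_univ] at this
  exact congrArg (fun T => T v) this

/-- A one-form in terms of its representative in a chart. -/
theorem form_eq_chartForm {k : ℕ} (θ : ∀ p : M, TangentSpace (𝓡 n) p →L[ℝ] (Fin k → ℝ)) {p q : M}
    (hq : q ∈ (extChartAt (𝓡 n) p).source) (v : TangentSpace (𝓡 n) q) :
    θ q v = chartForm θ p (extChartAt (𝓡 n) p q)
      (mfderiv (𝓡 n) 𝓘(ℝ, EuclideanSpace ℝ (Fin n)) (extChartAt (𝓡 n) p) q v) := by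
  obtain ⟨y, hy, rfl⟩ : ∃ y ∈ (extChartAt (𝓡 n) p).target, (extChartAt (𝓡 n) p).symm y = q :=
    ⟨_, (extChartAt (𝓡 n) p).map_source hq, (extChartAt (𝓡 n) p).left_inv hq⟩
  have e := mfderiv_symm_mfderiv_extChartAt' hy v
  rw [(extChartAt (𝓡 n) p).right_inv hy]
  exact congrArg (θ _) e.symm

theorem contMDiffOn_mfderiv_extChartAt (p : M) :
    ContMDiffOn (𝓡 n).tangent 𝓘(ℝ, EuclideanSpace ℝ (Fin n)) ∞
      (fun v : TangentBundle (𝓡 n) M =>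
        (mfderiv (𝓡 n) 𝓘(ℝ, EuclideanSpace ℝ (Fin n)) (extChartAt (𝓡 n) p) v.1 v.2 :
          EuclideanSpace ℝ (Fin n)))
      {v | v.1 ∈ (extChartAt (𝓡 n) p).source} := by
  have h := contMDiffOn_tangentMap (isOpen_extChartAt_source p)
    ((contMDiffOn_extChartAt (I := 𝓡 n) (n := ∞) (x := p)).mono
      (extChartAt_source (I := 𝓡 n) p).subset)
  exact (contMDiff_snd_tangentBundle_modelSpace _ _).comp_contMDiffOn h

theorem contMDiffOn_mfderiv_extChartAt_symm (p : M) (w : EuclideanSpace ℝ (Fin n)) :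
    ContMDiffOn 𝓘(ℝ, EuclideanSpace ℝ (Fin n)) (𝓡 n).tangent ∞
      (fun y => (⟨(extChartAt (𝓡 n) p).symm y,
        mfderiv 𝓘(ℝ, EuclideanSpace ℝ (Fin n)) (𝓡 n) (extChartAt (𝓡 n) p).symm y w⟩ :
          TangentBundle (𝓡 n) M)) (extChartAt (𝓡 n) p).target := by
  have h := contMDiffOn_tangentMap (isOpen_extChartAt_target p)
    (contMDiffOn_extChartAt_symm (I := 𝓡 n) (n := ∞) p)
  have h2 : ContMDiff 𝓘(ℝ, EuclideanSpace ℝ (Fin n)) 𝓘(ℝ, EuclideanSpace ℝ (Fin n)).tangent ∞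
      (fun y : EuclideanSpace ℝ (Fin n) => (⟨y, w⟩ : TangentBundle
        𝓘(ℝ, EuclideanSpace ℝ (Fin n)) (EuclideanSpace ℝ (Fin n)))) :=
    contMDiff_vectorSpace_iff_contDiff.2 contDiff_const
  exact h.comp h2.contMDiffOn fun y hy => hy

theorem contDiffOn_chartForm {k : ℕ} {θ : ∀ p : M, TangentSpace (𝓡 n) p →L[ℝ] (Fin k → ℝ)}
    (hθ : ContMDiff (𝓡 n).tangent 𝓘(ℝ, Fin k → ℝ) ∞
      (fun v : TangentBundle (𝓡 n) M => θ v.1 v.2)) (p : M) :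
    ContDiffOn ℝ ∞ (chartForm θ p) (extChartAt (𝓡 n) p).target := by
  rw [contDiffOn_clm_apply]
  intro w
  exact (hθ.comp_contMDiffOn (contMDiffOn_mfderiv_extChartAt_symm p w)).contDiffOn

/-- It suffices to control each representative at the center of its own chart, which is where the
forms built later are computed. -/
theorem contMDiff_form_of_chartForm {k : ℕ}
    {θ : ∀ p : M, TangentSpace (𝓡 n) p →L[ℝ] (Fin k → ℝ)}
    (h : ∀ p, ContDiffAt ℝ ∞ (chartForm θ p) (extChartAt (𝓡 n) p p)) :
    ContMDiff (𝓡 n).tangent 𝓘(ℝ, Fin k → ℝ) ∞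
      (fun v : TangentBundle (𝓡 n) M => θ v.1 v.2) := by
  intro v₀
  set p := v₀.1 with hp
  have hs : {v : TangentBundle (𝓡 n) M | v.1 ∈ (extChartAt (𝓡 n) p).source} ∈ 𝓝 v₀ :=
    (FiberBundle.continuous_proj _ _).continuousAt.preimage_mem_nhds
      ((isOpen_extChartAt_source p).mem_nhds (mem_extChartAt_source p))
  have h1 : ContMDiffAt (𝓡 n).tangent 𝓘(ℝ, EuclideanSpace ℝ (Fin n) →L[ℝ] (Fin k → ℝ)) ∞
      (fun v : TangentBundle (𝓡 n) M => chartForm θ p (extChartAt (𝓡 n) p v.1)) v₀ := by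
    have h0 : ContMDiffAt (𝓡 n).tangent (𝓡 n) ∞ (fun v : TangentBundle (𝓡 n) M => v.1) v₀ :=
      (Bundle.contMDiff_proj (TangentSpace (𝓡 n))).contMDiffAt
    exact ContMDiffAt.comp (g := chartForm θ p)
      (f := fun v : TangentBundle (𝓡 n) M => extChartAt (𝓡 n) p v.1)
      (I' := 𝓘(ℝ, EuclideanSpace ℝ (Fin n))) v₀ (h p).contMDiffAt
      (ContMDiffAt.comp (g := extChartAt (𝓡 n) p) (f := fun v : TangentBundle (𝓡 n) M => v.1)
        v₀ contMDiffAt_extChartAt h0)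
  have h2 := (contMDiffOn_mfderiv_extChartAt p).contMDiffAt hs
  refine (h1.clm_apply h2).congr_of_eventuallyEq ?_
  filter_upwards [hs] with v hv
  exact form_eq_chartForm θ hv v.2

theorem contDiffOn_chartVectorField {W : ∀ p : M, TangentSpace (𝓡 n) p}
    (hW : ContMDiff (𝓡 n) (𝓡 n).tangent ∞ (fun p => (⟨p, W p⟩ : TangentBundle (𝓡 n) M))) (p : M) :
    ContDiffOn ℝ ∞ (fun y => (mfderiv (𝓡 n) 𝓘(ℝ, EuclideanSpace ℝ (Fin n)) (extChartAt (𝓡 n) p)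
      ((extChartAt (𝓡 n) p).symm y) (W ((extChartAt (𝓡 n) p).symm y)) : EuclideanSpace ℝ (Fin n)))
      (extChartAt (𝓡 n) p).target :=
  ((contMDiffOn_mfderiv_extChartAt p).comp
    (hW.comp_contMDiffOn (contMDiffOn_extChartAt_symm (I := 𝓡 n) (n := ∞) p))
    fun _ hy => (extChartAt (𝓡 n) p).map_target hy).contDiffOn

variable {m : ℕ} {N : Type*} [TopologicalSpace N] [ChartedSpace (EuclideanSpace ℝ (Fin m)) N]
  [IsManifold (𝓡 m) ∞ N]

/-- The derivative of a map read in charts. -/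
theorem fderiv_writtenInCharts {f : M → N} {p : M} {p' : N} {y : EuclideanSpace ℝ (Fin n)}
    (hy : y ∈ (extChartAt (𝓡 n) p).target)
    (hf : MDifferentiableAt (𝓡 n) (𝓡 m) f ((extChartAt (𝓡 n) p).symm y))
    (hy' : f ((extChartAt (𝓡 n) p).symm y) ∈ (extChartAt (𝓡 m) p').source)
    (w : EuclideanSpace ℝ (Fin n)) :
    fderiv ℝ (fun z => extChartAt (𝓡 m) p' (f ((extChartAt (𝓡 n) p).symm z))) y w =
      mfderiv (𝓡 m) 𝓘(ℝ, EuclideanSpace ℝ (Fin m)) (extChartAt (𝓡 m) p')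
          (f ((extChartAt (𝓡 n) p).symm y))
        (mfderiv (𝓡 n) (𝓡 m) f ((extChartAt (𝓡 n) p).symm y)
          (mfderiv 𝓘(ℝ, EuclideanSpace ℝ (Fin n)) (𝓡 n) (extChartAt (𝓡 n) p).symm y w)) := by
  have h1 := (mdifferentiableAt_extChartAt_symm hy).hasMFDerivAt
  have h2 := hf.hasMFDerivAt
  have h3 := (mdifferentiableAt_extChartAt (I := 𝓡 m)
    (mem_chart_of_mem_extChartAt hy')).hasMFDerivAt
  have h := (HasMFDerivAt.comp y h3 (HasMFDerivAt.comp y h2 h1)).mfderiv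
  rw [mfderiv_eq_fderiv] at h
  exact congrArg (fun T => T w) h

theorem contDiffAt_writtenInCharts {f : M → N} {p : M} {p' : N} {y : EuclideanSpace ℝ (Fin n)}
    (hy : y ∈ (extChartAt (𝓡 n) p).target)
    (hf : ContMDiffAt (𝓡 n) (𝓡 m) ∞ f ((extChartAt (𝓡 n) p).symm y))
    (hy' : f ((extChartAt (𝓡 n) p).symm y) ∈ (extChartAt (𝓡 m) p').source) :
    ContDiffAt ℝ ∞ (fun z => extChartAt (𝓡 m) p' (f ((extChartAt (𝓡 n) p).symm z))) y := by
  have h1 : ContMDiffAt 𝓘(ℝ, EuclideanSpace ℝ (Fin n)) (𝓡 n) ∞ (extChartAt (𝓡 n) p).symm y :=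
    (contMDiffOn_extChartAt_symm (I := 𝓡 n) (n := ∞) p).contMDiffAt
      (extChartAt_target_mem_nhds' (by simpa using hy))
  have h3 : ContMDiffAt (𝓡 m) 𝓘(ℝ, EuclideanSpace ℝ (Fin m)) ∞ (extChartAt (𝓡 m) p')
      (f ((extChartAt (𝓡 n) p).symm y)) :=
    contMDiffAt_extChartAt' (mem_chart_of_mem_extChartAt hy')
  exact (ContMDiffAt.comp y h3 (ContMDiffAt.comp y hf h1)).contDiffAt

theorem fderiv_chartChange {p q : M} {y : EuclideanSpace ℝ (Fin n)}
    (hy : y ∈ (extChartAt (𝓡 n) p).target)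
    (hy' : (extChartAt (𝓡 n) p).symm y ∈ (extChartAt (𝓡 n) q).source)
    (w : EuclideanSpace ℝ (Fin n)) :
    fderiv ℝ (fun z => extChartAt (𝓡 n) q ((extChartAt (𝓡 n) p).symm z)) y w =
      mfderiv (𝓡 n) 𝓘(ℝ, EuclideanSpace ℝ (Fin n)) (extChartAt (𝓡 n) q)
          ((extChartAt (𝓡 n) p).symm y)
        (mfderiv 𝓘(ℝ, EuclideanSpace ℝ (Fin n)) (𝓡 n) (extChartAt (𝓡 n) p).symm y w) := by
  have h1 := (mdifferentiableAt_extChartAt_symm hy).hasMFDerivAt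
  have h3 := (mdifferentiableAt_extChartAt (I := 𝓡 n)
    (mem_chart_of_mem_extChartAt hy')).hasMFDerivAt
  have h := (HasMFDerivAt.comp y h3 h1).mfderiv
  rw [mfderiv_eq_fderiv] at h
  exact congrArg (fun T => T w) h

/-- The representatives of a one-form in two charts differ by the pullback along the change of
charts. -/
theorem chartForm_change {k : ℕ} (θ : ∀ p : M, TangentSpace (𝓡 n) p →L[ℝ] (Fin k → ℝ)) {p q : M}
    {y : EuclideanSpace ℝ (Fin n)} (hy : y ∈ (extChartAt (𝓡 n) p).target)
    (hy' : (extChartAt (𝓡 n) p).symm y ∈ (extChartAt (𝓡 n) q).source) :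
    chartForm θ p y = (chartForm θ q (extChartAt (𝓡 n) q ((extChartAt (𝓡 n) p).symm y))).comp
      (fderiv ℝ (fun z => extChartAt (𝓡 n) q ((extChartAt (𝓡 n) p).symm z)) y) := by
  ext1 w
  rw [ContinuousLinearMap.comp_apply, fderiv_chartChange hy hy' w]
  exact form_eq_chartForm θ hy' _

/-- `extDerivOneForm` at a point uses the chart centered there, so each point of the chart at p
involves a different chart. Naturality of the curl under the change of charts, together with the
derivative of a chart at its own center being the identity, gives one formula valid on the whole
chart. -/
theorem curl_chartForm {k : ℕ} {θ : ∀ p : M, TangentSpace (𝓡 n) p →L[ℝ] (Fin k → ℝ)}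
    (hθ : ContMDiff (𝓡 n).tangent 𝓘(ℝ, Fin k → ℝ) ∞
      (fun v : TangentBundle (𝓡 n) M => θ v.1 v.2)) {p : M} {y : EuclideanSpace ℝ (Fin n)}
    (hy : y ∈ (extChartAt (𝓡 n) p).target) (v w : EuclideanSpace ℝ (Fin n)) :
    curl (chartForm θ p) y v w = extDerivOneForm θ ((extChartAt (𝓡 n) p).symm y)
      (mfderiv 𝓘(ℝ, EuclideanSpace ℝ (Fin n)) (𝓡 n) (extChartAt (𝓡 n) p).symm y v)
      (mfderiv 𝓘(ℝ, EuclideanSpace ℝ (Fin n)) (𝓡 n) (extChartAt (𝓡 n) p).symm y w) := by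
  set q := (extChartAt (𝓡 n) p).symm y with hq
  have hqs : q ∈ (extChartAt (𝓡 n) q).source := mem_extChartAt_source q
  set κ := fun z => extChartAt (𝓡 n) q ((extChartAt (𝓡 n) p).symm z) with hκ
  have hc : ∀ᶠ z in 𝓝 y, chartForm θ p z = (chartForm θ q (κ z)).comp (fderiv ℝ κ z) := by
    have h1 : (extChartAt (𝓡 n) p).target ∈ 𝓝 y := (isOpen_extChartAt_target p).mem_nhds hy
    have h2 := ((mdifferentiableAt_extChartAt_symm hy).continuousAt).preimage_mem_nhds
      ((isOpen_extChartAt_source q).mem_nhds hqs)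
    filter_upwards [h1, h2] with z hz hz'
    exact chartForm_change θ hz hz'
  have hκ2 : ContDiffAt ℝ 2 κ y :=
    (contDiffAt_writtenInCharts (f := id) hy contMDiffAt_id hqs).of_le ENat.LEInfty.out
  have hd : DifferentiableAt ℝ (chartForm θ q) (κ y) :=
    ((contDiffOn_chartForm hθ q).contDiffAt (extChartAt_target_mem_nhds q)).differentiableAt
      (by simp)
  have hD : ∀ u : EuclideanSpace ℝ (Fin n), fderiv ℝ κ y u =
      mfderiv 𝓘(ℝ, EuclideanSpace ℝ (Fin n)) (𝓡 n) (extChartAt (𝓡 n) p).symm y u := by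
    intro u
    rw [hκ, fderiv_chartChange hy hqs, mfderiv_extChartAt_self]
    rfl
  rw [curl_congr hc, curl_pullback hκ2 hd, hD, hD]
  rfl

end Charts

end CartanRealization

namespace CartanRealization

/-! ### Realizations in charts -/

open Set

namespace CartanData

variable {n d : ℕ} {X : Type*} [TopologicalSpace X] [ChartedSpace (EuclideanSpace ℝ (Fin d)) X]
  [IsManifold (𝓡 d) ∞ X] (D : CartanData n d X)

/-- The anchor in the chart of `X` at `x`. -/
noncomputable def chartAnchor (x : X) (z : EuclideanSpace ℝ (Fin d)) :
    (Fin n → ℝ) →L[ℝ] EuclideanSpace ℝ (Fin d) :=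
  ∑ i, (ContinuousLinearMap.proj (R := ℝ) (φ := fun _ : Fin n => ℝ) i).smulRight
    (mfderiv (𝓡 d) 𝓘(ℝ, EuclideanSpace ℝ (Fin d)) (extChartAt (𝓡 d) x)
      ((extChartAt (𝓡 d) x).symm z) (D.F i ((extChartAt (𝓡 d) x).symm z)) :
        EuclideanSpace ℝ (Fin d))

theorem chartAnchor_apply (x : X) (z : EuclideanSpace ℝ (Fin d)) (a : Fin n → ℝ) :
    D.chartAnchor x z a = mfderiv (𝓡 d) 𝓘(ℝ, EuclideanSpace ℝ (Fin d)) (extChartAt (𝓡 d) x)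
      ((extChartAt (𝓡 d) x).symm z) (D.anchor ((extChartAt (𝓡 d) x).symm z) a) := by
  simp only [anchor, map_sum, map_smul, chartAnchor, sum_apply]
  rfl

theorem contDiffOn_chartAnchor (x : X) :
    ContDiffOn ℝ ∞ (D.chartAnchor x) (extChartAt (𝓡 d) x).target := by
  unfold chartAnchor
  refine ContDiffOn.sum fun i _ => ?_
  exact contDiffOn_const.smulRight (contDiffOn_chartVectorField (D.contMDiff_F i) x)

end CartanData

namespace Realization

variable {n d : ℕ} {X : Type*} [TopologicalSpace X] [ChartedSpace (EuclideanSpace ℝ (Fin d)) X]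
  [IsManifold (𝓡 d) ∞ X] {D : CartanData n d X} {M : Type*} [TopologicalSpace M]
  [ChartedSpace (EuclideanSpace ℝ (Fin n)) M] [IsManifold (𝓡 n) ∞ M] (R : Realization D M)

theorem bijective_chartForm {p : M} {y : EuclideanSpace ℝ (Fin n)}
    (hy : y ∈ (extChartAt (𝓡 n) p).target) : Function.Bijective (chartForm R.θ p y) := by
  refine (R.coframe ((extChartAt (𝓡 n) p).symm y)).comp ⟨fun v w h => ?_, fun v => ?_⟩
  · rw [← mfderiv_extChartAt_mfderiv_symm hy v, ← mfderiv_extChartAt_mfderiv_symm hy w]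
    exact congrArg _ h
  · exact ⟨_, mfderiv_symm_mfderiv_extChartAt' hy v⟩

theorem curl_chartForm_apply {p : M} {y : EuclideanSpace ℝ (Fin n)}
    (hy : y ∈ (extChartAt (𝓡 n) p).target) (v w : EuclideanSpace ℝ (Fin n)) (k : Fin n) :
    curl (chartForm R.θ p) y v w k = ∑ i, ∑ j ∈ Finset.Ioi i,
      D.C i j k (R.h ((extChartAt (𝓡 n) p).symm y)) *
        (chartForm R.θ p y v i * chartForm R.θ p y w j
          - chartForm R.θ p y v j * chartForm R.θ p y w i) := by
  rw [curl_chartForm R.contMDiff_θ hy]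
  exact R.structure_θ _ _ _ k

/-- In charts, h solves a total differential equation whose dependence on the realization is only
through its coframe. This is what allows h and h' to be compared along a development. -/
theorem hasFDerivAt_chart_h {p : M} {x : X} {y : EuclideanSpace ℝ (Fin n)}
    (hy : y ∈ (extChartAt (𝓡 n) p).target)
    (hx : R.h ((extChartAt (𝓡 n) p).symm y) ∈ (extChartAt (𝓡 d) x).source) :
    HasFDerivAt (fun z => extChartAt (𝓡 d) x (R.h ((extChartAt (𝓡 n) p).symm z)))
      ((D.chartAnchor x (extChartAt (𝓡 d) x (R.h ((extChartAt (𝓡 n) p).symm y)))).comp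
        (chartForm R.θ p y)) y := by
  have hd := (contDiffAt_writtenInCharts hy R.contMDiff_h.contMDiffAt hx).differentiableAt
    (by simp)
  refine hd.hasFDerivAt.congr_fderiv ?_
  ext1 w
  rw [fderiv_writtenInCharts hy (R.contMDiff_h.mdifferentiableAt (by simp)) hx, R.structure_h,
    ContinuousLinearMap.comp_apply, CartanData.chartAnchor_apply, (extChartAt (𝓡 d) x).left_inv hx]
  rfl

end Realization

/-! ### Developments -/

section Development

variable {n d : ℕ} {X : Type*} [TopologicalSpace X] [ChartedSpace (EuclideanSpace ℝ (Fin d)) X]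
  [IsManifold (𝓡 d) ∞ X] {D : CartanData n d X}
  {M : Type*} [TopologicalSpace M] [ChartedSpace (EuclideanSpace ℝ (Fin n)) M]
  [IsManifold (𝓡 n) ∞ M]
  {M' : Type*} [TopologicalSpace M'] [ChartedSpace (EuclideanSpace ℝ (Fin n)) M']
  [IsManifold (𝓡 n) ∞ M']
  {M'' : Type*} [TopologicalSpace M''] [ChartedSpace (EuclideanSpace ℝ (Fin n)) M'']
  [IsManifold (𝓡 n) ∞ M'']

/-- A development of `R` along `R'`, on the set `U`: a smooth map that pulls back `R'` to `R`. -/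
structure IsDevelopment (R : Realization D M) (R' : Realization D M') (U : Set M) (σ : M → M') :
    Prop where
  contMDiffAt : ∀ q ∈ U, ContMDiffAt (𝓡 n) (𝓡 n) ∞ σ q
  θ : ∀ q ∈ U, ∀ v : TangentSpace (𝓡 n) q, R'.θ (σ q) (mfderiv (𝓡 n) (𝓡 n) σ q v) = R.θ q v
  h : ∀ q ∈ U, R'.h (σ q) = R.h q

variable {R : Realization D M} {R' : Realization D M'} {R'' : Realization D M''}

theorem IsDevelopment.id (R : Realization D M) (U : Set M) : IsDevelopment R R U id where
  contMDiffAt _ _ := contMDiffAt_id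
  θ q _ v := by rw [mfderiv_id]; rfl
  h _ _ := rfl

theorem IsDevelopment.comp {U : Set M} {U' : Set M'} {σ : M → M'} {τ : M' → M''}
    (hτ : IsDevelopment R' R'' U' τ) (hσ : IsDevelopment R R' U σ) (h : MapsTo σ U U') :
    IsDevelopment R R'' U (τ ∘ σ) where
  contMDiffAt q hq := (hτ.contMDiffAt _ (h hq)).comp q (hσ.contMDiffAt q hq)
  θ q hq v := by
    rw [mfderiv_comp q ((hτ.contMDiffAt _ (h hq)).mdifferentiableAt (by simp))
      ((hσ.contMDiffAt q hq).mdifferentiableAt (by simp)), ← hσ.θ q hq, ← hτ.θ _ (h hq)]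
    rfl
  h q hq := (hτ.h _ (h hq)).trans (hσ.h q hq)

theorem IsDevelopment.mono {U V : Set M} {σ : M → M'} (hσ : IsDevelopment R R' V σ) (h : U ⊆ V) :
    IsDevelopment R R' U σ :=
  ⟨fun q hq => hσ.contMDiffAt q (h hq), fun q hq => hσ.θ q (h hq), fun q hq => hσ.h q (h hq)⟩

theorem IsDevelopment.congr {U : Set M} (hU : IsOpen U) {σ τ : M → M'}
    (hσ : IsDevelopment R R' U σ) (h : EqOn τ σ U) : IsDevelopment R R' U τ := by
  have e : ∀ q ∈ U, τ =ᶠ[𝓝 q] σ := fun q hq => h.eventuallyEq_of_mem (hU.mem_nhds hq)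
  refine ⟨fun q hq => (hσ.contMDiffAt q hq).congr_of_eventuallyEq (e q hq), fun q hq v => ?_,
    fun q hq => by rw [h hq, hσ.h q hq]⟩
  rw [(e q hq).mfderiv_eq, ← hσ.θ q hq v]
  congr 1
  rw [h hq]

/-- The coefficients of the equation satisfied by developments in charts. -/
noncomputable def devField (R : Realization D M) (R' : Realization D M') (p : M) (p' : M')
    (z : EuclideanSpace ℝ (Fin n) × EuclideanSpace ℝ (Fin n)) :
    EuclideanSpace ℝ (Fin n) →L[ℝ] EuclideanSpace ℝ (Fin n) :=
  (chartForm R'.θ p' z.2).inverse.comp (chartForm R.θ p z.1)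

theorem chartForm_comp_devField {p : M} {p' : M'}
    {z : EuclideanSpace ℝ (Fin n) × EuclideanSpace ℝ (Fin n)}
    (hz : z.2 ∈ (extChartAt (𝓡 n) p').target) :
    (chartForm R'.θ p' z.2).comp (devField R R' p p' z) = chartForm R.θ p z.1 := by
  have hb := R'.bijective_chartForm hz
  set e := ContinuousLinearEquiv.ofBijective (chartForm R'.θ p' z.2)
    (LinearMap.ker_eq_bot.2 hb.1) (LinearMap.range_eq_top.2 hb.2) with he
  have : chartForm R'.θ p' z.2 = e := rfl
  rw [devField, this, ContinuousLinearMap.inverse_equiv]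
  ext1 v
  exact e.apply_symm_apply _

theorem contDiffOn_devField (p : M) (p' : M') :
    ContDiffOn ℝ ∞ (devField R R' p p')
      ((extChartAt (𝓡 n) p).target ×ˢ (extChartAt (𝓡 n) p').target) := by
  intro z hz
  have hb := R'.bijective_chartForm hz.2
  set e := ContinuousLinearEquiv.ofBijective (chartForm R'.θ p' z.2)
    (LinearMap.ker_eq_bot.2 hb.1) (LinearMap.range_eq_top.2 hb.2) with he
  have hi : ContDiffAt ℝ ∞ ContinuousLinearMap.inverse (chartForm R'.θ p' z.2) :=
    contDiffAt_map_inverse e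
  have h1 : ContDiffAt ℝ ∞ (chartForm R'.θ p') z.2 :=
    (contDiffOn_chartForm R'.contMDiff_θ p').contDiffAt
      ((isOpen_extChartAt_target p').mem_nhds hz.2)
  have h2 : ContDiffAt ℝ ∞ (chartForm R.θ p) z.1 :=
    (contDiffOn_chartForm R.contMDiff_θ p).contDiffAt
      ((isOpen_extChartAt_target p).mem_nhds hz.1)
  exact ((hi.comp z (h1.comp z contDiffAt_snd)).clm_comp
    (h2.comp z contDiffAt_fst)).contDiffWithinAt

theorem IsDevelopment.hasFDerivAt {U : Set M} {σ : M → M'} (hσ : IsDevelopment R R' U σ) {p : M}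
    {p' : M'} {y : EuclideanSpace ℝ (Fin n)} (hy : y ∈ (extChartAt (𝓡 n) p).target)
    (hU : (extChartAt (𝓡 n) p).symm y ∈ U)
    (hy' : σ ((extChartAt (𝓡 n) p).symm y) ∈ (extChartAt (𝓡 n) p').source) :
    HasFDerivAt (fun z => extChartAt (𝓡 n) p' (σ ((extChartAt (𝓡 n) p).symm z)))
      (devField R R' p p' (y, extChartAt (𝓡 n) p' (σ ((extChartAt (𝓡 n) p).symm y)))) y := by
  have hd := (contDiffAt_writtenInCharts hy (hσ.contMDiffAt _ hU) hy').differentiableAt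
    (by simp)
  refine hd.hasFDerivAt.congr_fderiv ?_
  ext1 w
  have ht := (extChartAt (𝓡 n) p').map_source hy'
  apply (R'.bijective_chartForm ht).1
  rw [fderiv_writtenInCharts hy ((hσ.contMDiffAt _ hU).mdifferentiableAt (by simp)) hy']
  have h1 := congrArg (fun T => T w) (chartForm_comp_devField (R := R) (R' := R') (p := p)
    (z := (y, extChartAt (𝓡 n) p' (σ ((extChartAt (𝓡 n) p).symm y)))) ht)
  refine Eq.trans ?_ h1.symm
  exact (form_eq_chartForm R'.θ hy' _).symm.trans (hσ.θ _ hU _)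

/-- Developments with the same value at a point agree near it. -/
theorem IsDevelopment.eventuallyEq {U V : Set M} {σ τ : M → M'} (hσ : IsDevelopment R R' U σ)
    (hτ : IsDevelopment R R' V τ) (hU : IsOpen U) (hV : IsOpen V) {p : M} (hpU : p ∈ U)
    (hpV : p ∈ V) (h : σ p = τ p) : σ =ᶠ[𝓝 p] τ := by
  set φ := extChartAt (𝓡 n) p with hφ
  set φ' := extChartAt (𝓡 n) (σ p) with hφ'
  have hA : ContDiffAt ℝ 1 (devField R R' p (σ p)) (φ p, φ' (σ p)) :=
    ((contDiffOn_devField p (σ p)).contDiffAt (prod_mem_nhds (extChartAt_target_mem_nhds p)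
      (extChartAt_target_mem_nhds (σ p)))).of_le ENat.LEInfty.out
  have key : ∀ {W : Set M} {ρ : M → M'}, IsDevelopment R R' W ρ → IsOpen W → p ∈ W → ρ p = σ p →
      ∀ᶠ y in 𝓝 (φ p), HasFDerivAt (fun z => φ' (ρ (φ.symm z)))
        (devField R R' p (σ p) (y, φ' (ρ (φ.symm y)))) y := by
    intro W ρ hρ hW hpW e
    have c : ContinuousAt φ.symm (φ p) := continuousAt_extChartAt_symm p
    have e0 : φ.symm (φ p) = p := extChartAt_to_inv p
    have h1 : ∀ᶠ q in 𝓝 p, q ∈ W ∧ ρ q ∈ φ'.source := by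
      refine Filter.Eventually.and (hW.mem_nhds hpW)
        ((hρ.contMDiffAt p hpW).continuousAt.eventually_mem ?_)
      rw [e]
      exact extChartAt_source_mem_nhds (σ p)
    have h2 := c.eventually (by rw [e0]; exact h1)
    filter_upwards [h2, extChartAt_target_mem_nhds p] with y hy hyt
    exact hρ.hasFDerivAt hyt hy.1 hy.2
  have e0 : φ.symm (φ p) = p := extChartAt_to_inv p
  have := eventuallyEq_of_hasFDerivAt hA (f := fun z => φ' (σ (φ.symm z)))
    (g := fun z => φ' (τ (φ.symm z))) (by simp only [e0]) (by simp only [e0, h])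
    (key hσ hU hpU rfl) (key hτ hV hpV h.symm)
  have h3 := (continuousAt_extChartAt p).eventually this
  have c1 := (hσ.contMDiffAt p hpU).continuousAt.preimage_mem_nhds
    (extChartAt_source_mem_nhds (I := 𝓡 n) (σ p))
  have c2 := (hτ.contMDiffAt p hpV).continuousAt.preimage_mem_nhds
    (by rw [← h]; exact extChartAt_source_mem_nhds (I := 𝓡 n) (σ p))
  filter_upwards [h3, extChartAt_source_mem_nhds (I := 𝓡 n) p, c1, c2] with q hq hqs a b
  rw [φ.left_inv hqs] at hq
  exact φ'.injOn a b hq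

/-- Realizations are locally equivalent at points with the same image in `X`. -/
theorem exists_isDevelopment (R : Realization D M) (R' : Realization D M') {p : M} {p' : M'}
    (h : R.h p = R'.h p') :
    ∃ (U : Set M) (σ : M → M'), IsOpen U ∧ p ∈ U ∧ σ p = p' ∧ IsDevelopment R R' U σ := by
  set φ := extChartAt (𝓡 n) p with hφ
  set φ' := extChartAt (𝓡 n) p' with hφ'
  set ψ := extChartAt (𝓡 d) (R.h p) with hψ
  have e0 : φ.symm (φ p) = p := extChartAt_to_inv p
  have e0' : φ'.symm (φ' p') = p' := extChartAt_to_inv p'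
  have hT : φ.target ×ˢ φ'.target ∈ 𝓝 (φ p, φ' p') :=
    prod_mem_nhds (extChartAt_target_mem_nhds p) (extChartAt_target_mem_nhds p')
  have hTo : IsOpen (φ.target ×ˢ φ'.target) :=
    (isOpen_extChartAt_target p).prod (isOpen_extChartAt_target p')
  set A := devField R R' p p' with hAdef
  have hAs : ContDiffOn ℝ ∞ A (φ.target ×ˢ φ'.target) := contDiffOn_devField p p'
  have hA : ContDiffAt ℝ 2 A (φ p, φ' p') := (hAs.contDiffAt hT).of_le ENat.LEInfty.out
  -- The fiber product of h and h' in charts. The structure functions agree on it, so the curls of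
  -- the two coframes correspond there and the equation is integrable.
  set Z : Set (EuclideanSpace ℝ (Fin n) × EuclideanSpace ℝ (Fin n)) :=
    {z | R.h (φ.symm z.1) = R'.h (φ'.symm z.2)} with hZ
  have hcomp : ∀ z ∈ φ.target ×ˢ φ'.target,
      (chartForm R'.θ p' z.2).comp (A z) = chartForm R.θ p z.1 :=
    fun z hz => chartForm_comp_devField hz.2
  have hint : ∀ᶠ z in 𝓝 (φ p, φ' p'), z ∈ Z → ∀ v w,
      fderiv ℝ A z (v, A z v) w = fderiv ℝ A z (w, A z w) v := by
    filter_upwards [hT] with z hz hzZ v w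
    have hzn := hTo.mem_nhds hz
    refine integrable_of_curl_eq (Ω := chartForm R'.θ p') (Θ := chartForm R.θ p)
      ((hAs.contDiffAt hzn).differentiableAt (by simp))
      (((contDiffOn_chartForm R'.contMDiff_θ p').contDiffAt
        ((isOpen_extChartAt_target p').mem_nhds hz.2)).differentiableAt (by simp))
      (((contDiffOn_chartForm R.contMDiff_θ p).contDiffAt
        ((isOpen_extChartAt_target p).mem_nhds hz.1)).differentiableAt (by simp))
      (by filter_upwards [hzn] with z' hz' using hcomp z' hz')
      (R'.bijective_chartForm hz.2).1 (fun v w => ?_) v w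
    ext k
    have hv : ∀ v, chartForm R'.θ p' z.2 (A z v) = chartForm R.θ p z.1 v :=
      fun v => congrArg (fun T => T v) (hcomp z hz)
    have hzZ' : R.h (φ.symm z.1) = R'.h (φ'.symm z.2) := hzZ
    rw [R.curl_chartForm_apply hz.1, R'.curl_chartForm_apply hz.2, hv, hv, hzZ']
  -- Along a radial solution the two coframes take the same value on the velocity. So h and h', read
  -- in the chart ψ, solve the same differential equation with the same initial value, and the
  -- solution does not leave Z.
  have hstay : ∃ W ∈ 𝓝 (φ p, φ' p'), ∀ (v : EuclideanSpace ℝ (Fin n))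
      (u : ℝ → EuclideanSpace ℝ (Fin n)), u 0 = φ' p' →
      (∀ t ∈ Icc (0 : ℝ) 1, (φ p + t • v, u t) ∈ W) →
      (∀ t ∈ Icc (0 : ℝ) 1, HasDerivWithinAt u (A (φ p + t • v, u t) v) (Icc 0 1) t) →
      ∀ t ∈ Icc (0 : ℝ) 1, (φ p + t • v, u t) ∈ Z := by
    set H := fun z => ψ (R.h (φ.symm z)) with hH
    set H' := fun z => ψ (R'.h (φ'.symm z)) with hH'
    obtain ⟨K, S, hS, hK⟩ := ContDiffAt.exists_lipschitzOnWith
      (((D.contDiffOn_chartAnchor (R.h p)).contDiffAt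
        (extChartAt_target_mem_nhds (I := 𝓡 d) (R.h p))).of_le ENat.LEInfty.out :
        ContDiffAt ℝ 1 (D.chartAnchor (R.h p)) (ψ (R.h p)))
    have hΘc : ContinuousAt (chartForm R.θ p) (φ p) :=
      ((contDiffOn_chartForm R.contMDiff_θ p).contDiffAt
        (extChartAt_target_mem_nhds p)).continuousAt
    obtain ⟨c, hc⟩ : ∃ c : NNReal, ‖chartForm R.θ p (φ p)‖ < c :=
      ⟨⟨‖chartForm R.θ p (φ p)‖ + 1, by positivity⟩, lt_add_one _⟩
    have c1 : ContinuousAt (fun z => R.h (φ.symm z)) (φ p) :=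
      ContinuousAt.comp (g := R.h) R.contMDiff_h.continuous.continuousAt
        (continuousAt_extChartAt_symm p)
    have c2 : ContinuousAt (fun z => R'.h (φ'.symm z)) (φ' p') :=
      ContinuousAt.comp (g := R'.h) R'.contMDiff_h.continuous.continuousAt
        (continuousAt_extChartAt_symm p')
    have c3 : ContinuousAt H (φ p) := ContinuousAt.comp (g := ψ) (by
      rw [e0]; exact continuousAt_extChartAt (R.h p)) c1
    have c4 : ContinuousAt H' (φ' p') := ContinuousAt.comp (g := ψ) (by
      rw [e0', ← h]; exact continuousAt_extChartAt (R.h p)) c2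
    have n1 : ∀ᶠ y in 𝓝 (φ p), R.h (φ.symm y) ∈ ψ.source ∧ H y ∈ S ∧
        ‖chartForm R.θ p y‖ < c := by
      refine (c1.eventually_mem (by rw [e0]; exact extChartAt_source_mem_nhds _)).and
        ((c3.eventually_mem ?_).and (hΘc.norm.eventually_lt_const hc))
      simp only [hH, e0]
      exact hS
    have n2 : ∀ᶠ y in 𝓝 (φ' p'), R'.h (φ'.symm y) ∈ ψ.source ∧ H' y ∈ S := by
      refine (c2.eventually_mem (by rw [e0', ← h]; exact extChartAt_source_mem_nhds _)).and
        (c4.eventually_mem ?_)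
      simp only [hH', e0', ← h]
      exact hS
    refine ⟨_, Filter.inter_mem hT (n1.prod_nhds n2), fun v u hu0 huW hu t ht => ?_⟩
    have hl : ∀ t : ℝ, HasDerivWithinAt (fun t => φ p + t • v) v (Icc 0 1) t := fun t => by
      simpa using (((hasDerivAt_id t).smul_const v).const_add (φ p)).hasDerivWithinAt
    have d1 : ∀ t ∈ Icc (0 : ℝ) 1, HasDerivWithinAt (fun t => H (φ p + t • v))
        (D.chartAnchor (R.h p) (H (φ p + t • v)) (chartForm R.θ p (φ p + t • v) v))
        (Icc 0 1) t := fun t ht => by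
      have hf : HasFDerivAt H _ (φ p + t • v) :=
        R.hasFDerivAt_chart_h (huW t ht).1.1 (huW t ht).2.1.1
      exact hf.comp_hasDerivWithinAt t (hl t)
    have d2 : ∀ t ∈ Icc (0 : ℝ) 1, HasDerivWithinAt (fun t => H' (u t))
        (D.chartAnchor (R.h p) (H' (u t)) (chartForm R.θ p (φ p + t • v) v))
        (Icc 0 1) t := fun t ht => by
      have := (R'.hasFDerivAt_chart_h (huW t ht).1.2 (huW t ht).2.2.1).comp_hasDerivWithinAt t
        (hu t ht)
      rw [ContinuousLinearMap.comp_apply] at this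
      have e := congrArg (fun T => T v) (hcomp _ (huW t ht).1)
      simp only [ContinuousLinearMap.comp_apply] at e
      rwa [e] at this
    -- The Lipschitz constant is that of the anchor in the chart, K, times the bound c ‖v‖ on the
    -- coframe evaluated on the velocity.
    have eq := ODE_solution_unique_of_mem_Icc_right (a := 0) (b := 1)
      (K := K * (c * ‖v‖₊)) (s := fun _ => S)
      (v := fun t z => D.chartAnchor (R.h p) z (chartForm R.θ p (φ p + t • v) v))
      (f := fun t => H (φ p + t • v)) (g := fun t => H' (u t))
      (fun t ht => by
        have ht' := Ico_subset_Icc_self ht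
        refine LipschitzOnWith.of_dist_le_mul fun z hz z' hz' => ?_
        rw [dist_eq_norm, ← sub_apply]
        refine (ContinuousLinearMap.le_opNorm _ _).trans ?_
        have a1 := hK.dist_le_mul z hz z' hz'
        rw [dist_eq_norm] at a1
        have a2 : ‖chartForm R.θ p (φ p + t • v) v‖ ≤ c * ‖v‖ :=
          ContinuousLinearMap.le_of_opNorm_le _ (huW t ht').2.1.2.2.le v
        calc _ ≤ (K * dist z z') * (c * ‖v‖) := by gcongr
          _ = _ := by push_cast; ring)
      (fun t ht => (d1 t ht).continuousWithinAt)
      (fun t ht => ((d1 t (Ico_subset_Icc_self ht)).mono_of_mem_nhdsWithin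
        (Icc_mem_nhdsGE_of_mem ht)))
      (fun t ht => (huW t (Ico_subset_Icc_self ht)).2.1.2.1)
      (fun t ht => (d2 t ht).continuousWithinAt)
      (fun t ht => ((d2 t (Ico_subset_Icc_self ht)).mono_of_mem_nhdsWithin
        (Icc_mem_nhdsGE_of_mem ht)))
      (fun t ht => (huW t (Ico_subset_Icc_self ht)).2.2.2)
      (by simp only [hH, hH', zero_smul, add_zero, hu0, e0, e0', h])
    exact ψ.injOn (huW t ht).2.1.1 (huW t ht).2.2.1 (eq ht)
  obtain ⟨f, hf0, hf⟩ := exists_hasFDerivAt_of_integrable hA hint hstay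
  have hfc : ContinuousAt f (φ p) := hf.self_of_nhds.2.continuousAt
  obtain ⟨s, hs, hso, hps⟩ := eventually_nhds_iff.1 ((hf.and (hfc.eventually_mem
    (by rw [hf0]; exact extChartAt_target_mem_nhds p'))).and (extChartAt_target_mem_nhds p))
  have hfs : ContDiffOn ℝ ∞ f s := contDiffOn_infty_of_hasFDerivAt hso hAs
    (fun x hx => ⟨(hs x hx).2, (hs x hx).1.2⟩) (fun x hx => (hs x hx).1.1.2)
  have hU : IsOpen (φ.source ∩ φ ⁻¹' s) := isOpen_extChartAt_preimage' p hso
  refine ⟨φ.source ∩ φ ⁻¹' s, fun q => φ'.symm (f (φ q)), hU, ⟨mem_extChartAt_source p, hps⟩,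
    by simp only [hf0, e0'], ?_⟩
  have hsm1 : ∀ q ∈ φ.source, ContMDiffAt (𝓡 n) 𝓘(ℝ, EuclideanSpace ℝ (Fin n)) ∞ φ q :=
    fun q hq => contMDiffAt_extChartAt' (mem_chart_of_mem_extChartAt hq)
  have hsm2 : ∀ q ∈ φ.source ∩ φ ⁻¹' s, ContMDiffAt 𝓘(ℝ, EuclideanSpace ℝ (Fin n)) (𝓡 n) ∞
      φ'.symm (f (φ q)) := fun q hq =>
    (contMDiffOn_extChartAt_symm (I := 𝓡 n) (n := ∞) p').contMDiffAt
      ((isOpen_extChartAt_target p').mem_nhds (hs _ hq.2).1.2)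
  have hsm3 : ∀ q ∈ φ.source ∩ φ ⁻¹' s, ContMDiffAt 𝓘(ℝ, EuclideanSpace ℝ (Fin n))
      𝓘(ℝ, EuclideanSpace ℝ (Fin n)) ∞ f (φ q) := fun q hq =>
    (hfs.contDiffAt (hso.mem_nhds hq.2)).contMDiffAt
  refine ⟨fun q hq => ?_, fun q hq v => ?_, fun q hq => ?_⟩
  · exact ContMDiffAt.comp (g := φ'.symm) (f := fun q => f (φ q)) q (hsm2 q hq)
      (ContMDiffAt.comp (g := f) (f := φ) q (hsm3 q hq) (hsm1 q hq.1))
  · have k1 := ((hsm1 q hq.1).mdifferentiableAt (by simp)).hasMFDerivAt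
    have k3 := ((hsm2 q hq).mdifferentiableAt (by simp)).hasMFDerivAt
    have k2 : HasMFDerivAt 𝓘(ℝ, EuclideanSpace ℝ (Fin n)) 𝓘(ℝ, EuclideanSpace ℝ (Fin n)) f (φ q)
      (A (φ q, f (φ q))) := (hs _ hq.2).1.1.2.hasMFDerivAt
    have k := (HasMFDerivAt.comp (g := φ'.symm) (f := fun q => f (φ q)) q k3
      (HasMFDerivAt.comp (g := f) (f := φ) q k2 k1)).mfderiv
    have k' := congrArg (fun T => R'.θ (φ'.symm (f (φ q))) (T v)) k
    refine Eq.trans k' ?_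
    have e := congrArg (fun T => T (mfderiv (𝓡 n) 𝓘(ℝ, EuclideanSpace ℝ (Fin n)) φ q v))
      (hcomp (φ q, f (φ q)) ⟨(hs _ hq.2).2, (hs _ hq.2).1.2⟩)
    exact Eq.trans e (form_eq_chartForm R.θ hq.1 v).symm
  · have := (hs _ hq.2).1.1.1
    simp only [hZ, mem_ofPred_eq, φ.left_inv hq.1] at this
    exact this.symm

end Development

end CartanRealization

namespace CartanRealization

open Set

/-! ### Developments are local diffeomorphisms. -/

section Development

variable {n d : ℕ} {X : Type*} [TopologicalSpace X] [ChartedSpace (EuclideanSpace ℝ (Fin d)) X]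
  [IsManifold (𝓡 d) ∞ X] {D : CartanData n d X}
  {M : Type*} [TopologicalSpace M] [ChartedSpace (EuclideanSpace ℝ (Fin n)) M]
  [IsManifold (𝓡 n) ∞ M]
  {M' : Type*} [TopologicalSpace M'] [ChartedSpace (EuclideanSpace ℝ (Fin n)) M']
  [IsManifold (𝓡 n) ∞ M'] {R : Realization D M} {R' : Realization D M'}

theorem IsDevelopment.continuousOn {U : Set M} {σ : M → M'} (hσ : IsDevelopment R R' U σ) :
    ContinuousOn σ U :=
  fun q hq => (hσ.contMDiffAt q hq).continuousAt.continuousWithinAt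

/-- A development τ in the opposite direction through the same pair of points is a local inverse:
both composites are developments of a realization along itself with a fixed point, hence agree with
the identity near it. -/
theorem IsDevelopment.isLocalDiffeomorphAt {U : Set M} {σ : M → M'}
    (hσ : IsDevelopment R R' U σ) (hU : IsOpen U) {p : M} (hp : p ∈ U) :
    IsLocalDiffeomorphAt (𝓡 n) (𝓡 n) ∞ σ p := by
  obtain ⟨V, τ, hV, hpV, hτp, hτ⟩ := exists_isDevelopment R' R (hσ.h p hp)
  have oU : IsOpen (U ∩ σ ⁻¹' V) := hσ.continuousOn.isOpen_inter_preimage hU hV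
  have oV : IsOpen (V ∩ τ ⁻¹' U) := hτ.continuousOn.isOpen_inter_preimage hV hU
  have e1 : τ ∘ σ =ᶠ[𝓝 p] _root_.id :=
    (hτ.comp (hσ.mono inter_subset_left) (U := U ∩ σ ⁻¹' V) fun q hq => hq.2).eventuallyEq
      (IsDevelopment.id R univ) oU isOpen_univ ⟨hp, hpV⟩ (mem_univ _) hτp
  have e2 : σ ∘ τ =ᶠ[𝓝 (σ p)] _root_.id :=
    (hσ.comp (hτ.mono inter_subset_left) (U := V ∩ τ ⁻¹' U) fun q hq => hq.2).eventuallyEq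
      (IsDevelopment.id R' univ) oV isOpen_univ ⟨hpV, by rw [mem_preimage, hτp]; exact hp⟩
      (mem_univ _) (by simp [hτp])
  obtain ⟨U₀, hU₀, oU₀, hpU₀⟩ := eventually_nhds_iff.1 (e1.and (oU.mem_nhds ⟨hp, hpV⟩))
  obtain ⟨V₀, hV₀, oV₀, hpV₀⟩ := eventually_nhds_iff.1
    (e2.and (oV.mem_nhds ⟨hpV, by rw [mem_preimage, hτp]; exact hp⟩))
  have cσ : ContinuousOn σ U₀ := hσ.continuousOn.mono fun q hq => (hU₀ q hq).2.1
  have cτ : ContinuousOn τ V₀ := hτ.continuousOn.mono fun q hq => (hV₀ q hq).2.1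
  refine ⟨{ toFun := σ, invFun := τ, source := U₀ ∩ σ ⁻¹' V₀, target := V₀ ∩ τ ⁻¹' U₀,
            map_source' := fun q hq => ⟨hq.2, ?_⟩, map_target' := fun q hq => ⟨hq.2, ?_⟩,
            left_inv' := fun q hq => (hU₀ q hq.1).1, right_inv' := fun q hq => (hV₀ q hq.1).1,
            open_source := cσ.isOpen_inter_preimage oU₀ oV₀,
            open_target := cτ.isOpen_inter_preimage oV₀ oU₀,
            contMDiffOn_toFun := fun q hq =>
              (hσ.contMDiffAt q (hU₀ q hq.1).2.1).contMDiffWithinAt,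
            contMDiffOn_invFun := fun q hq =>
              (hτ.contMDiffAt q (hV₀ q hq.1).2.1).contMDiffWithinAt },
    ⟨hpU₀, hpV₀⟩, fun q _ => rfl⟩
  · have := (hU₀ q hq.1).1
    simp only [Function.comp_apply, _root_.id] at this
    rw [mem_preimage, this]
    exact hq.1
  · have := (hV₀ q hq.1).1
    simp only [Function.comp_apply, _root_.id] at this
    rw [mem_preimage, this]
    exact hq.1

end Development

/-! ### The image of a realization lies in an orbit -/

section Orbit

variable {n d : ℕ} {X : Type*} [TopologicalSpace X] [ChartedSpace (EuclideanSpace ℝ (Fin d)) X]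
  [IsManifold (𝓡 d) ∞ X] {D : CartanData n d X}
  {M : Type*} [TopologicalSpace M] [ChartedSpace (EuclideanSpace ℝ (Fin n)) M]
  [IsManifold (𝓡 n) ∞ M]

/-- The image under h of a segment in a chart is the base of an `A`-path, whose `A`-component is the
coframe evaluated on the velocity. -/
theorem Realization.eventually_joinedByPath (R : Realization D M) (p : M) :
    ∀ᶠ q in 𝓝 p, D.JoinedByPath (R.h p) (R.h q) := by
  set φ := extChartAt (𝓡 n) p with hφ
  obtain ⟨ε, hε, hb⟩ := Metric.mem_nhds_iff.1 (extChartAt_target_mem_nhds (I := 𝓡 n) p)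
  filter_upwards [(continuousAt_extChartAt (I := 𝓡 n) p).eventually_mem (Metric.ball_mem_nhds _ hε),
    extChartAt_source_mem_nhds (I := 𝓡 n) p] with q hq hqs
  set v := φ q - φ p with hv
  have hmem : ∀ t ∈ Icc (0 : ℝ) 1, φ p + t • v ∈ φ.target := fun t ht =>
    hb ((convex_ball (φ p) ε).add_smul_sub_mem (Metric.mem_ball_self hε) hq ht)
  have hl : ∀ t : ℝ, HasDerivWithinAt (fun t : ℝ => φ p + t • v) v (Icc 0 1) t := fun t => by
    simpa using (((hasDerivAt_id t).smul_const v).const_add (φ p)).hasDerivWithinAt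
  refine ⟨fun t => R.h (φ.symm (φ p + t • v)), fun t => chartForm R.θ p (φ p + t • v) v,
    ?_, fun t ht => ?_, ?_, ?_⟩
  · have h1 : ContDiffOn ℝ ∞ (fun t : ℝ => φ p + t • v) (Icc 0 1) := by fun_prop
    exact ((contDiffOn_chartForm R.contMDiff_θ p).comp h1 hmem).clm_apply contDiffOn_const
  · have k1 : HasMFDerivWithinAt 𝓘(ℝ, ℝ) 𝓘(ℝ, EuclideanSpace ℝ (Fin n))
        (fun t : ℝ => φ p + t • v) (Icc 0 1) t (ContinuousLinearMap.toSpanSingleton ℝ v) :=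
      (hl t).hasFDerivWithinAt.hasMFDerivWithinAt
    have k2 := (mdifferentiableAt_extChartAt_symm (hmem t ht)).hasMFDerivAt
    have k3 := (R.contMDiff_h.mdifferentiableAt (by simp)
      (x := φ.symm (φ p + t • v))).hasMFDerivAt
    have k := HasMFDerivAt.comp_hasMFDerivWithinAt (g := R.h ∘ φ.symm)
      (f := fun t : ℝ => φ p + t • v) t (HasMFDerivAt.comp (φ p + t • v) k3 k2) k1
    refine k.congr_mfderiv ?_
    ext1
    have e : mfderiv (𝓡 n) (𝓡 d) R.h (φ.symm (φ p + t • v))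
        (mfderiv 𝓘(ℝ, EuclideanSpace ℝ (Fin n)) (𝓡 n) φ.symm (φ p + t • v) ((1 : ℝ) • v)) =
        (1 : ℝ) • D.anchor (R.h (φ.symm (φ p + t • v))) (chartForm R.θ p (φ p + t • v) v) := by
      rw [one_smul, one_smul]
      exact R.structure_h _ _
    exact e
  · simp only [zero_smul, add_zero]
    rw [φ.left_inv (mem_extChartAt_source p)]
  · simp only [one_smul, hv, add_sub_cancel]
    rw [φ.left_inv hqs]

theorem Realization.range_h_subset_orbit [ConnectedSpace M] (R : Realization D M) (p : M) :
    range R.h ⊆ D.orbit (R.h p) := by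
  rintro _ ⟨q, rfl⟩
  let P : M → M → Prop := fun a b => Relation.EqvGen D.JoinedByPath (R.h a) (R.h b)
  have : Std.Symm P := ⟨fun _ _ h => .symm _ _ h⟩
  exact PreconnectedSpace.induction₂ P
    (fun a => (R.eventually_joinedByPath a).mono fun b hb => .rel _ _ hb)
    ⟨fun _ _ _ h h' => .trans _ _ _ h h'⟩ p q

end Orbit

end CartanRealization

namespace CartanRealization

open Set

/-! ### Pulling back realizations along local homeomorphisms -/

section Pullback

variable {n : ℕ} {M : Type*} [TopologicalSpace M] [ChartedSpace (EuclideanSpace ℝ (Fin n)) M]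
  {N : Type*} [TopologicalSpace N] {π : N → M}

/-- The charts of `N` are those of `M` composed with local inverses of `π : N → M`. -/
structure IsPullbackAtlas [ChartedSpace (EuclideanSpace ℝ (Fin n)) N] (π : N → M) : Prop where
  atlas : ∀ c ∈ atlas (EuclideanSpace ℝ (Fin n)) N, ∃ e : OpenPartialHomeomorph N M, ⇑e = π ∧
    ∃ c' ∈ atlas (EuclideanSpace ℝ (Fin n)) M, c = e ≫ₕ c'
  chartAt : ∀ z, ∃ e : OpenPartialHomeomorph N M, ⇑e = π ∧ z ∈ e.source ∧
    chartAt (EuclideanSpace ℝ (Fin n)) z = e ≫ₕ chartAt (EuclideanSpace ℝ (Fin n)) (π z)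

theorem exists_isPullbackAtlas (hπ : IsLocalHomeomorph π) :
    ∃ _ : ChartedSpace (EuclideanSpace ℝ (Fin n)) N, IsPullbackAtlas (n := n) π := by
  choose e he heπ using hπ
  let cs : ChartedSpace (EuclideanSpace ℝ (Fin n)) N :=
    { atlas := range fun z => e z ≫ₕ _root_.chartAt (EuclideanSpace ℝ (Fin n)) (π z)
      chartAt := fun z => e z ≫ₕ _root_.chartAt (EuclideanSpace ℝ (Fin n)) (π z)
      mem_chart_source := fun z => ⟨he z, by
        change e z z ∈ (chartAt (EuclideanSpace ℝ (Fin n)) (π z)).source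
        rw [← heπ z]
        exact mem_chart_source _ _⟩
      chart_mem_atlas := fun z => mem_range_self z }
  refine ⟨cs, ⟨?_, fun z => ⟨e z, (heπ z).symm, he z, rfl⟩⟩⟩
  rintro _ ⟨z, rfl⟩
  exact ⟨e z, (heπ z).symm, _, chart_mem_atlas _ _, rfl⟩

variable [IsManifold (𝓡 n) ∞ M] [ChartedSpace (EuclideanSpace ℝ (Fin n)) N]

/-- In a transition map the local inverses of π cancel, leaving a restriction of a transition map of
M. -/
theorem IsPullbackAtlas.isManifold (h : IsPullbackAtlas (n := n) π) : IsManifold (𝓡 n) ∞ N := by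
  refine isManifold_of_contDiffOn (𝓡 n) ∞ N fun c₁ c₂ h₁ h₂ => ?_
  obtain ⟨e₁, he₁, c₁', hc₁, rfl⟩ := h.atlas c₁ h₁
  obtain ⟨e₂, he₂, c₂', hc₂, rfl⟩ := h.atlas c₂ h₂
  have hc : ContDiffOn ℝ ∞ (⇑(𝓡 n) ∘ (c₁'.symm ≫ₕ c₂') ∘ (𝓡 n).symm)
      ((𝓡 n).symm ⁻¹' (c₁'.symm ≫ₕ c₂').source ∩ range (𝓡 n)) :=
    (mem_groupoid_of_pregroupoid.1
      (HasGroupoid.compatible (G := contDiffGroupoid ∞ (𝓡 n)) hc₁ hc₂)).1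
  simp only [mfld_simps] at hc ⊢
  have key : ∀ y, y ∈ e₁.target → e₂ (e₁.symm y) = y := fun y hy => by
    rw [he₂, ← he₁, e₁.right_inv hy]
  refine (hc.congr_mono (fun y hy => ?_) fun y hy => ?_)
  · simp only [mem_inter_iff, mem_preimage] at hy
    simp only [Function.comp_apply]
    rw [key _ hy.1.2]
  · simp only [mem_inter_iff, mem_preimage] at hy ⊢
    have := hy.2.2
    rw [Function.comp_apply, key _ hy.1.2] at this
    exact ⟨hy.1.1, this⟩

omit [IsManifold (𝓡 n) ∞ M] in
theorem IsPullbackAtlas.extChartAt_apply (h : IsPullbackAtlas (n := n) π) (z w : N) :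
    extChartAt (𝓡 n) z w = extChartAt (𝓡 n) (π z) (π w) := by
  obtain ⟨e, he, -, hc⟩ := h.chartAt z
  simp only [mfld_simps, hc, he]

omit [IsManifold (𝓡 n) ∞ M] in
theorem IsPullbackAtlas.map_extChartAt_symm (h : IsPullbackAtlas (n := n) π) (z : N)
    {y : EuclideanSpace ℝ (Fin n)} (hy : y ∈ (extChartAt (𝓡 n) z).target) :
    y ∈ (extChartAt (𝓡 n) (π z)).target ∧
      π ((extChartAt (𝓡 n) z).symm y) = (extChartAt (𝓡 n) (π z)).symm y := by
  obtain ⟨e, he, -, hc⟩ := h.chartAt z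
  simp only [mfld_simps, hc] at hy ⊢
  exact ⟨hy.1, (congrFun he _).symm.trans (e.right_inv hy.2)⟩

variable [IsManifold (𝓡 n) ∞ N]

omit [IsManifold (𝓡 n) ∞ M] [IsManifold (𝓡 n) ∞ N] in
theorem IsPullbackAtlas.writtenInExtChartAt_eventuallyEq (h : IsPullbackAtlas (n := n) π) (z : N) :
    extChartAt (𝓡 n) (π z) ∘ π ∘ (extChartAt (𝓡 n) z).symm =ᶠ[𝓝 (extChartAt (𝓡 n) z z)] id := by
  filter_upwards [extChartAt_target_mem_nhds (I := 𝓡 n) z] with y hy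
  obtain ⟨h1, h2⟩ := h.map_extChartAt_symm z hy
  simp only [Function.comp_apply, h2, (extChartAt (𝓡 n) (π z)).right_inv h1, id]

omit [IsManifold (𝓡 n) ∞ M] [IsManifold (𝓡 n) ∞ N] in
theorem IsPullbackAtlas.continuous (h : IsPullbackAtlas (n := n) π) : Continuous π := by
  refine continuous_iff_continuousAt.2 fun z => ?_
  obtain ⟨e, he, hz, -⟩ := h.chartAt z
  rw [← he]
  exact e.continuousAt hz

omit [IsManifold (𝓡 n) ∞ M] [IsManifold (𝓡 n) ∞ N] in
theorem IsPullbackAtlas.contMDiff (h : IsPullbackAtlas (n := n) π) :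
    ContMDiff (𝓡 n) (𝓡 n) ∞ π := fun z => contMDiffAt_iff.2
  ⟨h.continuous.continuousAt,
    (contDiffAt_id.congr_of_eventuallyEq
      (h.writtenInExtChartAt_eventuallyEq z)).contDiffWithinAt⟩

omit [IsManifold (𝓡 n) ∞ M] [IsManifold (𝓡 n) ∞ N] in
theorem IsPullbackAtlas.isLocalDiffeomorph (h : IsPullbackAtlas (n := n) π) :
    IsLocalDiffeomorph (𝓡 n) (𝓡 n) ∞ π := by
  intro z
  obtain ⟨e, he, hz, -⟩ := h.chartAt z
  refine ⟨{ e.toPartialEquiv with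
      toFun := π
      map_source' := fun x hx => he ▸ e.map_source hx
      left_inv' := fun x hx => he ▸ e.left_inv hx
      right_inv' := fun y hy => he ▸ e.right_inv hy
      open_source := e.open_source
      open_target := e.open_target
      contMDiffOn_toFun := h.contMDiff.contMDiffOn
      contMDiffOn_invFun := fun y hy => ?_ }, hz, fun _ _ => rfl⟩
  refine ContMDiffAt.contMDiffWithinAt (contMDiffAt_iff.2 ⟨e.symm.continuousAt hy, ?_⟩)
  refine (contDiffAt_id.congr_of_eventuallyEq ?_).contDiffWithinAt
  have e1 : π (e.symm y) = y := by rw [← he]; exact e.right_inv hy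
  have c := continuousAt_extChartAt_symm (I := 𝓡 n) y
  filter_upwards [c.eventually_mem (e.open_target.mem_nhds (by rwa [extChartAt_to_inv])),
    extChartAt_target_mem_nhds (I := 𝓡 n) y] with x hx hxt
  have e2 : π (e.symm ((extChartAt (𝓡 n) y).symm x)) = (extChartAt (𝓡 n) y).symm x := by
    rw [← he]; exact e.right_inv hx
  change extChartAt (𝓡 n) (e.symm y) (e.symm ((extChartAt (𝓡 n) y).symm x)) = x
  rw [h.extChartAt_apply, e1, e2]
  exact (extChartAt (𝓡 n) y).right_inv hxt

omit [IsManifold (𝓡 n) ∞ M] in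
theorem IsPullbackAtlas.chartForm_pullback (h : IsPullbackAtlas (n := n) π) {k : ℕ}
    (θ : ∀ p : M, TangentSpace (𝓡 n) p →L[ℝ] (Fin k → ℝ)) (z : N) :
    chartForm (fun w => (θ (π w)).comp (mfderiv (𝓡 n) (𝓡 n) π w)) z
      =ᶠ[𝓝 (extChartAt (𝓡 n) z z)] chartForm θ (π z) := by
  filter_upwards [extChartAt_target_mem_nhds (I := 𝓡 n) z] with y hy
  ext1 v
  have h1 := (mdifferentiableAt_extChartAt_symm hy).hasMFDerivAt
  have h2 := (h.contMDiff.mdifferentiable (by simp) ((extChartAt (𝓡 n) z).symm y)).hasMFDerivAt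
  have h3 := (HasMFDerivAt.comp y h2 h1).mfderiv
  have e : π ∘ (extChartAt (𝓡 n) z).symm =ᶠ[𝓝 y] (extChartAt (𝓡 n) (π z)).symm := by
    filter_upwards [(isOpen_extChartAt_target z).mem_nhds hy] with x hx
    exact (h.map_extChartAt_symm z hx).2
  rw [e.mfderiv_eq] at h3
  have h4 := congrArg (fun T => θ (π ((extChartAt (𝓡 n) z).symm y)) (T v)) h3
  refine Eq.trans h4.symm ?_
  simp only [chartForm]
  rw [(h.map_extChartAt_symm z hy).2]
  rfl

variable {d : ℕ} {X : Type*} [TopologicalSpace X] [ChartedSpace (EuclideanSpace ℝ (Fin d)) X]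
  [IsManifold (𝓡 d) ∞ X] {D : CartanData n d X}

/-- The pullback of a realization. -/
noncomputable def IsPullbackAtlas.realization (h : IsPullbackAtlas (n := n) π)
    (R : Realization D M) : Realization D N where
  θ w := (R.θ (π w)).comp (mfderiv (𝓡 n) (𝓡 n) π w)
  h := R.h ∘ π
  contMDiff_θ := contMDiff_form_of_chartForm fun z => by
    refine ContDiffAt.congr_of_eventuallyEq ?_ (h.chartForm_pullback R.θ z)
    rw [h.extChartAt_apply]
    exact (contDiffOn_chartForm R.contMDiff_θ (π z)).contDiffAt (extChartAt_target_mem_nhds _)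
  contMDiff_h := R.contMDiff_h.comp h.contMDiff
  coframe z := by
    have := (h.isLocalDiffeomorph z).mfderivToContinuousLinearEquiv (by simp) |>.bijective
    exact (R.coframe (π z)).comp this
  structure_θ z v w k := by
    refine Eq.trans ?_ (R.structure_θ (π z) (mfderiv (𝓡 n) (𝓡 n) π z v)
      (mfderiv (𝓡 n) (𝓡 n) π z w) k)
    -- The chart of N at z is the chart of M at π z composed with π. With tangent spaces identified
    -- with the model space through these charts, the derivative of π at z is the identity.
    have hid : ∀ v : EuclideanSpace ℝ (Fin n),
        (mfderiv (𝓡 n) (𝓡 n) π z v : EuclideanSpace ℝ (Fin n)) = v := fun v => by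
      have e := (h.writtenInExtChartAt_eventuallyEq z).fderiv_eq (𝕜 := ℝ)
      rw [fderiv_id] at e
      rw [(h.contMDiff.mdifferentiable (by simp) z).mfderiv,
        ModelWithCorners.range_eq_univ, fderivWithin_univ]
      exact congrArg (fun T => T v) e
    simp only [extDerivOneForm]
    rw [(h.chartForm_pullback R.θ z).fderiv_eq, h.extChartAt_apply]
    have hv := hid v
    have hw := hid w
    rw [hv, hw]
  structure_h z v := by
    rw [mfderiv_comp z (R.contMDiff_h.mdifferentiable (by simp) _)
      (h.contMDiff.mdifferentiable (by simp) z)]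
    exact R.structure_h _ _

theorem IsPullbackAtlas.isCoverOnto (h : IsPullbackAtlas (n := n) π) (R : Realization D M)
    (hs : Function.Surjective π) : IsCoverOnto (h.realization R) R π ⊤ where
  localDiffeo := h.isLocalDiffeomorph
  range_eq := by rw [hs.range_eq]; rfl
  pullback_θ _ _ := rfl
  pullback_h _ := rfl

end Pullback

end CartanRealization

namespace CartanRealization

open Set Manifold

/-! ### Fibers of submersions -/

section Fiber

variable {E E' F : Type*} [NormedAddCommGroup E] [NormedSpace ℝ E] [NormedAddCommGroup E']
  [NormedSpace ℝ E'] [NormedAddCommGroup F] [NormedSpace ℝ F]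
  {G L : Type*} [TopologicalSpace G] [ChartedSpace E G] [TopologicalSpace L] [ChartedSpace E' L]
  {f : G → L}

namespace IsSubmersionAtOfComplement

variable {g : G} (h : IsSubmersionAtOfComplement F 𝓘(ℝ, E) 𝓘(ℝ, E') ∞ f g)

theorem codChart_apply {y : G} (hy : y ∈ h.domChart.source) :
    h.codChart (f y) = (h.equiv (h.domChart y)).1 := by
  have := h.writtenInCharts (show h.domChart y ∈ (h.domChart.extend 𝓘(ℝ, E)).target by
    simpa using h.domChart.map_source hy)
  simpa [h.domChart.left_inv hy] using this

theorem map_symm {x : L} (hx : x ∈ h.codChart.source) {w : F}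
    (hw : h.equiv.symm (h.codChart x, w) ∈ h.domChart.target) :
    f (h.domChart.symm (h.equiv.symm (h.codChart x, w))) = x := by
  have hs := h.domChart.map_target hw
  refine h.codChart.injOn (h.source_subset_preimage_source hs) hx ?_
  rw [codChart_apply h hs, h.domChart.right_inv hw, ContinuousLinearEquiv.apply_symm_apply]

open Classical in
/-- The chart of the fiber of a submersion given by the charts in which it is a projection. -/
noncomputable def fiberChart {x : L} (s : f ⁻¹' {x})
    (h : IsSubmersionAtOfComplement F 𝓘(ℝ, E) 𝓘(ℝ, E') ∞ f s.1) :
    OpenPartialHomeomorph (f ⁻¹' {x}) F where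
  toFun q := (h.equiv (h.domChart q.1)).2
  invFun w := if hw : f (h.domChart.symm (h.equiv.symm (h.codChart x, w))) = x then ⟨_, hw⟩ else s
  source := {q | q.1 ∈ h.domChart.source}
  target := {w | h.equiv.symm (h.codChart x, w) ∈ h.domChart.target}
  map_source' q hq := by
    have e : h.codChart x = (h.equiv (h.domChart q.1)).1 := by
      rw [← codChart_apply h hq]
      exact congrArg _ q.2.symm
    rw [mem_ofPred_eq, e, Prod.mk.eta, ContinuousLinearEquiv.symm_apply_apply]
    exact h.domChart.map_source hq
  map_target' w hw := by
    have hx : x ∈ h.codChart.source := by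
      have := h.mem_codChart_source
      rwa [show f s.1 = x from s.2] at this
    rw [dif_pos (map_symm h hx hw)]
    exact h.domChart.map_target hw
  left_inv' q hq := by
    have e : h.codChart x = (h.equiv (h.domChart q.1)).1 := by
      rw [← codChart_apply h hq]
      exact congrArg _ q.2.symm
    have e2 : h.domChart.symm (h.equiv.symm (h.codChart x, (h.equiv (h.domChart q.1)).2)) = q.1 := by
      rw [e, Prod.mk.eta, ContinuousLinearEquiv.symm_apply_apply, h.domChart.left_inv hq]
    rw [dif_pos (by rw [e2]; exact q.2)]
    exact Subtype.ext e2
  right_inv' w hw := by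
    have hx : x ∈ h.codChart.source := by
      have := h.mem_codChart_source
      rwa [show f s.1 = x from s.2] at this
    rw [dif_pos (map_symm h hx hw)]
    simp only
    rw [h.domChart.right_inv hw, ContinuousLinearEquiv.apply_symm_apply]
  open_source := h.domChart.open_source.preimage continuous_subtype_val
  open_target := h.domChart.open_target.preimage
    (h.equiv.symm.continuous.comp (Continuous.prodMk_right _))
  continuousOn_toFun := by
    refine (continuous_snd.comp h.equiv.continuous).comp_continuousOn ?_
    exact h.domChart.continuousOn.comp continuous_subtype_val.continuousOn fun q hq => hq
  continuousOn_invFun := by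
    have hx : x ∈ h.codChart.source := by
      have := h.mem_codChart_source
      rwa [show f s.1 = x from s.2] at this
    rw [Topology.IsInducing.subtypeVal.continuousOn_iff]
    have : ContinuousOn (fun w => h.domChart.symm (h.equiv.symm (h.codChart x, w)))
        {w | h.equiv.symm (h.codChart x, w) ∈ h.domChart.target} :=
      h.domChart.continuousOn_symm.comp
        (h.equiv.symm.continuous.comp (Continuous.prodMk_right _)).continuousOn fun w hw => hw
    refine this.congr fun w hw => ?_
    rw [Function.comp_apply, dif_pos (map_symm h hx hw)]

theorem fiberChart_symm_val {x : L} {s : f ⁻¹' {x}}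
    (h : IsSubmersionAtOfComplement F 𝓘(ℝ, E) 𝓘(ℝ, E') ∞ f s.1) {w : F}
    (hw : w ∈ (fiberChart s h).target) :
    ((fiberChart s h).symm w).1 = h.domChart.symm (h.equiv.symm (h.codChart x, w)) := by
  have hx : x ∈ h.codChart.source := by
    have := h.mem_codChart_source
    rwa [show f s.1 = x from s.2] at this
  have : (fiberChart s h).symm w = _ := dif_pos (map_symm h hx hw)
  rw [this]

end IsSubmersionAtOfComplement

open IsSubmersionAtOfComplement

/-- The fiber of a submersion as a manifold. -/
@[reducible]
noncomputable def fiberChartedSpace (hf : IsSubmersionOfComplement F 𝓘(ℝ, E) 𝓘(ℝ, E') ∞ f) (x : L) :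
    ChartedSpace F (f ⁻¹' {x}) where
  atlas := range fun s : f ⁻¹' {x} => fiberChart s (hf s.1)
  chartAt s := fiberChart s (hf s.1)
  mem_chart_source s := (hf s.1).mem_domChart_source
  chart_mem_atlas s := mem_range_self s

/-- A transition map of the fiber is the vertical component of an ambient transition map restricted
to an affine slice. -/
theorem isManifold_fiber (hf : IsSubmersionOfComplement F 𝓘(ℝ, E) 𝓘(ℝ, E') ∞ f) (x : L) :
    letI := fiberChartedSpace hf x
    IsManifold 𝓘(ℝ, F) ∞ (f ⁻¹' {x}) := by
  let _ := fiberChartedSpace hf x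
  refine isManifold_of_contDiffOn 𝓘(ℝ, F) ∞ (f ⁻¹' {x}) ?_
  rintro _ _ ⟨s, rfl⟩ ⟨s', rfl⟩
  set h := hf s.1
  set h' := hf s'.1
  have hc : ContDiffOn ℝ ∞ (⇑𝓘(ℝ, E) ∘ (h.domChart.symm ≫ₕ h'.domChart) ∘ 𝓘(ℝ, E).symm)
      (𝓘(ℝ, E).symm ⁻¹' (h.domChart.symm ≫ₕ h'.domChart).source ∩ range 𝓘(ℝ, E)) :=
    (mem_groupoid_of_pregroupoid.1 (IsManifold.compatible_of_mem_maximalAtlas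
      h.domChart_mem_maximalAtlas h'.domChart_mem_maximalAtlas)).1
  simp only [mfld_simps] at hc ⊢
  have h1 : ContDiff ℝ ∞ fun w : F => h.equiv.symm (h.codChart x, w) :=
    h.equiv.symm.contDiff.comp (contDiff_prodMk_right _)
  refine ((contDiff_snd.comp h'.equiv.contDiff).comp_contDiffOn
    (hc.comp h1.contDiffOn fun w hw => ?_)).congr fun w hw => ?_
  · have hv := fiberChart_symm_val h hw.1
    have h2 : ((fiberChart s h).symm w).1 ∈ h'.domChart.source := hw.2
    rw [hv] at h2
    exact ⟨hw.1, h2⟩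
  · have hv := fiberChart_symm_val h hw.1
    change (h'.equiv (h'.domChart ((fiberChart s h).symm w).1)).2 = _
    rw [hv]
    rfl

theorem isSmoothEmbedding_fiber [IsManifold 𝓘(ℝ, E) ∞ G]
    (hf : IsSubmersionOfComplement F 𝓘(ℝ, E) 𝓘(ℝ, E') ∞ f) (x : L) :
    letI := fiberChartedSpace hf x
    IsSmoothEmbedding 𝓘(ℝ, F) 𝓘(ℝ, E) ∞ (Subtype.val : f ⁻¹' {x} → G) := by
  let _ := fiberChartedSpace hf x
  have := isManifold_fiber hf x
  refine ⟨IsImmersionOfComplement.isImmersion (F := E') fun s => ?_, .subtypeVal⟩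
  set h := hf s.1 with hh
  let T : (F × E') ≃L[ℝ] E := (ContinuousLinearEquiv.prodComm ℝ F E').trans h.equiv.symm
  -- In the ambient chart the fiber is an affine slice, whereas the normal form of an immersion is w
  -- ↦ (w, 0). The translation τ moves the slice to pass through the origin.
  let τ : E ≃ₜ E := Homeomorph.addRight (-h.equiv.symm (h.codChart x, 0))
  have hτ : h.domChart.transHomeomorph τ ∈ IsManifold.maximalAtlas 𝓘(ℝ, E) ∞ G := by
    refine OpenPartialHomeomorph.mem_maximalAtlas_of_contMDiffOn (I := 𝓘(ℝ, E)) (n := ∞) _ ?_ ?_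
    · have : ContMDiff 𝓘(ℝ, E) 𝓘(ℝ, E) ∞ τ := (contDiff_id.add contDiff_const).contMDiff
      exact this.comp_contMDiffOn (contMDiffOn_of_mem_maximalAtlas h.domChart_mem_maximalAtlas)
    · have : ContMDiff 𝓘(ℝ, E) 𝓘(ℝ, E) ∞ τ.symm := (contDiff_id.add contDiff_const).contMDiff
      exact (contMDiffOn_symm_of_mem_maximalAtlas h.domChart_mem_maximalAtlas).comp
        this.contMDiffOn fun w hw => hw
  refine IsImmersionAtOfComplement.mk_of_charts T (fiberChart s h) (h.domChart.transHomeomorph τ)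
    h.mem_domChart_source h.mem_domChart_source
    (IsManifold.subset_maximalAtlas (mem_range_self s)) hτ (fun q hq => hq) fun w hw => ?_
  have hw' : w ∈ (fiberChart s h).target := by simpa using hw
  have e1 : h.equiv.symm (h.codChart x, w) ∈ h.domChart.target := hw'
  have e : τ (h.domChart (((fiberChart s h).symm w).1)) = h.equiv.symm (0, w) := by
    rw [fiberChart_symm_val h hw', h.domChart.right_inv e1]
    change (_ : E) + -_ = _
    rw [← sub_eq_add_neg, ← map_sub]
    simp
  simpa [T] using e

end Fiber

end CartanRealization

namespace CartanRealization

open Set Manifold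

/-! ### Differentials of immersions and submersions -/

section Differentials

variable {E E' : Type*} [NormedAddCommGroup E] [NormedSpace ℝ E] [NormedAddCommGroup E']
  [NormedSpace ℝ E'] {M N : Type*} [TopologicalSpace M] [ChartedSpace E M] [TopologicalSpace N]
  [ChartedSpace E' N] {f : M → N} {x : M}

theorem injective_mfderiv_of_leftInverse {g : N → M} (hf : MDifferentiableAt 𝓘(ℝ, E) 𝓘(ℝ, E') f x)
    (hg : MDifferentiableAt 𝓘(ℝ, E') 𝓘(ℝ, E) g (f x)) (h : g ∘ f =ᶠ[𝓝 x] id) :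
    Function.Injective (mfderiv 𝓘(ℝ, E) 𝓘(ℝ, E') f x) := by
  have e := (HasMFDerivAt.comp x hg.hasMFDerivAt hf.hasMFDerivAt).mfderiv
  rw [h.mfderiv_eq, mfderiv_id] at e
  intro v w hvw
  have ev := congrArg (fun T => T v) e
  have ew := congrArg (fun T => T w) e
  exact ev.trans ((congrArg (mfderiv 𝓘(ℝ, E') 𝓘(ℝ, E) g (f x)) hvw).trans ew.symm)

theorem surjective_mfderiv_of_rightInverse {σ : N → M} (hσ : σ (f x) = x)
    (hf : MDifferentiableAt 𝓘(ℝ, E) 𝓘(ℝ, E') f x)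
    (hs : MDifferentiableAt 𝓘(ℝ, E') 𝓘(ℝ, E) σ (f x)) (h : f ∘ σ =ᶠ[𝓝 (f x)] id) :
    Function.Surjective (mfderiv 𝓘(ℝ, E) 𝓘(ℝ, E') f x) := by
  have hf' : HasMFDerivAt 𝓘(ℝ, E) 𝓘(ℝ, E') f (σ (f x)) (mfderiv 𝓘(ℝ, E) 𝓘(ℝ, E') f x) := by
    rw [hσ]
    exact hf.hasMFDerivAt
  have e := (HasMFDerivAt.comp (f x) hf' hs.hasMFDerivAt).mfderiv
  rw [h.mfderiv_eq, mfderiv_id] at e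
  intro w
  exact ⟨_, (congrArg (fun T => T w) e).symm⟩

/-- The normal form w ↦ (w, 0) yields a smooth local left inverse, by projecting in the charts. -/
theorem injective_mfderiv_of_isImmersionAt (h : IsImmersionAt 𝓘(ℝ, E) 𝓘(ℝ, E') ∞ f x) :
    Function.Injective (mfderiv 𝓘(ℝ, E) 𝓘(ℝ, E') f x) := by
  have key : ∀ y ∈ h.domChart.source,
      (h.equiv.symm (h.codChart (f y))).1 = h.domChart y := fun y hy => by
    have := h.writtenInCharts (show h.domChart y ∈ (h.domChart.extend 𝓘(ℝ, E)).target by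
      simpa using h.domChart.map_source hy)
    have e : h.codChart (f y) = h.equiv (h.domChart y, 0) := by
      simpa [h.domChart.left_inv hy] using this
    rw [e, ContinuousLinearEquiv.symm_apply_apply]
  refine injective_mfderiv_of_leftInverse
    (g := fun z => h.domChart.symm (h.equiv.symm (h.codChart z)).1)
    (h.contMDiffAt.mdifferentiableAt (by simp)) ?_ ?_
  · have h1 : ContMDiffAt 𝓘(ℝ, E') 𝓘(ℝ, E') ∞ h.codChart (f x) :=
      contMDiffAt_of_mem_maximalAtlas h.codChart_mem_maximalAtlas h.mem_codChart_source
    have h2 : ContMDiffAt 𝓘(ℝ, E') 𝓘(ℝ, E) ∞ (fun w => (h.equiv.symm w).1) (h.codChart (f x)) :=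
      (contDiff_fst.comp h.equiv.symm.contDiff).contDiffAt.contMDiffAt
    have h3 : ContMDiffAt 𝓘(ℝ, E) 𝓘(ℝ, E) ∞ h.domChart.symm
        (h.equiv.symm (h.codChart (f x))).1 :=
      contMDiffAt_symm_of_mem_maximalAtlas h.domChart_mem_maximalAtlas
        (by rw [key x h.mem_domChart_source]; exact h.domChart.map_source h.mem_domChart_source)
    exact ((ContMDiffAt.comp (f x) h3 (ContMDiffAt.comp (f x) h2 h1))).mdifferentiableAt (by simp)
  · filter_upwards [h.domChart.open_source.mem_nhds h.mem_domChart_source] with y hy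
    simp only [Function.comp_apply, key y hy, h.domChart.left_inv hy, id]

/-- A submersion has local sections through every point. -/
theorem exists_section_of_isSubmersionAt {F : Type*} [NormedAddCommGroup F] [NormedSpace ℝ F]
    (h : IsSubmersionAtOfComplement F 𝓘(ℝ, E) 𝓘(ℝ, E') ∞ f x) :
    ∃ σ : N → M, σ (f x) = x ∧ ContMDiffAt 𝓘(ℝ, E') 𝓘(ℝ, E) ∞ σ (f x) ∧
      f ∘ σ =ᶠ[𝓝 (f x)] id := by
  set w := (h.equiv (h.domChart x)).2 with hw
  have e0 : h.equiv.symm (h.codChart (f x), w) = h.domChart x := by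
    rw [IsSubmersionAtOfComplement.codChart_apply h h.mem_domChart_source, hw, Prod.mk.eta,
      ContinuousLinearEquiv.symm_apply_apply]
  have h1 : ContMDiffAt 𝓘(ℝ, E') 𝓘(ℝ, E') ∞ h.codChart (f x) :=
    contMDiffAt_of_mem_maximalAtlas h.codChart_mem_maximalAtlas h.mem_codChart_source
  have h2 : ContMDiffAt 𝓘(ℝ, E') 𝓘(ℝ, E) ∞ (fun z => h.equiv.symm (z, w)) (h.codChart (f x)) :=
    (h.equiv.symm.contDiff.comp (contDiff_prodMk_left w)).contDiffAt.contMDiffAt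
  have h3 : ContMDiffAt 𝓘(ℝ, E) 𝓘(ℝ, E) ∞ h.domChart.symm (h.equiv.symm (h.codChart (f x), w)) :=
    contMDiffAt_symm_of_mem_maximalAtlas h.domChart_mem_maximalAtlas
      (by rw [e0]; exact h.domChart.map_source h.mem_domChart_source)
  have h12 := ContMDiffAt.comp (f x) h2 h1
  refine ⟨fun y => h.domChart.symm (h.equiv.symm (h.codChart y, w)), ?_,
    ContMDiffAt.comp (f x) h3 h12, ?_⟩
  · simp only [e0, h.domChart.left_inv h.mem_domChart_source]
  · filter_upwards [h12.continuousAt.eventually_mem (h.domChart.open_target.mem_nhds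
      (by simp only [Function.comp_apply, e0]
          exact h.domChart.map_source h.mem_domChart_source)),
      h.codChart.open_source.mem_nhds h.mem_codChart_source] with y hy hys
    exact IsSubmersionAtOfComplement.map_symm h hys hy

theorem surjective_mfderiv_of_isSubmersionAt {F : Type*} [NormedAddCommGroup F] [NormedSpace ℝ F]
    (h : IsSubmersionAtOfComplement F 𝓘(ℝ, E) 𝓘(ℝ, E') ∞ f x) :
    Function.Surjective (mfderiv 𝓘(ℝ, E) 𝓘(ℝ, E') f x) := by
  obtain ⟨σ, hσ, hs, h'⟩ := exists_section_of_isSubmersionAt h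
  exact surjective_mfderiv_of_rightInverse hσ (h.contMDiffAt.mdifferentiableAt (by simp))
    (hs.mdifferentiableAt (by simp)) h'

end Differentials

/-! ### Tangent spaces of fibers and smooth maps into fibers. -/

section FiberDifferentials

variable {m r n : ℕ} {G L : Type*} [TopologicalSpace G] [ChartedSpace (EuclideanSpace ℝ (Fin m)) G]
  [TopologicalSpace L] [ChartedSpace (EuclideanSpace ℝ (Fin r)) L]
  {f : G → L}

/-- The complement in the definition of a submersion, made explicit. -/
theorem isSubmersionOfComplement_euclideanSpace (hf : IsSubmersion (𝓡 m) (𝓡 r) ∞ f)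
    (hm : m = r + n) :
    IsSubmersionOfComplement (EuclideanSpace ℝ (Fin n)) (𝓡 m) (𝓡 r) ∞ f := by
  obtain ⟨F, _, _, hF⟩ := hf
  intro g
  have T := (hF g).equiv
  have : FiniteDimensional ℝ F := by
    refine Module.Finite.of_surjective (M := EuclideanSpace ℝ (Fin m))
      ((LinearMap.snd ℝ (EuclideanSpace ℝ (Fin r)) F).comp T.toLinearMap) ?_
    exact Prod.snd_surjective.comp T.surjective
  have e := T.toLinearEquiv.finrank_eq
  rw [Module.finrank_prod, finrank_euclideanSpace_fin, finrank_euclideanSpace_fin] at e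
  refine (hF g).trans_F (ContinuousLinearEquiv.ofFinrankEq ?_)
  rw [finrank_euclideanSpace_fin]
  omega

variable {x : L} [ChartedSpace (EuclideanSpace ℝ (Fin n)) (f ⁻¹' {x})]

theorem mfderiv_mfderiv_subtypeVal
    (hι : IsSmoothEmbedding (𝓡 n) (𝓡 m) ∞ (Subtype.val : f ⁻¹' {x} → G))
    (hf : MDifferentiable (𝓡 m) (𝓡 r) f) (s : f ⁻¹' {x}) (v : TangentSpace (𝓡 n) s) :
    mfderiv (𝓡 m) (𝓡 r) f s.1 (mfderiv (𝓡 n) (𝓡 m) (Subtype.val : f ⁻¹' {x} → G) s v) = 0 := by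
  have e := (HasMFDerivAt.comp (g := f) (f := (Subtype.val : f ⁻¹' {x} → G)) s (hf s.1).hasMFDerivAt
    ((hι.isImmersion.isImmersionAt s).contMDiffAt.mdifferentiableAt (by simp)).hasMFDerivAt).mfderiv
  have hc : f ∘ (Subtype.val : f ⁻¹' {x} → G) = fun _ => x := funext fun s => s.2
  rw [hc, mfderiv_const] at e
  exact (congrArg (fun T => T v) e).symm

/-- The tangent space of the fiber is contained in the kernel of the differential of f, and both
have dimension n. -/
theorem exists_mfderiv_subtypeVal_eq
    (hι : IsSmoothEmbedding (𝓡 n) (𝓡 m) ∞ (Subtype.val : f ⁻¹' {x} → G)) (hm : m = r + n)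
    (hf : MDifferentiable (𝓡 m) (𝓡 r) f) (s : f ⁻¹' {x})
    (hs : Function.Surjective (mfderiv (𝓡 m) (𝓡 r) f s.1)) (ξ : TangentSpace (𝓡 m) s.1)
    (hξ : mfderiv (𝓡 m) (𝓡 r) f s.1 ξ = 0) :
    ∃ v, mfderiv (𝓡 n) (𝓡 m) (Subtype.val : f ⁻¹' {x} → G) s v = ξ := by
  let A : EuclideanSpace ℝ (Fin n) →ₗ[ℝ] EuclideanSpace ℝ (Fin m) :=
    (mfderiv (𝓡 n) (𝓡 m) (Subtype.val : f ⁻¹' {x} → G) s).toLinearMap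
  let B : EuclideanSpace ℝ (Fin m) →ₗ[ℝ] EuclideanSpace ℝ (Fin r) :=
    (mfderiv (𝓡 m) (𝓡 r) f s.1).toLinearMap
  have hA : Function.Injective A :=
    injective_mfderiv_of_isImmersionAt (hι.isImmersion.isImmersionAt s)
  have hB : Function.Surjective B := hs
  have hle : A.range ≤ B.ker := by
    rintro _ ⟨v, rfl⟩
    exact mfderiv_mfderiv_subtypeVal hι hf s v
  have h1 := LinearMap.finrank_range_of_inj hA
  have h2 := B.finrank_range_add_finrank_ker
  rw [LinearMap.range_eq_top.2 hB, finrank_top, finrank_euclideanSpace_fin,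
    finrank_euclideanSpace_fin] at h2
  rw [finrank_euclideanSpace_fin] at h1
  have := Submodule.eq_of_le_of_finrank_eq hle (by omega)
  have hmem : (ξ : EuclideanSpace ℝ (Fin m)) ∈ A.range := by rw [this]; exact hξ
  exact hmem

variable {E : Type*} [NormedAddCommGroup E] [NormedSpace ℝ E] {H : Type*} [TopologicalSpace H]
  {I : ModelWithCorners ℝ E H} {P : Type*} [TopologicalSpace P] [ChartedSpace H P]

omit [TopologicalSpace L] in
/-- Smoothness of maps into a fiber. -/
theorem contMDiffAt_fiber_iff
    (hι : IsSmoothEmbedding (𝓡 n) (𝓡 m) ∞ (Subtype.val : f ⁻¹' {x} → G)) {φ : P → f ⁻¹' {x}}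
    {p : P} : ContMDiffAt I (𝓡 n) ∞ φ p ↔ ContMDiffAt I (𝓡 m) ∞ (fun q => (φ q).1) p := by
  have := ContMDiffAt.iff_comp_isImmersionAt (I := I) (f := φ) (x := p)
    (hι.isImmersion.isImmersionAt (φ p))
  rw [this]
  refine ⟨fun h => h.2, fun h => ⟨?_, h⟩⟩
  exact Topology.IsInducing.subtypeVal.continuousAt_iff.2 h.continuousAt

end FiberDifferentials

end CartanRealization

namespace CartanRealization

open Set Manifold

/-! ### The Lie bracket of vector fields in a chart. -/

section Bracket

variable {n : ℕ} {M : Type*} [TopologicalSpace M] [ChartedSpace (EuclideanSpace ℝ (Fin n)) M]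
  [IsManifold (𝓡 n) ∞ M]

/-- A vector field in the chart at `p`. -/
noncomputable def chartField (V : ∀ q : M, TangentSpace (𝓡 n) q) (p : M)
    (y : EuclideanSpace ℝ (Fin n)) : EuclideanSpace ℝ (Fin n) :=
  mfderiv (𝓡 n) 𝓘(ℝ, EuclideanSpace ℝ (Fin n)) (extChartAt (𝓡 n) p)
    ((extChartAt (𝓡 n) p).symm y) (V ((extChartAt (𝓡 n) p).symm y))

theorem chartField_self (V : ∀ q : M, TangentSpace (𝓡 n) q) (p : M) :
    chartField V p (extChartAt (𝓡 n) p p) = V p := by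
  have e : (extChartAt (𝓡 n) p).symm (extChartAt (𝓡 n) p p) = p := extChartAt_to_inv p
  rw [chartField, e, mfderiv_extChartAt_self]
  rfl

/-- At the center of the chart the change back to the tangent space is the identity, so the bracket
is the usual coordinate expression without further correction. -/
theorem mlieBracket_eq_chartField (V W : ∀ q : M, TangentSpace (𝓡 n) q) (p : M) :
    (VectorField.mlieBracket (𝓡 n) V W p : EuclideanSpace ℝ (Fin n)) =
      fderiv ℝ (chartField W p) (extChartAt (𝓡 n) p p) (V p)
        - fderiv ℝ (chartField V p) (extChartAt (𝓡 n) p p) (W p) := by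
  have key : ∀ V : ∀ q : M, TangentSpace (𝓡 n) q,
      VectorField.mpullbackWithin 𝓘(ℝ, EuclideanSpace ℝ (Fin n)) (𝓡 n) (extChartAt (𝓡 n) p).symm V
        (range (𝓡 n)) =ᶠ[𝓝 (extChartAt (𝓡 n) p p)] chartField V p := by
    intro V
    filter_upwards [extChartAt_target_mem_nhds (I := 𝓡 n) p] with y hy
    rw [VectorField.mpullbackWithin_apply, ModelWithCorners.range_eq_univ, mfderivWithin_univ]
    let e : EuclideanSpace ℝ (Fin n) ≃L[ℝ] EuclideanSpace ℝ (Fin n) :=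
      ContinuousLinearEquiv.equivOfInverse
        (mfderiv 𝓘(ℝ, EuclideanSpace ℝ (Fin n)) (𝓡 n) (extChartAt (𝓡 n) p).symm y)
        (mfderiv (𝓡 n) 𝓘(ℝ, EuclideanSpace ℝ (Fin n)) (extChartAt (𝓡 n) p)
          ((extChartAt (𝓡 n) p).symm y))
        (fun w => mfderiv_extChartAt_mfderiv_symm hy w)
        (fun w => mfderiv_symm_mfderiv_extChartAt' hy w)
    exact congrArg (fun T => T (V ((extChartAt (𝓡 n) p).symm y)))
      (ContinuousLinearMap.inverse_equiv e)
  rw [← VectorField.mlieBracketWithin_univ, VectorField.mlieBracketWithin_apply,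
    mfderiv_extChartAt_self]
  have hinv : ∀ u : EuclideanSpace ℝ (Fin n),
      (ContinuousLinearMap.id ℝ (EuclideanSpace ℝ (Fin n))).inverse u = u := fun u => by
    rw [ContinuousLinearMap.inverse_id]
    rfl
  refine (hinv _).trans ?_
  have hu : (extChartAt (𝓡 n) p).symm ⁻¹' univ ∩ range (𝓡 n) = univ := by
    rw [preimage_univ, univ_inter, ModelWithCorners.range_eq_univ]
  rw [hu]
  refine (congrFun VectorField.lieBracketWithin_univ _).trans ?_
  refine ((key V).lieBracket_vectorField_eq (key W)).trans ?_
  rw [VectorField.lieBracket_eq]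
  simp only [chartField_self]

end Bracket

/-! ### Right translations in Lie groupoids -/

namespace LieGroupoid

variable {r m : ℕ} {L G : Type*} [TopologicalSpace L]
  [ChartedSpace (EuclideanSpace ℝ (Fin r)) L] [TopologicalSpace G]
  [ChartedSpace (EuclideanSpace ℝ (Fin m)) G] (𝒢 : LieGroupoid r m L G)

theorem mdifferentiable_src : MDifferentiable (𝓡 m) (𝓡 r) 𝒢.src := fun g =>
  (𝒢.submersion_src.isSubmersionAt g).contMDiffAt.mdifferentiableAt (by simp)

theorem mdifferentiable_tgt : MDifferentiable (𝓡 m) (𝓡 r) 𝒢.tgt := fun g =>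
  (𝒢.submersion_tgt.isSubmersionAt g).contMDiffAt.mdifferentiableAt (by simp)

theorem mdifferentiableWithinAt_mul_right {k g : G} (h : 𝒢.src g = 𝒢.tgt k) :
    MDifferentiableWithinAt (𝓡 m) (𝓡 m) (fun g' => 𝒢.mul g' k) (𝒢.src ⁻¹' {𝒢.tgt k}) g := by
  have h1 : ContMDiffWithinAt (𝓡 m) ((𝓡 m).prod (𝓡 m)) ∞ (fun g' : G => (g', k))
      (𝒢.src ⁻¹' {𝒢.tgt k}) g :=
    (ContMDiffAt.prodMk contMDiffAt_id contMDiffAt_const).contMDiffWithinAt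
  have h2 := (𝒢.contMDiffOn_mul (g, k) h).comp g h1 fun g' hg' => hg'
  exact h2.mdifferentiableWithinAt (by simp)

variable {n : ℕ} [∀ y, ChartedSpace (EuclideanSpace ℝ (Fin n)) (𝒢.src ⁻¹' {y})]
  (hι : ∀ y, IsSmoothEmbedding (𝓡 n) (𝓡 m) ∞ (Subtype.val : 𝒢.src ⁻¹' {y} → G))

include hι in
theorem mdifferentiable_val (y : L) :
    MDifferentiable (𝓡 n) (𝓡 m) (Subtype.val : 𝒢.src ⁻¹' {y} → G) := fun s =>
  ((hι y).isImmersion.isImmersionAt s).contMDiffAt.mdifferentiableAt (by simp)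

include hι in
theorem contMDiff_mul_right {k : G} {y : L} (hk : 𝒢.tgt k = y) :
    ContMDiff (𝓡 n) (𝓡 m) ∞ (fun s : 𝒢.src ⁻¹' {y} => 𝒢.mul s.1 k) := fun s => by
  have h1 : ContMDiffAt (𝓡 n) ((𝓡 m).prod (𝓡 m)) ∞ (fun s : 𝒢.src ⁻¹' {y} => (s.1, k)) s :=
    ContMDiffAt.prodMk ((hι y).isImmersion.isImmersionAt s).contMDiffAt contMDiffAt_const
  exact ((𝒢.contMDiffOn_mul (s.1, k) (s.2.trans hk.symm)).comp s
    (h1.contMDiffWithinAt (s := univ)) fun s' _ => s'.2.trans hk.symm).contMDiffAt Filter.univ_mem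

include hι in
-- `dRight` is a derivative within a subset of G. On vectors that come from the fiber as a manifold,
-- the chain rule replaces it by an ordinary derivative on the fiber; all later identities are
-- proved for such vectors.
theorem dRight_mfderiv_val {k : G} {y : L} (hk : 𝒢.tgt k = y) (s : 𝒢.src ⁻¹' {y})
    (v : TangentSpace (𝓡 n) s) :
    𝒢.dRight k s.1 (mfderiv (𝓡 n) (𝓡 m) (Subtype.val : 𝒢.src ⁻¹' {y} → G) s v) =
      mfderiv (𝓡 n) (𝓡 m) (fun s' : 𝒢.src ⁻¹' {y} => 𝒢.mul s'.1 k) s v := by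
  subst hk
  have h1 := (𝒢.mdifferentiableWithinAt_mul_right s.2).hasMFDerivWithinAt
  have h2 := ((𝒢.mdifferentiable_val hι (𝒢.tgt k) s).hasMFDerivAt).hasMFDerivWithinAt (s := univ)
  have h3 := (h1.comp s h2 fun s' _ => s'.2)
  rw [hasMFDerivWithinAt_univ] at h3
  exact (congrArg (fun T => T v) h3.mfderiv).symm

end LieGroupoid

end CartanRealization

namespace CartanRealization

open Set Manifold

namespace LieGroupoid

variable {r m : ℕ} {L G : Type*} [TopologicalSpace L]
  [ChartedSpace (EuclideanSpace ℝ (Fin r)) L] [TopologicalSpace G]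
  [ChartedSpace (EuclideanSpace ℝ (Fin m)) G] (𝒢 : LieGroupoid r m L G)
  {n : ℕ} [∀ y, ChartedSpace (EuclideanSpace ℝ (Fin n)) (𝒢.src ⁻¹' {y})]
  (hι : ∀ y, IsSmoothEmbedding (𝓡 n) (𝓡 m) ∞ (Subtype.val : 𝒢.src ⁻¹' {y} → G))

/-- Right translation between source fibers. -/
def rightMul (k : G) {y : L} (hk : 𝒢.tgt k = y) (s : 𝒢.src ⁻¹' {y}) : 𝒢.src ⁻¹' {𝒢.src k} :=
  ⟨𝒢.mul s.1 k, 𝒢.src_mul _ _ (Eq.trans s.2 hk.symm)⟩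

/-- The unit at `y` as a point of the source fiber. -/
def unit (y : L) : 𝒢.src ⁻¹' {y} := ⟨𝒢.one y, 𝒢.src_one y⟩

include hι in
theorem contMDiff_rightMul (k : G) {y : L} (hk : 𝒢.tgt k = y) :
    ContMDiff (𝓡 n) (𝓡 n) ∞ (𝒢.rightMul k hk) := fun s =>
  (contMDiffAt_fiber_iff (hι (𝒢.src k))).2 (𝒢.contMDiff_mul_right hι hk s)

include hι in
theorem mfderiv_val_mfderiv_rightMul (k : G) {y : L} (hk : 𝒢.tgt k = y) (s : 𝒢.src ⁻¹' {y})
    (v : TangentSpace (𝓡 n) s) :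
    (mfderiv (𝓡 n) (𝓡 m) (Subtype.val : 𝒢.src ⁻¹' {𝒢.src k} → G) (𝒢.rightMul k hk s)
      (mfderiv (𝓡 n) (𝓡 n) (𝒢.rightMul k hk) s v) : EuclideanSpace ℝ (Fin m)) =
      𝒢.dRight k s.1 (mfderiv (𝓡 n) (𝓡 m) (Subtype.val : 𝒢.src ⁻¹' {y} → G) s v) := by
  rw [𝒢.dRight_mfderiv_val hι hk s v]
  have e := (HasMFDerivAt.comp (g := (Subtype.val : 𝒢.src ⁻¹' {𝒢.src k} → G)) s
    (𝒢.mdifferentiable_val hι (𝒢.src k) (𝒢.rightMul k hk s)).hasMFDerivAt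
    ((𝒢.contMDiff_rightMul hι k hk s).mdifferentiableAt (by simp)).hasMFDerivAt).mfderiv
  exact (congrArg (fun T => T v) e).symm

include hι in
-- R_l ∘ R_k = R_{kl} differentiated on the source fiber. The base points (g k) l and g (k l)
-- coincide only by associativity, so the equality is stated in the model space.
theorem dRight_dRight {k l : G} {y : L} (hk : 𝒢.tgt k = y) (hl : 𝒢.tgt l = 𝒢.src k)
    (s : 𝒢.src ⁻¹' {y}) (v : TangentSpace (𝓡 n) s) :
    (𝒢.dRight l (𝒢.mul s.1 k) (𝒢.dRight k s.1
      (mfderiv (𝓡 n) (𝓡 m) (Subtype.val : 𝒢.src ⁻¹' {y} → G) s v)) : EuclideanSpace ℝ (Fin m)) =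
      𝒢.dRight (𝒢.mul k l) s.1 (mfderiv (𝓡 n) (𝓡 m) (Subtype.val : 𝒢.src ⁻¹' {y} → G) s v) := by
  have h1 := 𝒢.mfderiv_val_mfderiv_rightMul hι k hk s v
  have h2 := 𝒢.dRight_mfderiv_val hι hl (𝒢.rightMul k hk s)
    (mfderiv (𝓡 n) (𝓡 n) (𝒢.rightMul k hk) s v)
  have h3 := 𝒢.dRight_mfderiv_val hι (k := 𝒢.mul k l) (y := y)
    ((𝒢.tgt_mul k l hl.symm).trans hk) s v
  have h4 := (HasMFDerivAt.comp (g := fun s' : 𝒢.src ⁻¹' {𝒢.src k} => 𝒢.mul s'.1 l) s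
    ((𝒢.contMDiff_mul_right hι hl (𝒢.rightMul k hk s)).mdifferentiableAt (by simp)).hasMFDerivAt
    ((𝒢.contMDiff_rightMul hι k hk s).mdifferentiableAt (by simp)).hasMFDerivAt).mfderiv
  have h5 : (fun s' : 𝒢.src ⁻¹' {𝒢.src k} => 𝒢.mul s'.1 l) ∘ 𝒢.rightMul k hk =
      fun s' : 𝒢.src ⁻¹' {y} => 𝒢.mul s'.1 (𝒢.mul k l) := funext fun s' =>
    𝒢.mul_assoc _ _ _ (Eq.trans s'.2 hk.symm) hl.symm
  rw [h5] at h4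
  have h6 := congrArg (fun T => T v) h4
  refine Eq.trans ?_ (h2.trans (h6.symm.trans h3.symm))
  exact (congrArg (fun ξ : EuclideanSpace ℝ (Fin m) =>
    (𝒢.dRight l (𝒢.mul s.1 k) ξ : EuclideanSpace ℝ (Fin m))) h1).symm

include hι in
theorem dRight_one {y : L} (s : 𝒢.src ⁻¹' {y}) (v : TangentSpace (𝓡 n) s) :
    (𝒢.dRight (𝒢.one y) s.1 (mfderiv (𝓡 n) (𝓡 m) (Subtype.val : 𝒢.src ⁻¹' {y} → G) s v) :
      EuclideanSpace ℝ (Fin m)) =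
      mfderiv (𝓡 n) (𝓡 m) (Subtype.val : 𝒢.src ⁻¹' {y} → G) s v := by
  refine (𝒢.dRight_mfderiv_val hι (𝒢.tgt_one y) s v).trans ?_
  have : (fun s' : 𝒢.src ⁻¹' {y} => 𝒢.mul s'.1 (𝒢.one y)) = Subtype.val := funext fun s' => by
    have h : 𝒢.src s'.1 = y := s'.2
    exact (congrArg (fun z => 𝒢.mul s'.1 (𝒢.one z)) h).symm.trans (𝒢.mul_one _)
  rw [this]
  rfl

include hι in
theorem mfderiv_tgt_dRight {k : G} {y : L} (hk : 𝒢.tgt k = y) (s : 𝒢.src ⁻¹' {y})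
    (v : TangentSpace (𝓡 n) s) :
    (mfderiv (𝓡 m) (𝓡 r) 𝒢.tgt (𝒢.mul s.1 k) (𝒢.dRight k s.1
      (mfderiv (𝓡 n) (𝓡 m) (Subtype.val : 𝒢.src ⁻¹' {y} → G) s v)) : EuclideanSpace ℝ (Fin r)) =
      mfderiv (𝓡 m) (𝓡 r) 𝒢.tgt s.1
        (mfderiv (𝓡 n) (𝓡 m) (Subtype.val : 𝒢.src ⁻¹' {y} → G) s v) := by
  rw [𝒢.dRight_mfderiv_val hι hk s v]
  have h1 := (HasMFDerivAt.comp (g := 𝒢.tgt) s (𝒢.mdifferentiable_tgt (𝒢.mul s.1 k)).hasMFDerivAt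
    ((𝒢.contMDiff_mul_right hι hk s).mdifferentiableAt (by simp)).hasMFDerivAt).mfderiv
  have h2 := (HasMFDerivAt.comp (g := 𝒢.tgt) s (𝒢.mdifferentiable_tgt s.1).hasMFDerivAt
    (𝒢.mdifferentiable_val hι y s).hasMFDerivAt).mfderiv
  have h3 : (𝒢.tgt ∘ fun s' : 𝒢.src ⁻¹' {y} => 𝒢.mul s'.1 k) = 𝒢.tgt ∘ Subtype.val :=
    funext fun s' => 𝒢.tgt_mul _ _ (Eq.trans s'.2 hk.symm)
  rw [h3] at h1
  exact (congrArg (fun T => T v) h1).symm.trans (congrArg (fun T => T v) h2)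

end LieGroupoid

/-! ### The right-invariant frame -/

namespace Integration

variable {n r : ℕ} {L : Type u} [TopologicalSpace L] [ChartedSpace (EuclideanSpace ℝ (Fin r)) L]
  [IsManifold (𝓡 r) ∞ L] {A : CartanData n r L} (𝒢 : Integration A)

/-- The right-invariant vector fields with values `iso x a` at the units. -/
noncomputable def frame (g : 𝒢.arrows) : (Fin n → ℝ) →L[ℝ] EuclideanSpace ℝ (Fin 𝒢.dim) :=
  (𝒢.groupoid.dRight g (𝒢.groupoid.one (𝒢.groupoid.tgt g))).comp (𝒢.iso (𝒢.groupoid.tgt g))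

/-- Rank and nullity of the differential of the source map at the unit of x, whose kernel is the
image of ℝⁿ under `iso`. The point x also witnesses that L is non-empty. -/
theorem dim_eq (x : L) : 𝒢.dim = r + n := by
  obtain ⟨F, _, _, hF⟩ := 𝒢.groupoid.submersion_src
  let B : EuclideanSpace ℝ (Fin 𝒢.dim) →ₗ[ℝ] EuclideanSpace ℝ (Fin r) :=
    (mfderiv (𝓡 𝒢.dim) (𝓡 r) 𝒢.groupoid.src (𝒢.groupoid.one x)).toLinearMap
  let e : (Fin n → ℝ) →ₗ[ℝ] EuclideanSpace ℝ (Fin 𝒢.dim) := (𝒢.iso x).toLinearMap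
  have hB : Function.Surjective B := surjective_mfderiv_of_isSubmersionAt (hF _)
  have he : Function.Injective e := 𝒢.injective_iso x
  have hr : e.range = B.ker := by
    ext ξ
    exact 𝒢.range_iso x ξ
  have h1 := LinearMap.finrank_range_of_inj he
  have h2 := B.finrank_range_add_finrank_ker
  rw [LinearMap.range_eq_top.2 hB, finrank_top, finrank_euclideanSpace_fin,
    finrank_euclideanSpace_fin, ← hr, h1, Module.finrank_fin_fun] at h2
  exact h2.symm

variable [∀ y, ChartedSpace (EuclideanSpace ℝ (Fin n)) (𝒢.groupoid.src ⁻¹' {y})]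
  (hι : ∀ y, IsSmoothEmbedding (𝓡 n) (𝓡 𝒢.dim) ∞
    (Subtype.val : 𝒢.groupoid.src ⁻¹' {y} → 𝒢.arrows))

include hι in
theorem exists_mfderiv_val_eq {y : L} (s : 𝒢.groupoid.src ⁻¹' {y})
    (ξ : TangentSpace (𝓡 𝒢.dim) s.1) (hξ : mfderiv (𝓡 𝒢.dim) (𝓡 r) 𝒢.groupoid.src s.1 ξ = 0) :
    ∃ v, mfderiv (𝓡 n) (𝓡 𝒢.dim) (Subtype.val : 𝒢.groupoid.src ⁻¹' {y} → 𝒢.arrows) s v = ξ := by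
  obtain ⟨F, _, _, hF⟩ := 𝒢.groupoid.submersion_src
  exact exists_mfderiv_subtypeVal_eq (hι y) (𝒢.dim_eq y) 𝒢.groupoid.mdifferentiable_src s
    (surjective_mfderiv_of_isSubmersionAt (hF _)) ξ hξ

include hι in
theorem exists_mfderiv_val_eq_iso (y : L) (a : Fin n → ℝ) :
    ∃ v, mfderiv (𝓡 n) (𝓡 𝒢.dim) (Subtype.val : 𝒢.groupoid.src ⁻¹' {y} → 𝒢.arrows)
      (𝒢.groupoid.unit y) v = 𝒢.iso y a :=
  𝒢.exists_mfderiv_val_eq hι (𝒢.groupoid.unit y) _ ((𝒢.range_iso y _).1 ⟨a, rfl⟩)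

include hι in
-- Right invariance of the frame. Taking k = g⁻¹ shows that the Maurer-Cartan form sends the frame
-- at g to `iso`, that is, inverts it.
theorem dRight_frame {g k : 𝒢.arrows} (h : 𝒢.groupoid.src g = 𝒢.groupoid.tgt k) (a : Fin n → ℝ) :
    (𝒢.groupoid.dRight k g (𝒢.frame g a) : EuclideanSpace ℝ (Fin 𝒢.dim)) =
      𝒢.frame (𝒢.groupoid.mul g k) a := by
  obtain ⟨v, hv⟩ := 𝒢.exists_mfderiv_val_eq_iso hι (𝒢.groupoid.tgt g) a
  have h1 := 𝒢.groupoid.dRight_dRight hι (k := g) (l := k) rfl h.symm _ v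
  rw [hv] at h1
  have h2 : (𝒢.groupoid.dRight k (𝒢.groupoid.mul (𝒢.groupoid.one (𝒢.groupoid.tgt g)) g)
      (𝒢.frame g a) : EuclideanSpace ℝ (Fin 𝒢.dim)) = 𝒢.groupoid.dRight k g (𝒢.frame g a) := by
    rw [𝒢.groupoid.one_mul]
  have h3 : (𝒢.groupoid.dRight (𝒢.groupoid.mul g k) (𝒢.groupoid.one (𝒢.groupoid.tgt g))
      (𝒢.iso (𝒢.groupoid.tgt g) a) : EuclideanSpace ℝ (Fin 𝒢.dim)) =
      𝒢.frame (𝒢.groupoid.mul g k) a := by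
    simp only [frame]
    rw [𝒢.groupoid.tgt_mul g k h]
    rfl
  exact h2.symm.trans (h1.trans h3)

include hι in
theorem frame_one (y : L) (a : Fin n → ℝ) : 𝒢.frame (𝒢.groupoid.one y) a = 𝒢.iso y a := by
  obtain ⟨v, hv⟩ := 𝒢.exists_mfderiv_val_eq_iso hι y a
  have h1 := 𝒢.groupoid.dRight_one hι _ v
  rw [hv] at h1
  refine Eq.trans ?_ h1
  simp only [frame]
  rw [𝒢.groupoid.tgt_one]
  rfl

include hι in
theorem maurerCartan_frame (g : 𝒢.arrows) (a : Fin n → ℝ) :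
    𝒢.groupoid.maurerCartan g (𝒢.frame g a) = 𝒢.iso (𝒢.groupoid.tgt g) a := by
  have h1 := 𝒢.dRight_frame hι (k := 𝒢.groupoid.inv g) (𝒢.groupoid.tgt_inv g).symm a
  rw [𝒢.groupoid.mul_inv] at h1
  exact h1.trans (𝒢.frame_one hι _ a)

include hι in
theorem injective_frame (g : 𝒢.arrows) : Function.Injective (𝒢.frame g) := fun a b h => by
  apply 𝒢.injective_iso (𝒢.groupoid.tgt g)
  rw [← 𝒢.maurerCartan_frame hι, ← 𝒢.maurerCartan_frame hι, h]

include hι in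
theorem exists_mfderiv_val_eq_frame {y : L} (s : 𝒢.groupoid.src ⁻¹' {y}) (a : Fin n → ℝ) :
    ∃ v, mfderiv (𝓡 n) (𝓡 𝒢.dim) (Subtype.val : 𝒢.groupoid.src ⁻¹' {y} → 𝒢.arrows) s v =
      𝒢.frame s.1 a := by
  obtain ⟨w, hw⟩ := 𝒢.exists_mfderiv_val_eq_iso hι (𝒢.groupoid.tgt s.1) a
  refine 𝒢.exists_mfderiv_val_eq hι s _ ?_
  have h1 := 𝒢.groupoid.mfderiv_val_mfderiv_rightMul hι s.1 rfl
    (𝒢.groupoid.unit (𝒢.groupoid.tgt s.1)) w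
  rw [hw] at h1
  have h2 := mfderiv_mfderiv_subtypeVal (hι (𝒢.groupoid.src s.1)) 𝒢.groupoid.mdifferentiable_src
    (𝒢.groupoid.rightMul s.1 rfl (𝒢.groupoid.unit (𝒢.groupoid.tgt s.1)))
    (mfderiv (𝓡 n) (𝓡 n) (𝒢.groupoid.rightMul s.1 rfl)
      (𝒢.groupoid.unit (𝒢.groupoid.tgt s.1)) w)
  have h3 : (𝒢.groupoid.rightMul s.1 rfl (𝒢.groupoid.unit (𝒢.groupoid.tgt s.1))).1 = s.1 :=
    𝒢.groupoid.one_mul s.1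
  have h4 : (mfderiv (𝓡 𝒢.dim) (𝓡 r) 𝒢.groupoid.src
      (𝒢.groupoid.rightMul s.1 rfl (𝒢.groupoid.unit (𝒢.groupoid.tgt s.1))).1 (𝒢.frame s.1 a) :
        EuclideanSpace ℝ (Fin r)) = 0 :=
    (congrArg (fun ξ : EuclideanSpace ℝ (Fin 𝒢.dim) => (mfderiv (𝓡 𝒢.dim) (𝓡 r) 𝒢.groupoid.src
      (𝒢.groupoid.rightMul s.1 rfl (𝒢.groupoid.unit (𝒢.groupoid.tgt s.1))).1 ξ :
        EuclideanSpace ℝ (Fin r))) h1).symm.trans h2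
  rw [h3] at h4
  exact h4

include hι in
-- The frame is tangent to the source fiber, injective, and has the dimension n of the fiber, so it
-- spans the tangent space.
theorem exists_frame_eq {y : L} (s : 𝒢.groupoid.src ⁻¹' {y}) (v : TangentSpace (𝓡 n) s) :
    ∃ a, 𝒢.frame s.1 a =
      mfderiv (𝓡 n) (𝓡 𝒢.dim) (Subtype.val : 𝒢.groupoid.src ⁻¹' {y} → 𝒢.arrows) s v := by
  let B : EuclideanSpace ℝ (Fin n) →ₗ[ℝ] EuclideanSpace ℝ (Fin 𝒢.dim) :=
    (mfderiv (𝓡 n) (𝓡 𝒢.dim) (Subtype.val : 𝒢.groupoid.src ⁻¹' {y} → 𝒢.arrows) s).toLinearMap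
  let C : (Fin n → ℝ) →ₗ[ℝ] EuclideanSpace ℝ (Fin 𝒢.dim) := (𝒢.frame s.1).toLinearMap
  have hB : Function.Injective B :=
    injective_mfderiv_of_isImmersionAt ((hι y).isImmersion.isImmersionAt s)
  have hC : Function.Injective C := 𝒢.injective_frame hι s.1
  have hle : C.range ≤ B.range := by
    rintro _ ⟨a, rfl⟩
    exact 𝒢.exists_mfderiv_val_eq_frame hι s a
  have h1 := LinearMap.finrank_range_of_inj hB
  have h2 := LinearMap.finrank_range_of_inj hC
  rw [finrank_euclideanSpace_fin] at h1
  rw [Module.finrank_fin_fun] at h2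
  have := Submodule.eq_of_le_of_finrank_eq hle (by omega)
  have hmem : B v ∈ C.range := by rw [this]; exact ⟨v, rfl⟩
  exact hmem

include hι in
theorem mfderiv_tgt_frame (g : 𝒢.arrows) (a : Fin n → ℝ) :
    (mfderiv (𝓡 𝒢.dim) (𝓡 r) 𝒢.groupoid.tgt g (𝒢.frame g a) : EuclideanSpace ℝ (Fin r)) =
      A.anchor (𝒢.groupoid.tgt g) a := by
  obtain ⟨v, hv⟩ := 𝒢.exists_mfderiv_val_eq_iso hι (𝒢.groupoid.tgt g) a
  have h1 := 𝒢.groupoid.mfderiv_tgt_dRight hι (k := g) rfl _ v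
  rw [hv] at h1
  have h2 := 𝒢.anchor_iso (𝒢.groupoid.tgt g) a
  have h3 : (mfderiv (𝓡 𝒢.dim) (𝓡 r) 𝒢.groupoid.tgt
      (𝒢.groupoid.mul (𝒢.groupoid.one (𝒢.groupoid.tgt g)) g) (𝒢.frame g a) :
        EuclideanSpace ℝ (Fin r)) = mfderiv (𝓡 𝒢.dim) (𝓡 r) 𝒢.groupoid.tgt g (𝒢.frame g a) := by
    rw [𝒢.groupoid.one_mul]
  refine h3.symm.trans (h1.trans (h2.trans ?_))
  rw [𝒢.groupoid.tgt_one]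

end Integration

end CartanRealization

namespace CartanRealization

open Set Manifold

/-! ### Smoothness of the right-invariant frame. -/

namespace Integration

variable {n r : ℕ} {L : Type u} [TopologicalSpace L] [ChartedSpace (EuclideanSpace ℝ (Fin r)) L]
  [IsManifold (𝓡 r) ∞ L] {A : CartanData n r L} (𝒢 : Integration A)

/-- The right-invariant frame in the chart at `g₀`. -/
noncomputable def frameChart (g₀ : 𝒢.arrows) (y : EuclideanSpace ℝ (Fin 𝒢.dim)) :
    (Fin n → ℝ) →L[ℝ] EuclideanSpace ℝ (Fin 𝒢.dim) :=
  ContinuousLinearMap.comp (M₂ := EuclideanSpace ℝ (Fin 𝒢.dim))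
    (mfderiv (𝓡 𝒢.dim) 𝓘(ℝ, EuclideanSpace ℝ (Fin 𝒢.dim)) (extChartAt (𝓡 𝒢.dim) g₀)
      ((extChartAt (𝓡 𝒢.dim) g₀).symm y)) (𝒢.frame ((extChartAt (𝓡 𝒢.dim) g₀).symm y))

theorem frameChart_apply (g₀ : 𝒢.arrows) (y : EuclideanSpace ℝ (Fin 𝒢.dim)) (a : Fin n → ℝ) :
    𝒢.frameChart g₀ y a = chartField (M := 𝒢.arrows) (fun g => 𝒢.frame g a) g₀ y := rfl

section Slice

variable {F : Type*} [NormedAddCommGroup F] [NormedSpace ℝ F] {x₀ : L}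
  (h : IsSubmersionAtOfComplement F (𝓡 𝒢.dim) (𝓡 r) ∞ 𝒢.groupoid.src (𝒢.groupoid.one x₀))

/-- The family of slices given by the charts in which the source map is a projection. -/
noncomputable def slice (q : L × F) : 𝒢.arrows :=
  h.domChart.symm (h.equiv.symm (h.codChart q.1, q.2))

/-- The coordinate of the unit at `x` in the slice. -/
noncomputable def unitCoord (x : L) : F := (h.equiv (h.domChart (𝒢.groupoid.one x))).2

/-- The vertical coordinates of `iso x a`. -/
noncomputable def isoCoord (x : L) : (Fin n → ℝ) →L[ℝ] F :=
  ((ContinuousLinearMap.snd ℝ (EuclideanSpace ℝ (Fin r)) F).comp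
    (h.equiv : EuclideanSpace ℝ (Fin 𝒢.dim) →L[ℝ] EuclideanSpace ℝ (Fin r) × F)).comp
    (ContinuousLinearMap.comp (M₂ := EuclideanSpace ℝ (Fin 𝒢.dim))
      (mfderiv (𝓡 𝒢.dim) 𝓘(ℝ, EuclideanSpace ℝ (Fin 𝒢.dim)) h.domChart (𝒢.groupoid.one x))
      (𝒢.iso x))

variable {h} {x : L} (hx : 𝒢.groupoid.one x ∈ h.domChart.source)

include hx in
theorem mem_codChart_source_of_unit : x ∈ h.codChart.source := by
  have := h.source_subset_preimage_source hx
  rwa [mem_preimage, 𝒢.groupoid.src_one] at this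

include hx in
theorem equiv_symm_unitCoord :
    h.equiv.symm (h.codChart x, 𝒢.unitCoord h x) = h.domChart (𝒢.groupoid.one x) := by
  have := IsSubmersionAtOfComplement.codChart_apply h hx
  rw [𝒢.groupoid.src_one] at this
  rw [this, unitCoord, Prod.mk.eta, ContinuousLinearEquiv.symm_apply_apply]

include hx in
theorem slice_unitCoord : 𝒢.slice h (x, 𝒢.unitCoord h x) = 𝒢.groupoid.one x := by
  rw [slice, 𝒢.equiv_symm_unitCoord hx, h.domChart.left_inv hx]

include hx in
theorem eventually_src_slice :
    ∀ᶠ q in 𝓝 (x, 𝒢.unitCoord h x), 𝒢.groupoid.src (𝒢.slice h q) = q.1 := by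
  have hc : ContinuousAt (fun q : L × F => h.equiv.symm (h.codChart q.1, q.2))
      (x, 𝒢.unitCoord h x) := by
    refine h.equiv.symm.continuous.continuousAt.comp (ContinuousAt.prodMk ?_ continuousAt_snd)
    exact ContinuousAt.comp (g := h.codChart)
      (h.codChart.continuousAt (𝒢.mem_codChart_source_of_unit hx)) continuousAt_fst
  filter_upwards [hc.eventually_mem (h.domChart.open_target.mem_nhds
      (by rw [𝒢.equiv_symm_unitCoord hx]; exact h.domChart.map_source hx)),
    continuousAt_fst.eventually_mem (h.codChart.open_source.mem_nhds
      (𝒢.mem_codChart_source_of_unit hx))] with q h1 h2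
  exact IsSubmersionAtOfComplement.map_symm h h2 h1

include hx in
theorem contMDiffAt_slice :
    ContMDiffAt ((𝓡 r).prod 𝓘(ℝ, F)) (𝓡 𝒢.dim) ∞ (𝒢.slice h) (x, 𝒢.unitCoord h x) := by
  have h1 : ContMDiffAt ((𝓡 r).prod 𝓘(ℝ, F)) (𝓡 r) ∞ (fun q : L × F => h.codChart q.1)
      (x, 𝒢.unitCoord h x) :=
    ContMDiffAt.comp (g := h.codChart) (x, 𝒢.unitCoord h x) (contMDiffAt_of_mem_maximalAtlas
      h.codChart_mem_maximalAtlas (𝒢.mem_codChart_source_of_unit hx)) contMDiffAt_fst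
  have h2 : ContMDiffAt ((𝓡 r).prod 𝓘(ℝ, F)) 𝓘(ℝ, EuclideanSpace ℝ (Fin r) × F) ∞
      (fun q : L × F => (h.codChart q.1, q.2)) (x, 𝒢.unitCoord h x) :=
    h1.prodMk_space contMDiffAt_snd
  have h3 : ContMDiffAt ((𝓡 r).prod 𝓘(ℝ, F)) (𝓡 𝒢.dim) ∞
      (fun q : L × F => h.equiv.symm (h.codChart q.1, q.2)) (x, 𝒢.unitCoord h x) :=
    ContMDiffAt.comp (g := h.equiv.symm) (x, 𝒢.unitCoord h x)
      h.equiv.symm.contDiff.contDiffAt.contMDiffAt h2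
  refine ContMDiffAt.comp (g := h.domChart.symm) (x, 𝒢.unitCoord h x)
    (contMDiffAt_symm_of_mem_maximalAtlas h.domChart_mem_maximalAtlas ?_) h3
  rw [𝒢.equiv_symm_unitCoord hx]
  exact h.domChart.map_source hx

omit h hx in
theorem contMDiffAt_mul {E' H' P : Type*} [NormedAddCommGroup E'] [NormedSpace ℝ E']
    [TopologicalSpace H'] {I : ModelWithCorners ℝ E' H'} [TopologicalSpace P] [ChartedSpace H' P]
    {f g : P → 𝒢.arrows} {p : P} (hf : ContMDiffAt I (𝓡 𝒢.dim) ∞ f p)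
    (hg : ContMDiffAt I (𝓡 𝒢.dim) ∞ g p)
    (hfg : ∀ᶠ q in 𝓝 p, 𝒢.groupoid.src (f q) = 𝒢.groupoid.tgt (g q)) :
    ContMDiffAt I (𝓡 𝒢.dim) ∞ (fun q => 𝒢.groupoid.mul (f q) (g q)) p := by
  have h1 : ContMDiffWithinAt I ((𝓡 𝒢.dim).prod (𝓡 𝒢.dim)) ∞ (fun q => (f q, g q))
      {q | 𝒢.groupoid.src (f q) = 𝒢.groupoid.tgt (g q)} p := (hf.prodMk hg).contMDiffWithinAt
  exact ((𝒢.groupoid.contMDiffOn_mul (f p, g p) hfg.self_of_nhds).comp p h1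
    fun q hq => hq).contMDiffAt hfg

include hx in
theorem mdifferentiableAt_slice_mul {g : 𝒢.arrows} (hg : 𝒢.groupoid.tgt g = x) :
    MDifferentiableAt 𝓘(ℝ, F) (𝓡 𝒢.dim) (fun w => 𝒢.groupoid.mul (𝒢.slice h (x, w)) g)
      (𝒢.unitCoord h x) := by
  have h1 : ContMDiffAt 𝓘(ℝ, F) ((𝓡 r).prod 𝓘(ℝ, F)) ∞ (fun w : F => (x, w))
      (𝒢.unitCoord h x) := contMDiffAt_const.prodMk contMDiffAt_id
  refine (𝒢.contMDiffAt_mul ((𝒢.contMDiffAt_slice hx).comp _ h1) contMDiffAt_const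
    ?_).mdifferentiableAt (by simp)
  filter_upwards [h1.continuousAt.eventually (𝒢.eventually_src_slice hx)] with w hw
  exact hw.trans hg.symm

variable [∀ y, ChartedSpace (EuclideanSpace ℝ (Fin n)) (𝒢.groupoid.src ⁻¹' {y})]
  (hι : ∀ y, IsSmoothEmbedding (𝓡 n) (𝓡 𝒢.dim) ∞
    (Subtype.val : 𝒢.groupoid.src ⁻¹' {y} → 𝒢.arrows))

include hι hx in
-- `dRight` lives on a source fiber that moves with g. Near the unit that fiber is parametrized by
-- the slice w ↦ `slice (x, w)`, so the frame becomes a partial derivative with respect to w in the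
-- fixed vector space F, applied to the vertical coordinates of `iso`.
theorem frame_eq_mfderiv_slice_mul {g : 𝒢.arrows} (hg : 𝒢.groupoid.tgt g = x) (a : Fin n → ℝ) :
    𝒢.frame g a = mfderiv 𝓘(ℝ, F) (𝓡 𝒢.dim) (fun w => 𝒢.groupoid.mul (𝒢.slice h (x, w)) g)
      (𝒢.unitCoord h x) (𝒢.isoCoord h x a) := by
  subst hg
  set x := 𝒢.groupoid.tgt g with hxg
  let s := 𝒢.groupoid.unit x
  obtain ⟨v, hv⟩ := 𝒢.exists_mfderiv_val_eq_iso hι x a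
  have h1 := 𝒢.groupoid.dRight_mfderiv_val hι (k := g) rfl s v
  let ρ : 𝒢.groupoid.src ⁻¹' {x} → F := fun s' => (h.equiv (h.domChart s'.1)).2
  have k1 := (𝒢.groupoid.mdifferentiable_val hι x s).hasMFDerivAt
  have k2 : HasMFDerivAt (𝓡 𝒢.dim) 𝓘(ℝ, EuclideanSpace ℝ (Fin 𝒢.dim)) h.domChart s.1
      (mfderiv (𝓡 𝒢.dim) 𝓘(ℝ, EuclideanSpace ℝ (Fin 𝒢.dim)) h.domChart s.1) :=
    ((contMDiffAt_of_mem_maximalAtlas h.domChart_mem_maximalAtlas hx).mdifferentiableAt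
      (by simp)).hasMFDerivAt
  have k3 : HasMFDerivAt 𝓘(ℝ, EuclideanSpace ℝ (Fin 𝒢.dim)) 𝓘(ℝ, F) (fun z => (h.equiv z).2)
      (h.domChart s.1) ((ContinuousLinearMap.snd ℝ (EuclideanSpace ℝ (Fin r)) F).comp
    (h.equiv : EuclideanSpace ℝ (Fin 𝒢.dim) →L[ℝ] EuclideanSpace ℝ (Fin r) × F)) :=
    (ContinuousLinearMap.hasFDerivAt ((ContinuousLinearMap.snd ℝ (EuclideanSpace ℝ (Fin r)) F).comp
      (h.equiv : EuclideanSpace ℝ (Fin 𝒢.dim) →L[ℝ] EuclideanSpace ℝ (Fin r) × F))).hasMFDerivAt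
  have kρ := HasMFDerivAt.comp (g := fun z => (h.equiv z).2)
    (f := fun s' : 𝒢.groupoid.src ⁻¹' {x} => h.domChart s'.1) s k3
    (HasMFDerivAt.comp (g := h.domChart) s k2 k1)
  have km := (𝒢.mdifferentiableAt_slice_mul hx rfl).hasMFDerivAt
  have kc := (HasMFDerivAt.comp (g := fun w => 𝒢.groupoid.mul (𝒢.slice h (x, w)) g) (f := ρ) s
    km kρ).mfderiv
  have ke : (fun w => 𝒢.groupoid.mul (𝒢.slice h (x, w)) g) ∘ ρ =ᶠ[𝓝 s]
      fun s' => 𝒢.groupoid.mul s'.1 g := by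
    filter_upwards [continuous_subtype_val.continuousAt.eventually_mem
      (h.domChart.open_source.mem_nhds hx)] with s' hs'
    have e : h.codChart x = (h.equiv (h.domChart s'.1)).1 := by
      rw [← IsSubmersionAtOfComplement.codChart_apply h hs']
      exact congrArg _ s'.2.symm
    simp only [Function.comp_apply, slice, ρ, e, Prod.mk.eta,
      ContinuousLinearEquiv.symm_apply_apply, h.domChart.left_inv hs']
  rw [ke.mfderiv_eq] at kc
  have hv' : (mfderiv (𝓡 n) (𝓡 𝒢.dim) (Subtype.val : 𝒢.groupoid.src ⁻¹' {x} → 𝒢.arrows) s v :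
      EuclideanSpace ℝ (Fin 𝒢.dim)) = 𝒢.iso x a := hv
  have h2 : 𝒢.frame g a = 𝒢.groupoid.dRight g s.1
      (mfderiv (𝓡 n) (𝓡 𝒢.dim) (Subtype.val : 𝒢.groupoid.src ⁻¹' {x} → 𝒢.arrows) s v) :=
    congrArg (fun ξ : EuclideanSpace ℝ (Fin 𝒢.dim) =>
      (𝒢.groupoid.dRight g s.1 ξ : EuclideanSpace ℝ (Fin 𝒢.dim))) hv'.symm
  refine h2.trans (h1.trans ((congrArg (fun T => T v) kc).trans ?_))
  exact congrArg (fun ξ : EuclideanSpace ℝ (Fin 𝒢.dim) =>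
    (mfderiv 𝓘(ℝ, F) (𝓡 𝒢.dim) (fun w => 𝒢.groupoid.mul (𝒢.slice h (x, w)) g)
      (𝒢.unitCoord h x) ((h.equiv (mfderiv (𝓡 𝒢.dim) 𝓘(ℝ, EuclideanSpace ℝ (Fin 𝒢.dim))
        h.domChart s.1 ξ : EuclideanSpace ℝ (Fin 𝒢.dim))).2) : EuclideanSpace ℝ (Fin 𝒢.dim))) hv'

end Slice

end Integration

end CartanRealization

namespace CartanRealization

open Set Manifold

namespace Integration

variable {n r : ℕ} {L : Type u} [TopologicalSpace L] [ChartedSpace (EuclideanSpace ℝ (Fin r)) L]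
  [IsManifold (𝓡 r) ∞ L] {A : CartanData n r L} (𝒢 : Integration A)

section Slice

variable {F : Type*} [NormedAddCommGroup F] [NormedSpace ℝ F] {x₀ : L}
  {h : IsSubmersionAtOfComplement F (𝓡 𝒢.dim) (𝓡 r) ∞ 𝒢.groupoid.src (𝒢.groupoid.one x₀)}

theorem contMDiffAt_unitCoord {x : L} (hx : 𝒢.groupoid.one x ∈ h.domChart.source) :
    ContMDiffAt (𝓡 r) 𝓘(ℝ, F) ∞ (𝒢.unitCoord h) x := by
  have h1 : ContMDiffAt (𝓡 r) 𝓘(ℝ, EuclideanSpace ℝ (Fin 𝒢.dim)) ∞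
      (fun x => h.domChart (𝒢.groupoid.one x)) x :=
    ContMDiffAt.comp (g := h.domChart) x (contMDiffAt_of_mem_maximalAtlas
      h.domChart_mem_maximalAtlas hx) (𝒢.groupoid.contMDiff_one x)
  have h2 : ContMDiffAt 𝓘(ℝ, EuclideanSpace ℝ (Fin 𝒢.dim)) 𝓘(ℝ, F) ∞
      (fun z => (h.equiv z).2) (h.domChart (𝒢.groupoid.one x)) :=
    (contDiff_snd.comp h.equiv.contDiff).contDiffAt.contMDiffAt
  exact ContMDiffAt.comp (g := fun z => (h.equiv z).2) x h2 h1

theorem contMDiffOn_isoCoord (a : Fin n → ℝ) :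
    ContMDiffOn (𝓡 r) 𝓘(ℝ, F) ∞ (fun x => 𝒢.isoCoord h x a)
      {x | 𝒢.groupoid.one x ∈ h.domChart.source} := by
  have h1 : ContMDiff (𝓡 r) (𝓡 𝒢.dim).tangent ∞ (fun x : L =>
      (⟨𝒢.groupoid.one x, 𝒢.iso x a⟩ : TangentBundle (𝓡 𝒢.dim) 𝒢.arrows)) :=
    𝒢.contMDiff_iso.comp (contMDiff_id.prodMk contMDiff_const)
  have h2 := contMDiffOn_tangentMap (I := 𝓡 𝒢.dim) h.domChart.open_source
    (contMDiffOn_of_mem_maximalAtlas h.domChart_mem_maximalAtlas)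
  have h3 := (contMDiff_snd_tangentBundle_modelSpace _ _).comp_contMDiffOn
    (h2.comp h1.contMDiffOn fun x hx => hx)
  have h4 : ContMDiff 𝓘(ℝ, EuclideanSpace ℝ (Fin 𝒢.dim)) 𝓘(ℝ, F) ∞ (fun z => (h.equiv z).2) :=
    (contDiff_snd.comp h.equiv.contDiff).contMDiff
  exact h4.comp_contMDiffOn h3

end Slice

variable [∀ y, ChartedSpace (EuclideanSpace ℝ (Fin n)) (𝒢.groupoid.src ⁻¹' {y})]
  (hι : ∀ y, IsSmoothEmbedding (𝓡 n) (𝓡 𝒢.dim) ∞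
    (Subtype.val : 𝒢.groupoid.src ⁻¹' {y} → 𝒢.arrows))

include hι in
-- By `frame_eq_mfderiv_slice_mul` the frame in a chart is ∂_w Ψ(y, W y) ∘ Ω y. Here Ψ is
-- multiplication of the slice with the point y in charts, W is the coordinate of the unit at its
-- target, and Ω is `isoCoord`; all three are smooth.
theorem contDiffAt_frameChart (g₀ : 𝒢.arrows) :
    ContDiffAt ℝ ∞ (𝒢.frameChart g₀) (extChartAt (𝓡 𝒢.dim) g₀ g₀) := by
  obtain ⟨F, _, _, hF⟩ := 𝒢.groupoid.submersion_src
  have h := hF (𝒢.groupoid.one (𝒢.groupoid.tgt g₀))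
  set φ := extChartAt (𝓡 𝒢.dim) g₀ with hφ
  set y₀ := φ g₀ with hy₀
  have hy₀t : φ.target ∈ 𝓝 y₀ := extChartAt_target_mem_nhds g₀
  have hφ₀ : φ.symm y₀ = g₀ := extChartAt_to_inv g₀
  let x : EuclideanSpace ℝ (Fin 𝒢.dim) → L := fun y => 𝒢.groupoid.tgt (φ.symm y)
  have hsymm : ContMDiffOn 𝓘(ℝ, EuclideanSpace ℝ (Fin 𝒢.dim)) (𝓡 𝒢.dim) ∞ φ.symm φ.target :=
    contMDiffOn_extChartAt_symm g₀
  have hxs : ContMDiffOn 𝓘(ℝ, EuclideanSpace ℝ (Fin 𝒢.dim)) (𝓡 r) ∞ x φ.target :=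
    ContMDiff.comp_contMDiffOn (g := 𝒢.groupoid.tgt)
      (fun g => (𝒢.groupoid.submersion_tgt.isSubmersionAt g).contMDiffAt) hsymm
  have hxc : ContMDiffAt 𝓘(ℝ, EuclideanSpace ℝ (Fin 𝒢.dim)) (𝓡 r) ∞ x y₀ := hxs.contMDiffAt hy₀t
  have hx₀ : 𝒢.groupoid.one (x y₀) ∈ h.domChart.source := by
    simp only [x, hφ₀]
    exact h.mem_domChart_source
  let s : Set (EuclideanSpace ℝ (Fin 𝒢.dim)) :=
    {y | y ∈ φ.target ∧ 𝒢.groupoid.one (x y) ∈ h.domChart.source}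
  have hs : s ∈ 𝓝 y₀ := Filter.inter_mem hy₀t ((ContinuousAt.comp (g := 𝒢.groupoid.one)
    𝒢.groupoid.contMDiff_one.continuous.continuousAt hxc.continuousAt).preimage_mem_nhds
      (h.domChart.open_source.mem_nhds hx₀))
  have hW : ContDiffAt ℝ ∞ (fun y => 𝒢.unitCoord h (x y)) y₀ :=
    (ContMDiffAt.comp (g := 𝒢.unitCoord h) y₀ (𝒢.contMDiffAt_unitCoord hx₀) hxc).contDiffAt
  have hΩ : ContDiffAt ℝ ∞ (fun y => 𝒢.isoCoord h (x y)) y₀ := by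
    refine ContDiffOn.contDiffAt (contDiffOn_clm_apply.2 fun a => ?_) hs
    exact ((𝒢.contMDiffOn_isoCoord a).comp (hxs.mono fun y hy => hy.1)
      fun y hy => hy.2).contDiffOn
  let Ψ : EuclideanSpace ℝ (Fin 𝒢.dim) × F → EuclideanSpace ℝ (Fin 𝒢.dim) :=
    fun q => φ (𝒢.groupoid.mul (𝒢.slice h (x q.1, q.2)) (φ.symm q.1))
  -- At w = W y the slice passes through the unit, so Ψ(y, W y) = y. In particular Ψ takes values in
  -- the domain of the chart near this point.
  have hmul : ∀ y ∈ s, 𝒢.groupoid.mul (𝒢.slice h (x y, 𝒢.unitCoord h (x y))) (φ.symm y) =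
      φ.symm y := fun y hy => by
    rw [𝒢.slice_unitCoord hy.2]
    exact 𝒢.groupoid.one_mul _
  have hΨ : ContDiffAt ℝ ∞ Ψ (y₀, 𝒢.unitCoord h (x y₀)) := by
    have k1 : ContMDiffAt 𝓘(ℝ, EuclideanSpace ℝ (Fin 𝒢.dim) × F)
        𝓘(ℝ, EuclideanSpace ℝ (Fin 𝒢.dim)) ∞ Prod.fst (y₀, 𝒢.unitCoord h (x y₀)) :=
      contDiffAt_fst.contMDiffAt
    have k2 : ContMDiffAt 𝓘(ℝ, EuclideanSpace ℝ (Fin 𝒢.dim) × F) 𝓘(ℝ, F) ∞ Prod.snd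
        (y₀, 𝒢.unitCoord h (x y₀)) := contDiffAt_snd.contMDiffAt
    have k3 : ContMDiffAt 𝓘(ℝ, EuclideanSpace ℝ (Fin 𝒢.dim) × F) ((𝓡 r).prod 𝓘(ℝ, F)) ∞
        (fun q => (x q.1, q.2)) (y₀, 𝒢.unitCoord h (x y₀)) :=
      (ContMDiffAt.comp (g := x) (f := Prod.fst) (y₀, 𝒢.unitCoord h (x y₀)) hxc k1).prodMk k2
    have k4 : ContMDiffAt 𝓘(ℝ, EuclideanSpace ℝ (Fin 𝒢.dim) × F) (𝓡 𝒢.dim) ∞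
        (fun q => 𝒢.slice h (x q.1, q.2)) (y₀, 𝒢.unitCoord h (x y₀)) :=
      ContMDiffAt.comp (g := 𝒢.slice h) (f := fun q => (x q.1, q.2))
        (y₀, 𝒢.unitCoord h (x y₀)) (𝒢.contMDiffAt_slice hx₀) k3
    have k5 : ContMDiffAt 𝓘(ℝ, EuclideanSpace ℝ (Fin 𝒢.dim) × F) (𝓡 𝒢.dim) ∞
        (fun q => φ.symm q.1) (y₀, 𝒢.unitCoord h (x y₀)) :=
      ContMDiffAt.comp (g := φ.symm) (f := Prod.fst) (y₀, 𝒢.unitCoord h (x y₀))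
        (hsymm.contMDiffAt hy₀t) k1
    have k6 := 𝒢.contMDiffAt_mul k4 k5
      (k3.continuousAt.eventually (𝒢.eventually_src_slice hx₀))
    refine ContMDiffAt.contDiffAt (ContMDiffAt.comp (g := φ)
      (y₀, 𝒢.unitCoord h (x y₀)) ?_ k6)
    refine contMDiffAt_extChartAt' ?_
    simp only
    rw [hmul y₀ (mem_of_mem_nhds hs), hφ₀]
    exact mem_chart_source _ g₀
  have hgraph : ContDiffAt ℝ ∞ (fun y => (y, 𝒢.unitCoord h (x y))) y₀ := contDiffAt_id.prodMk hW
  have hd : ∀ᶠ y in 𝓝 y₀, DifferentiableAt ℝ Ψ (y, 𝒢.unitCoord h (x y)) := by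
    have k1 : ∀ᶠ q in 𝓝 (y₀, 𝒢.unitCoord h (x y₀)), ContDiffAt ℝ 1 Ψ q :=
      (hΨ.of_le (by simp)).eventually (by simp)
    filter_upwards [hgraph.continuousAt.eventually k1] with y hy
    exact hy.differentiableAt (by simp)
  have key : ContDiffAt ℝ ∞ (fun y => ((fderiv ℝ Ψ (y, 𝒢.unitCoord h (x y))).comp
      (ContinuousLinearMap.inr ℝ (EuclideanSpace ℝ (Fin 𝒢.dim)) F)).comp
        (𝒢.isoCoord h (x y))) y₀ := by
    have k1 : ContDiffAt ℝ ∞ (fderiv ℝ Ψ) (y₀, 𝒢.unitCoord h (x y₀)) :=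
      hΨ.fderiv_right (by simp)
    exact ((ContDiffAt.comp y₀ k1 hgraph).clm_comp contDiffAt_const).clm_comp hΩ
  refine key.congr_of_eventuallyEq ?_
  filter_upwards [hs, hd] with y hy hdy
  ext1 a
  have e := hmul y hy
  have k1 := (𝒢.mdifferentiableAt_slice_mul hy.2 (g := φ.symm y) rfl).hasMFDerivAt
  have k2 : MDifferentiableAt (𝓡 𝒢.dim) 𝓘(ℝ, EuclideanSpace ℝ (Fin 𝒢.dim)) φ
      (𝒢.groupoid.mul (𝒢.slice h (x y, 𝒢.unitCoord h (x y))) (φ.symm y)) := by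
    rw [e]
    exact mdifferentiableAt_extChartAt (mem_chart_of_mem_extChartAt (φ.map_target hy.1))
  have k3 := (HasMFDerivAt.comp (g := φ)
    (f := fun w => 𝒢.groupoid.mul (𝒢.slice h (x y, w)) (φ.symm y)) (𝒢.unitCoord h (x y))
    k2.hasMFDerivAt k1).mfderiv
  rw [mfderiv_eq_fderiv] at k3
  have k4 := (HasFDerivAt.comp (𝒢.unitCoord h (x y)) (g := Ψ)
    hdy.hasFDerivAt (hasFDerivAt_prodMk_right y (𝒢.unitCoord h (x y)))).fderiv
  have k5 := 𝒢.frame_eq_mfderiv_slice_mul hy.2 hι (g := φ.symm y) rfl a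
  have k6 := congrArg (fun T => T (𝒢.isoCoord h (x y) a)) (k4.symm.trans k3)
  refine Eq.trans ?_ k6.symm
  have k7 : (mfderiv (𝓡 𝒢.dim) 𝓘(ℝ, EuclideanSpace ℝ (Fin 𝒢.dim)) φ
      (𝒢.groupoid.mul (𝒢.slice h (x y, 𝒢.unitCoord h (x y))) (φ.symm y))
      (𝒢.frame (φ.symm y) a) : EuclideanSpace ℝ (Fin 𝒢.dim)) = 𝒢.frameChart g₀ y a := by
    rw [e]
    rfl
  refine k7.symm.trans ?_
  exact congrArg (fun ξ : EuclideanSpace ℝ (Fin 𝒢.dim) =>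
    (mfderiv (𝓡 𝒢.dim) 𝓘(ℝ, EuclideanSpace ℝ (Fin 𝒢.dim)) φ
      (𝒢.groupoid.mul (𝒢.slice h (x y, 𝒢.unitCoord h (x y))) (φ.symm y)) ξ :
        EuclideanSpace ℝ (Fin 𝒢.dim))) k5

end Integration

end CartanRealization

namespace CartanRealization

open Set Manifold

/-! ### Skew-symmetry of the structure functions -/

namespace CartanData

variable {n d : ℕ} {X : Type*} [TopologicalSpace X] [ChartedSpace (EuclideanSpace ℝ (Fin d)) X]
  [IsManifold (𝓡 d) ∞ X] (D : CartanData n d X)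

theorem bracket_const (a b : Fin n → ℝ) (x : X) (k : Fin n) :
    D.bracket (fun _ => a) (fun _ => b) x k = -∑ i, ∑ j, D.C i j k x * a i * b j := by
  simp only [bracket, derivAlong, mfderiv_const, Finset.sum_neg_distrib]
  exact (sub_zero _).trans (add_zero _)

variable {D}

/-- On constant sections the bracket has no derivative terms, and alternation is polarized on basis
vectors. -/
theorem IsLieAlgebroid.C_swap (hA : D.IsLieAlgebroid) (i j k : Fin n) (x : X) :
    D.C j i k x = -D.C i j k x := by
  have key : ∀ a : Fin n → ℝ, ∑ i, ∑ j, D.C i j k x * a i * a j = 0 := fun a => by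
    have h1 := congrFun (hA.alternating (fun _ => a) contMDiff_const x) k
    rw [bracket_const] at h1
    exact neg_eq_zero.1 h1
  let B : (Fin n → ℝ) → (Fin n → ℝ) → ℝ := fun a b => ∑ i, ∑ j, D.C i j k x * a i * b j
  have hB : ∀ i j, B (Pi.single i 1) (Pi.single j 1) = D.C i j k x := fun i j => by
    simp [B, Pi.single_apply]
  have h1 : B (Pi.single i 1 + Pi.single j 1) (Pi.single i 1 + Pi.single j 1) =
      B (Pi.single i 1) (Pi.single i 1) + B (Pi.single i 1) (Pi.single j 1) +
        B (Pi.single j 1) (Pi.single i 1) + B (Pi.single j 1) (Pi.single j 1) := by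
    simp only [B, ← Finset.sum_add_distrib, Pi.add_apply]
    exact Finset.sum_congr rfl fun _ _ => Finset.sum_congr rfl fun _ _ => by ring
  have h2 : ∀ a, B a a = 0 := key
  rw [h2, h2, h2, hB, hB] at h1
  linarith

end CartanData

/-- Reconciles the sum over all pairs in the bracket with the sum over i < j in the structure
equation. -/
theorem sum_sum_skew {n : ℕ} {c : Fin n → Fin n → ℝ} (hc : ∀ i j, c j i = -c i j)
    (a b : Fin n → ℝ) :
    ∑ i, ∑ j, c i j * a i * b j = ∑ i, ∑ j ∈ Finset.Ioi i, c i j * (a i * b j - a j * b i) := by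
  have hd : ∀ i, c i i = 0 := fun i => by linarith [hc i i]
  have h1 : ∑ i, ∑ j, c i j * a i * b j = ∑ i, ∑ j ∈ Finset.Ioi i, c i j * a i * b j +
      ∑ i, ∑ j ∈ Finset.Iio i, c i j * a i * b j := by
    rw [← Finset.sum_add_distrib]
    refine Finset.sum_congr rfl fun i _ => ?_
    rw [← Finset.sum_union (Finset.disjoint_left.2 fun j h h' =>
      lt_asymm (Finset.mem_Ioi.1 h) (Finset.mem_Iio.1 h'))]
    symm
    refine Finset.sum_subset (Finset.subset_univ _) fun j _ hj => ?_
    have : j = i := by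
      simp only [Finset.mem_union, Finset.mem_Ioi, Finset.mem_Iio, not_or, not_lt] at hj
      exact le_antisymm hj.1 hj.2
    simp [this, hd]
  have h2 : ∑ i, ∑ j ∈ Finset.Iio i, c i j * a i * b j =
      ∑ i, ∑ j ∈ Finset.Ioi i, c j i * a j * b i :=
    Finset.sum_comm' fun i j => by simp
  rw [h1, h2, ← Finset.sum_add_distrib]
  refine Finset.sum_congr rfl fun i _ => ?_
  rw [← Finset.sum_add_distrib]
  exact Finset.sum_congr rfl fun j _ => by rw [hc i j]; ring

/-! ### The source fibers as realizations -/

namespace Integration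

variable {n r : ℕ} {L : Type u} [TopologicalSpace L] [ChartedSpace (EuclideanSpace ℝ (Fin r)) L]
  [IsManifold (𝓡 r) ∞ L] {A : CartanData n r L} (𝒢 : Integration A)
  [∀ y, ChartedSpace (EuclideanSpace ℝ (Fin n)) (𝒢.groupoid.src ⁻¹' {y})]
  (hι : ∀ y, IsSmoothEmbedding (𝓡 n) (𝓡 𝒢.dim) ∞
    (Subtype.val : 𝒢.groupoid.src ⁻¹' {y} → 𝒢.arrows))

include hι in
/-- The coframe of the source fibers dual to the right-invariant frame. -/
theorem exists_coframe (y : L) : ∃ θ : ∀ s : 𝒢.groupoid.src ⁻¹' {y},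
    TangentSpace (𝓡 n) s →L[ℝ] (Fin n → ℝ), ∀ s v, 𝒢.frame s.1 (θ s v) =
      mfderiv (𝓡 n) (𝓡 𝒢.dim) (Subtype.val : 𝒢.groupoid.src ⁻¹' {y} → 𝒢.arrows) s v := by
  have key : ∀ s : 𝒢.groupoid.src ⁻¹' {y}, ∃ θ : EuclideanSpace ℝ (Fin n) →L[ℝ] (Fin n → ℝ),
      ∀ v, 𝒢.frame s.1 (θ v) = mfderiv (𝓡 n) (𝓡 𝒢.dim)
        (Subtype.val : 𝒢.groupoid.src ⁻¹' {y} → 𝒢.arrows) s v := fun s => by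
    let B : EuclideanSpace ℝ (Fin n) →L[ℝ] EuclideanSpace ℝ (Fin 𝒢.dim) :=
      mfderiv (𝓡 n) (𝓡 𝒢.dim) (Subtype.val : 𝒢.groupoid.src ⁻¹' {y} → 𝒢.arrows) s
    obtain ⟨l, hl⟩ := (𝒢.frame s.1).toLinearMap.exists_leftInverse_of_injective
      (LinearMap.ker_eq_bot.2 (𝒢.injective_frame hι s.1))
    refine ⟨(LinearMap.toContinuousLinearMap l).comp B, fun v => ?_⟩
    obtain ⟨a, ha⟩ := 𝒢.exists_frame_eq hι s v
    have h1 : l (𝒢.frame s.1 a) = a := congrArg (fun T => T a) hl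
    have h2 : l (B v) = a := (congrArg l ha).symm.trans h1
    refine Eq.trans ?_ ha
    exact congrArg (𝒢.frame s.1) h2
  choose θ hθ using key
  exact ⟨θ, hθ⟩

variable {y : L} {θ : ∀ s : 𝒢.groupoid.src ⁻¹' {y}, TangentSpace (𝓡 n) s →L[ℝ] (Fin n → ℝ)}
  (hθ : ∀ s v, 𝒢.frame s.1 (θ s v) =
      mfderiv (𝓡 n) (𝓡 𝒢.dim) (Subtype.val : 𝒢.groupoid.src ⁻¹' {y} → 𝒢.arrows) s v)

include hι hθ in
theorem bijective_coframe (s : 𝒢.groupoid.src ⁻¹' {y}) : Function.Bijective (θ s) := by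
  refine ⟨fun v w h => injective_mfderiv_of_isImmersionAt ((hι y).isImmersion.isImmersionAt s) ?_,
    fun a => ?_⟩
  · exact (hθ s v).symm.trans ((congrArg (𝒢.frame s.1) h).trans (hθ s w))
  · obtain ⟨v, hv⟩ := 𝒢.exists_mfderiv_val_eq_frame hι s a
    exact ⟨v, 𝒢.injective_frame hι s.1 ((hθ s v).trans hv)⟩

variable [∀ y, IsManifold (𝓡 n) ∞ (𝒢.groupoid.src ⁻¹' {y})]

/-- The inclusion of a source fiber in charts. -/
noncomputable def chartVal (s : 𝒢.groupoid.src ⁻¹' {y}) (z : EuclideanSpace ℝ (Fin n)) :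
    EuclideanSpace ℝ (Fin 𝒢.dim) :=
  extChartAt (𝓡 𝒢.dim) s.1 ((extChartAt (𝓡 n) s).symm z).1

omit [∀ y, IsManifold (𝓡 n) ∞ (𝒢.groupoid.src ⁻¹' {y})] in
theorem chartVal_self (s : 𝒢.groupoid.src ⁻¹' {y}) :
    𝒢.chartVal s (extChartAt (𝓡 n) s s) = extChartAt (𝓡 𝒢.dim) s.1 s.1 := by
  rw [chartVal, extChartAt_to_inv]

include hι in
theorem contDiffAt_chartVal (s : 𝒢.groupoid.src ⁻¹' {y}) :
    ContDiffAt ℝ ∞ (𝒢.chartVal s) (extChartAt (𝓡 n) s s) := by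
  have e : (extChartAt (𝓡 n) s).symm (extChartAt (𝓡 n) s s) = s := extChartAt_to_inv s
  refine contDiffAt_writtenInCharts
    (f := (Subtype.val : 𝒢.groupoid.src ⁻¹' {y} → 𝒢.arrows)) (mem_extChartAt_target s)
    ((hι y).isImmersion.isImmersionAt _).contMDiffAt ?_
  rw [e]
  exact mem_extChartAt_source s.1

include hι hθ in
theorem eventually_fderiv_chartVal (s : 𝒢.groupoid.src ⁻¹' {y}) :
    ∀ᶠ z in 𝓝 (extChartAt (𝓡 n) s s), fderiv ℝ (𝒢.chartVal s) z =
      (𝒢.frameChart s.1 (𝒢.chartVal s z)).comp (chartForm θ s z) := by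
  have hc : ContinuousAt (fun z => ((extChartAt (𝓡 n) s).symm z).1) (extChartAt (𝓡 n) s s) :=
    continuous_subtype_val.continuousAt.comp
      (mdifferentiableAt_extChartAt_symm (mem_extChartAt_target s)).continuousAt
  have e : (extChartAt (𝓡 n) s).symm (extChartAt (𝓡 n) s s) = s := extChartAt_to_inv s
  filter_upwards [extChartAt_target_mem_nhds (I := 𝓡 n) s, hc.preimage_mem_nhds
    ((isOpen_extChartAt_source (I := 𝓡 𝒢.dim) s.1).mem_nhds
      (by rw [e]; exact mem_extChartAt_source s.1))] with z hz hz'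
  ext1 w
  have h1 := fderiv_writtenInCharts (f := (Subtype.val : 𝒢.groupoid.src ⁻¹' {y} → 𝒢.arrows))
    hz (𝒢.groupoid.mdifferentiable_val hι y _) hz' w
  refine h1.trans ?_
  have h2 : (extChartAt (𝓡 𝒢.dim) s.1).symm (𝒢.chartVal s z) = ((extChartAt (𝓡 n) s).symm z).1 :=
    (extChartAt (𝓡 𝒢.dim) s.1).left_inv hz'
  have h3 := (hθ ((extChartAt (𝓡 n) s).symm z)
    (mfderiv 𝓘(ℝ, EuclideanSpace ℝ (Fin n)) (𝓡 n) (extChartAt (𝓡 n) s).symm z w)).symm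
  rw [ContinuousLinearMap.comp_apply, frameChart, h2]
  exact congrArg (fun ξ : EuclideanSpace ℝ (Fin 𝒢.dim) =>
    (mfderiv (𝓡 𝒢.dim) 𝓘(ℝ, EuclideanSpace ℝ (Fin 𝒢.dim)) (extChartAt (𝓡 𝒢.dim) s.1)
      ((extChartAt (𝓡 n) s).symm z).1 ξ : EuclideanSpace ℝ (Fin 𝒢.dim))) h3

omit [∀ y, ChartedSpace (EuclideanSpace ℝ (Fin n)) (𝒢.groupoid.src ⁻¹' {y})]
  [∀ y, IsManifold (𝓡 n) ∞ (𝒢.groupoid.src ⁻¹' {y})] in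
theorem frameChart_self (g : 𝒢.arrows) :
    𝒢.frameChart g (extChartAt (𝓡 𝒢.dim) g g) = 𝒢.frame g := by
  ext1 a
  rw [frameChart_apply]
  exact chartField_self _ g

include hι in
theorem contDiffAt_frameChart_chartVal (s : 𝒢.groupoid.src ⁻¹' {y}) :
    ContDiffAt ℝ ∞ (fun z => 𝒢.frameChart s.1 (𝒢.chartVal s z)) (extChartAt (𝓡 n) s s) := by
  refine ContDiffAt.comp (g := 𝒢.frameChart s.1) _ ?_ (𝒢.contDiffAt_chartVal hι s)
  rw [chartVal_self]
  exact 𝒢.contDiffAt_frameChart hι s.1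

include hι hθ in
-- With J the inclusion in charts and V the frame, DJ = V ∘ Θ determines Θ. If l' is a left inverse
-- of V at the center, then K = l' ∘ V is the identity there, hence invertible nearby, and Θ = K⁻¹ ∘
-- l' ∘ DJ.
theorem contDiffAt_chartForm_coframe (s : 𝒢.groupoid.src ⁻¹' {y}) :
    ContDiffAt ℝ ∞ (chartForm θ s) (extChartAt (𝓡 n) s s) := by
  obtain ⟨l, hl⟩ := (𝒢.frame s.1).toLinearMap.exists_leftInverse_of_injective
      (LinearMap.ker_eq_bot.2 (𝒢.injective_frame hι s.1))
  let l' : EuclideanSpace ℝ (Fin 𝒢.dim) →L[ℝ] (Fin n → ℝ) := LinearMap.toContinuousLinearMap l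
  let K : EuclideanSpace ℝ (Fin n) → (Fin n → ℝ) →L[ℝ] (Fin n → ℝ) :=
    fun z => l'.comp (𝒢.frameChart s.1 (𝒢.chartVal s z))
  have hK : ContDiffAt ℝ ∞ K (extChartAt (𝓡 n) s s) :=
    contDiffAt_const.clm_comp (𝒢.contDiffAt_frameChart_chartVal hι s)
  have hK₀ : K (extChartAt (𝓡 n) s s) =
      (ContinuousLinearEquiv.refl ℝ (Fin n → ℝ) : (Fin n → ℝ) →L[ℝ] (Fin n → ℝ)) := by
    ext1 a
    simp only [K, chartVal_self, frameChart_self]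
    exact congrArg (fun T => T a) hl
  have hinv : ContDiffAt ℝ ∞ (fun z => (K z).inverse) (extChartAt (𝓡 n) s s) := by
    refine ContDiffAt.comp (g := ContinuousLinearMap.inverse) _ ?_ hK
    rw [hK₀]
    exact contDiffAt_map_inverse _
  have hJ : ContDiffAt ℝ ∞ (fderiv ℝ (𝒢.chartVal s)) (extChartAt (𝓡 n) s s) :=
    (𝒢.contDiffAt_chartVal hι s).fderiv_right (by simp)
  have key : ContDiffAt ℝ ∞ (fun z => (K z).inverse.comp (l'.comp (fderiv ℝ (𝒢.chartVal s) z)))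
      (extChartAt (𝓡 n) s s) := hinv.clm_comp (contDiffAt_const.clm_comp hJ)
  refine key.congr_of_eventuallyEq ?_
  have hr := (ContinuousLinearEquiv.refl ℝ (Fin n → ℝ)).nhds
  rw [← hK₀] at hr
  filter_upwards [𝒢.eventually_fderiv_chartVal hι hθ s, hK.continuousAt.preimage_mem_nhds hr]
    with z hz ⟨e, he⟩
  rw [hz, ← ContinuousLinearMap.comp_assoc]
  change _ = (K z).inverse.comp ((K z).comp (chartForm θ s z))
  rw [← he, ContinuousLinearMap.inverse_equiv, ← ContinuousLinearMap.comp_assoc,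
    ContinuousLinearEquiv.coe_symm_comp_coe, ContinuousLinearMap.id_comp]

include hι hθ in
-- The Maurer-Cartan equation. Freeze the values of θ on v and w; by `frame_curl`, dθ(v, w)
-- corresponds to minus the bracket of the two right-invariant fields, which `bracket_iso` computes.
-- The minus sign matches the one in [eᵢ, eⱼ] = -∑ C_{ij}^k eₖ.
theorem frame_extDerivOneForm (s : 𝒢.groupoid.src ⁻¹' {y}) (v w : TangentSpace (𝓡 n) s) :
    𝒢.frame s.1 (extDerivOneForm θ s v w) =
      -𝒢.frame s.1 (A.bracket (fun _ => θ s v) (fun _ => θ s w) (𝒢.groupoid.tgt s.1)) := by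
  have hV : DifferentiableAt ℝ (𝒢.frameChart s.1) (𝒢.chartVal s (extChartAt (𝓡 n) s s)) := by
    rw [chartVal_self]
    exact (𝒢.contDiffAt_frameChart hι s.1).differentiableAt (by simp)
  have h1 := frame_curl ((𝒢.contDiffAt_chartVal hι s).of_le ENat.LEInfty.out) hV
    ((𝒢.contDiffAt_chartForm_coframe hι hθ s).differentiableAt (by simp))
    (𝒢.eventually_fderiv_chartVal hι hθ s) v w
  rw [chartVal_self] at hV
  rw [chartVal_self, frameChart_self] at h1
  have hself : ∀ u : EuclideanSpace ℝ (Fin n),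
      chartForm θ s (extChartAt (𝓡 n) s s) u = θ s u := fun u => by
    have := form_eq_chartForm θ (mem_extChartAt_source (I := 𝓡 n) s) u
    rw [mfderiv_extChartAt_self] at this
    exact this.symm
  have h2 := 𝒢.bracket_iso (fun _ => θ s v) (fun _ => θ s w) contMDiff_const contMDiff_const s.1
  have h3 := mlieBracket_eq_chartField (fun g => 𝒢.frame g (θ s v)) (fun g => 𝒢.frame g (θ s w)) s.1
  have h4 : ∀ a : Fin n → ℝ, ∀ u, fderiv ℝ (chartField (M := 𝒢.arrows) (fun g => 𝒢.frame g a) s.1)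
      (extChartAt (𝓡 𝒢.dim) s.1 s.1) u =
        fderiv ℝ (𝒢.frameChart s.1) (extChartAt (𝓡 𝒢.dim) s.1 s.1) u a := fun a u => by
    have := (hV.hasFDerivAt.clm_apply (hasFDerivAt_const a _)).fderiv
    refine (congrArg (fun T => T u) this).trans ?_
    simp
  rw [h4, h4] at h3
  have hv : chartForm θ s (extChartAt (𝓡 n) s s) v = θ s v := hself v
  have hw : chartForm θ s (extChartAt (𝓡 n) s s) w = θ s w := hself w
  rw [hv, hw] at h1
  refine h1.trans ?_
  rw [← neg_sub]
  exact congrArg Neg.neg (h3.symm.trans h2)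

/-- The realization of the Lie algebroid on a source fiber of an integration. -/
noncomputable def fiberRealization (hC : ∀ i j k x, A.C j i k x = -A.C i j k x) (y : L) :
    Realization A (𝒢.groupoid.src ⁻¹' {y}) where
  θ := (𝒢.exists_coframe hι y).choose
  h s := 𝒢.groupoid.tgt s.1
  contMDiff_θ := contMDiff_form_of_chartForm
    (𝒢.contDiffAt_chartForm_coframe hι (𝒢.exists_coframe hι y).choose_spec)
  contMDiff_h s := ContMDiffAt.comp (g := 𝒢.groupoid.tgt) s
    (𝒢.groupoid.submersion_tgt.isSubmersionAt s.1).contMDiffAt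
    ((hι y).isImmersion.isImmersionAt s).contMDiffAt
  coframe := 𝒢.bijective_coframe hι (𝒢.exists_coframe hι y).choose_spec
  structure_θ s v w k := by
    have h1 := 𝒢.frame_extDerivOneForm hι (𝒢.exists_coframe hι y).choose_spec s v w
    rw [← map_neg] at h1
    have h2 := congrFun (𝒢.injective_frame hι s.1 h1) k
    rw [h2, Pi.neg_apply, A.bracket_const, neg_neg, sum_sum_skew fun i j => hC i j k _]
  structure_h s v := by
    have h1 := (HasMFDerivAt.comp (g := 𝒢.groupoid.tgt) s
      (𝒢.groupoid.mdifferentiable_tgt s.1).hasMFDerivAt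
      (𝒢.groupoid.mdifferentiable_val hι y s).hasMFDerivAt).mfderiv
    have h2 := (𝒢.exists_coframe hι y).choose_spec s v
    have h3 := 𝒢.mfderiv_tgt_frame hι s.1 ((𝒢.exists_coframe hι y).choose s v)
    rw [h2] at h3
    exact (congrArg (fun T => T v) h1).trans h3

theorem frame_fiberRealization (hC : ∀ i j k x, A.C j i k x = -A.C i j k x) (y : L)
    (s : 𝒢.groupoid.src ⁻¹' {y}) (v : TangentSpace (𝓡 n) s) :
    𝒢.frame s.1 ((𝒢.fiberRealization hι hC y).θ s v) =
      mfderiv (𝓡 n) (𝓡 𝒢.dim) (Subtype.val : 𝒢.groupoid.src ⁻¹' {y} → 𝒢.arrows) s v :=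
  (𝒢.exists_coframe hι y).choose_spec s v

end Integration

end CartanRealization

namespace CartanRealization

open Set Manifold

/-! ### Equivalence up to covering from extension of developments -/

section Extension

variable {n d : ℕ} {X : Type*} [TopologicalSpace X] [ChartedSpace (EuclideanSpace ℝ (Fin d)) X]
  [IsManifold (𝓡 d) ∞ X] {D : CartanData n d X}
  {M : Type v} [TopologicalSpace M] [ChartedSpace (EuclideanSpace ℝ (Fin n)) M]
  [IsManifold (𝓡 n) ∞ M]
  {S : Type u} [TopologicalSpace S] [ChartedSpace (EuclideanSpace ℝ (Fin n)) S]
  [IsManifold (𝓡 n) ∞ S]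

/-- The developments of `R` along `R'` on open sets. -/
def developments (R : Realization D M) (R' : Realization D S) : LocalMaps M S where
  mem U σ := IsOpen U ∧ IsDevelopment R R' U σ
  isOpen h := h.1
  continuousOn h := h.2.continuousOn
  eventuallyEq h h' hq hq' e := h.2.eventuallyEq h'.2 h.1 h'.1 hq hq' e

/-- N is a component of the étale space of developments, with the manifold structure and realization
pulled back along the projection π₁. Locally the evaluation π₂ is a development composed with π₁,
hence itself a development and a local diffeomorphism; V is its image. -/
theorem exists_equivalentUpToCover [T2Space M] [ConnectedSpace M] [T2Space S]
    {R : Realization D M} {R' : Realization D S} (hL : (developments R R').EvenlyExtends)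
    {p₀ : M} {s₀ : S} (h : R.h p₀ = R'.h s₀) :
    ∃ V : TopologicalSpace.Opens S, EquivalentUpToCover R R' V := by
  have h₀ : ∃ U σ, (developments R R').mem U σ ∧ p₀ ∈ U ∧ σ p₀ = s₀ := by
    obtain ⟨U, σ, hU, hp, hσ, hd⟩ := exists_isDevelopment R R' h
    exact ⟨U, σ, ⟨hU, hd⟩, hp, hσ⟩
  let N := (developments R R').Component (show (developments R R').Etale from (p₀, s₀))
  let π₁ : N → M := LocalMaps.Component.proj
  let π₂ : N → S := LocalMaps.Component.ev
  have hcov : IsCoveringMap π₁ := LocalMaps.Component.isCoveringMap hL h₀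
  have hsurj : Function.Surjective π₁ := LocalMaps.Component.surjective_proj hL h₀
  obtain ⟨_, hat⟩ := exists_isPullbackAtlas (n := n) hcov.isLocalHomeomorph
  have := hat.isManifold
  have hπ₁ : IsDevelopment (hat.realization R) R univ π₁ :=
    ⟨fun y _ => hat.contMDiff y, fun _ _ _ => rfl, fun _ _ => rfl⟩
  have key : ∀ y : N, ∃ W, IsOpen W ∧ y ∈ W ∧ IsDevelopment (hat.realization R) R' W π₂ :=
    fun y => by
    obtain ⟨U, σ, ⟨hU, hσ⟩, hy, -, he⟩ := LocalMaps.Component.exists_ev_eq h₀ y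
    obtain ⟨W, hWs, hW, hyW⟩ := mem_nhds_iff.1
      (Filter.inter_mem he (hcov.continuous.continuousAt.preimage_mem_nhds (hU.mem_nhds hy)))
    exact ⟨W, hW, hyW, (hσ.comp (hπ₁.mono (subset_univ W)) fun z hz => (hWs hz).2).congr hW
      fun z hz => (hWs hz).1⟩
  have hπ₂ : IsLocalDiffeomorph (𝓡 n) (𝓡 n) ∞ π₂ := fun y => by
    obtain ⟨W, hW, hy, hd⟩ := key y
    exact hd.isLocalDiffeomorphAt hW hy
  refine ⟨⟨range π₂, hπ₂.isOpen_range⟩, N, inferInstance, inferInstance, inferInstance,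
    inferInstance, inferInstance, hat.realization R, π₁, π₂, hcov, hat.isCoverOnto R hsurj, hπ₂,
    rfl, fun y v => ?_, fun y => ?_⟩ <;> obtain ⟨W, -, hy, hd⟩ := key y
  · exact (hd.θ y hy v).symm
  · exact (hd.h y hy).symm

end Extension

/-! ### Extension of developments along source fibers -/

/-- A realization of the restriction of the Lie algebroid to an orbit, as a realization of the Lie
algebroid. -/
noncomputable def OrbitManifold.push {n d : ℕ} {X : Type u} [TopologicalSpace X]
    [ChartedSpace (EuclideanSpace ℝ (Fin d)) X] [IsManifold (𝓡 d) ∞ X] {D : CartanData n d X}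
    {x₀ : X} (O : OrbitManifold D x₀) {S : Type*} [TopologicalSpace S]
    [ChartedSpace (EuclideanSpace ℝ (Fin n)) S] [IsManifold (𝓡 n) ∞ S]
    (R : Realization O.restriction S) : Realization D S where
  θ := R.θ
  h := O.incl ∘ R.h
  contMDiff_θ := R.contMDiff_θ
  contMDiff_h := O.immersion.contMDiff.comp R.contMDiff_h
  coframe := R.coframe
  structure_θ p v w k := by simp only [R.structure_θ, O.restriction_C, Function.comp_apply]
  structure_h p v := by
    rw [mfderiv_comp p (O.immersion.contMDiff.mdifferentiable (by simp) _)
      (R.contMDiff_h.mdifferentiable (by simp) p), ContinuousLinearMap.comp_apply, R.structure_h,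
      CartanData.anchor, map_sum]
    refine Finset.sum_congr rfl fun i _ => ?_
    rw [map_smul]
    exact congrArg _ (O.restriction_F i _)

theorem OrbitManifold.C_swap {n d : ℕ} {X : Type u} [TopologicalSpace X]
    [ChartedSpace (EuclideanSpace ℝ (Fin d)) X] [IsManifold (𝓡 d) ∞ X] {D : CartanData n d X}
    {x₀ : X} (O : OrbitManifold D x₀) (hA : D.IsLieAlgebroid) (i j k : Fin n) (x : O.carrier) :
    O.restriction.C j i k x = -O.restriction.C i j k x := by
  rw [O.restriction_C, O.restriction_C, hA.C_swap]

namespace Integration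

variable {n d : ℕ} {X : Type u} [TopologicalSpace X] [ChartedSpace (EuclideanSpace ℝ (Fin d)) X]
  [IsManifold (𝓡 d) ∞ X] {D : CartanData n d X} {x₀ : X} {O : OrbitManifold D x₀}
  (𝒢 : Integration O.restriction)
  [∀ y, ChartedSpace (EuclideanSpace ℝ (Fin n)) (𝒢.groupoid.src ⁻¹' {y})]
  [∀ y, IsManifold (𝓡 n) ∞ (𝒢.groupoid.src ⁻¹' {y})]
  (hι : ∀ y, IsSmoothEmbedding (𝓡 n) (𝓡 𝒢.dim) ∞
    (Subtype.val : 𝒢.groupoid.src ⁻¹' {y} → 𝒢.arrows))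

/-- The source fiber at `x`. -/
noncomputable def sourceFiber (hA : D.IsLieAlgebroid) (x : O.carrier) : SourceFiber 𝒢 x where
  carrier := 𝒢.groupoid.src ⁻¹' {x}
  topology := inferInstance
  charted := inferInstance
  manifold := inferInstance
  incl := Subtype.val
  embedding := hι x
  range_incl := Subtype.range_val
  realization := O.push (𝒢.fiberRealization hι (O.C_swap hA) x)
  realization_h _ := rfl
  realization_θ s v := by
    have h1 := 𝒢.maurerCartan_frame hι s.1 ((𝒢.fiberRealization hι (O.C_swap hA) x).θ s v)
    rw [𝒢.frame_fiberRealization hι (O.C_swap hA) x s v] at h1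
    exact h1.symm

variable (hA : D.IsLieAlgebroid)

/-- Right translation carries frame to frame and preserves targets, so it preserves both the coframe
and the map to X. -/
theorem isDevelopment_rightMul (k : 𝒢.arrows) {y : O.carrier} (hk : 𝒢.groupoid.tgt k = y) :
    IsDevelopment (O.push (𝒢.fiberRealization hι (O.C_swap hA) y))
      (O.push (𝒢.fiberRealization hι (O.C_swap hA) (𝒢.groupoid.src k))) univ
      (𝒢.groupoid.rightMul k hk) where
  contMDiffAt s _ := 𝒢.groupoid.contMDiff_rightMul hι k hk s
  θ s _ v := by
    apply 𝒢.injective_frame hι (𝒢.groupoid.rightMul k hk s).1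
    have h1 := 𝒢.frame_fiberRealization hι (O.C_swap hA) _ (𝒢.groupoid.rightMul k hk s)
      (mfderiv (𝓡 n) (𝓡 n) (𝒢.groupoid.rightMul k hk) s v)
    have h2 := 𝒢.groupoid.mfderiv_val_mfderiv_rightMul hι k hk s v
    have h3 := 𝒢.dRight_frame hι (g := s.1) (Eq.trans s.2 hk.symm)
      ((𝒢.fiberRealization hι (O.C_swap hA) y).θ s v)
    rw [𝒢.frame_fiberRealization hι (O.C_swap hA) y s v] at h3
    exact h1.trans (h2.trans h3)
  h s _ := congrArg O.incl (𝒢.groupoid.tgt_mul _ _ (Eq.trans s.2 hk.symm))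

/-- One development σ₀ near p, into the source fiber over the point y of the orbit with image h p,
generates all others by right translation. The domain on which it is defined therefore serves for
every development into s⁻¹(x). -/
theorem evenlyExtends_developments {M : Type v} [TopologicalSpace M]
    [ChartedSpace (EuclideanSpace ℝ (Fin n)) M] [IsManifold (𝓡 n) ∞ M] (R : Realization D M)
    (hR : range R.h ⊆ range O.incl) (x : O.carrier) :
    (developments R (O.push (𝒢.fiberRealization hι (O.C_swap hA) x))).EvenlyExtends := by
  have := ChartedSpace.locallyConnectedSpace (EuclideanSpace ℝ (Fin n)) M
  intro p
  obtain ⟨y, hy⟩ := hR (mem_range_self p)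
  obtain ⟨U, σ₀, hU, hp, hσ₀, hd⟩ := exists_isDevelopment R
    (O.push (𝒢.fiberRealization hι (O.C_swap hA) y)) (p := p) (p' := 𝒢.groupoid.unit y)
    (hy.symm.trans (congrArg O.incl (𝒢.groupoid.tgt_one y).symm))
  have hUo : IsOpen (connectedComponentIn U p) := hU.connectedComponentIn
  refine ⟨connectedComponentIn U p, hUo, mem_connectedComponentIn hp,
    isPreconnected_connectedComponentIn, ?_⟩
  rintro q hq s ⟨U', σ', ⟨-, hσ'⟩, hq', rfl⟩
  have hqU : q ∈ U := connectedComponentIn_subset _ _ hq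
  -- Both targets have image h q in X. Injectivity of the immersion `O.incl` makes them equal in the
  -- orbit, so that σ₀(q)⁻¹ and σ'(q) are composable.
  have ht : 𝒢.groupoid.tgt (σ₀ q).1 = 𝒢.groupoid.tgt (σ' q).1 :=
    O.injective ((hd.h q hqU).trans (hσ'.h q hq').symm)
  -- The arrow from x to y whose right translation takes σ₀(q) to σ'(q).
  set k := 𝒢.groupoid.mul (𝒢.groupoid.inv (σ₀ q).1) (σ' q).1 with hk
  have hc : 𝒢.groupoid.src (𝒢.groupoid.inv (σ₀ q).1) = 𝒢.groupoid.tgt (σ' q).1 :=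
    (𝒢.groupoid.src_inv _).trans ht
  have hkt : 𝒢.groupoid.tgt k = y :=
    (𝒢.groupoid.tgt_mul _ _ hc).trans ((𝒢.groupoid.tgt_inv _).trans (σ₀ q).2)
  have hks : 𝒢.groupoid.src k = x := (𝒢.groupoid.src_mul _ _ hc).trans (σ' q).2
  have hmul : 𝒢.groupoid.mul (σ₀ q).1 k = (σ' q).1 := by
    rw [hk, ← 𝒢.groupoid.mul_assoc _ _ _ (𝒢.groupoid.tgt_inv _).symm hc, 𝒢.groupoid.mul_inv, ht,
      𝒢.groupoid.one_mul]
  clear_value k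
  clear hk
  subst hks
  refine ⟨𝒢.groupoid.rightMul k hkt ∘ σ₀, ⟨hUo, (𝒢.isDevelopment_rightMul hι hA k hkt).comp
    (hd.mono (connectedComponentIn_subset _ _)) fun _ _ => mem_univ _⟩, Subtype.ext hmul⟩

end Integration

end CartanRealization

/-! ### Conclusion: development along a source fiber, starting at a unit. -/

open CartanRealization in
theorem mainTheorem5 {n d : ℕ} {X : Type u} [TopologicalSpace X] [T2Space X]
    [ChartedSpace (EuclideanSpace ℝ (Fin d)) X] [IsManifold (𝓡 d) ∞ X]
    (D : CartanData n d X) (hA : D.IsLieAlgebroid) (hD : D.WeaklyIntegrable)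
    {M : Type v} [TopologicalSpace M] [T2Space M] [ConnectedSpace M]
    [ChartedSpace (EuclideanSpace ℝ (Fin n)) M] [IsManifold (𝓡 n) ∞ M]
    (R : Realization D M) :
    ∃ x₀ : X, Set.range R.h ⊆ D.orbit x₀ ∧
      (∃ O : OrbitManifold D x₀, Nonempty (Integration O.restriction)) ∧
      ∀ (O : OrbitManifold D x₀) (𝒢 : Integration O.restriction),
        ∃ (x : O.carrier) (S : SourceFiber 𝒢 x) (V : TopologicalSpace.Opens S.carrier),
          EquivalentUpToCover R S.realization V := by
  obtain ⟨p₀⟩ : Nonempty M := inferInstance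
  refine ⟨R.h p₀, R.range_h_subset_orbit p₀, hD _, fun O 𝒢 => ?_⟩
  obtain ⟨x, hx⟩ : R.h p₀ ∈ Set.range O.incl := by
    rw [O.range_incl]
    exact R.range_h_subset_orbit p₀ ⟨p₀, rfl⟩
  -- The fibers must be manifolds modelled on ℝⁿ itself, so the abstract complement in the
  -- submersion charts is replaced by `EuclideanSpace ℝ (Fin n)` through the dimension count.
  have hs := isSubmersionOfComplement_euclideanSpace 𝒢.groupoid.submersion_src (𝒢.dim_eq x)
  let _ := fun y => fiberChartedSpace hs y
  have := fun y => isManifold_fiber hs y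
  have hι := fun y => isSmoothEmbedding_fiber hs y
  have := 𝒢.groupoid.t2_fiber x
  have hL := 𝒢.evenlyExtends_developments hι hA R
    (O.range_incl ▸ R.range_h_subset_orbit p₀) x
  have hV := exists_equivalentUpToCover hL (s₀ := 𝒢.groupoid.unit x)
    (hx.symm.trans (congrArg O.incl (𝒢.groupoid.tgt_one x).symm))
  exact ⟨x, 𝒢.sourceFiber hι hA x, hV⟩
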